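/- Let $\tfrac12<H<\tfrac34$, $a>0$ and $T>0$. Let $B^{H,1},B^{H,2}$ be two independent fractional Brownian motions with Hurst index $H$ on a probability space, that is, centered Gaussian processes $(B^{H,j}_t)_{t\ge 0}$ with almost surely continuous paths and $$E\big[B^{H,j}_tB^{H,j}_s\big]=\tfrac12\big(t^{2H}+s^{2H}-|t-s|^{2H}\big),\qquad s,t\ge 0 .$$ Let $X=(X^{1},X^{2})$ be the two-dimensional linear fractional self-attracting diffusion on $[0,T]$: a process with almost surely continuous paths such that, almost surely, $$X^{j}_t=B^{H,j}_t-a\int_0^t\int_0^u\big(X^{j}_u-X^{j}_v\big)\,dv\,du,\qquad 0\le t\le T,\ j=1,2 .$$ For $\varepsilon>0$ put $$\beta_T^{H,\varepsilon}=\int_0^T\int_0^t p_\varepsilon(X_t-X_s)\,ds\,dt,\qquad p_\varepsilon(x)=\frac1{2\pi\varepsilon}e^{-|x|^2/(2\varepsilon)},\quad x\in\mathbb R^2 .$$ Then $\beta_T^{H,\varepsilon}\in L^2$ for every $\varepsilon>0$, and the centered variables $\beta_T^{H,\varepsilon}-E\big[\beta_T^{H,\varepsilon}\big]$ converge in $L^2$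 as $\varepsilon\downarrow 0$: there is a random variable $Z\in L^2$ such that $$\lim_{\varepsilon\downarrow 0}E\Big[\big(\beta_T^{H,\varepsilon}-E[\beta_T^{H,\varepsilon}]-Z\big)^2\Big]=0 .$$ -/

import Mathlib

open MeasureTheory ProbabilityTheory Filter Topology
open scoped NNReal ENNReal

/-- Fractional Brownian motion `(B_t)_{t ≥ 0}` with Hurst index `H`: a centered Gaussian process
with (almost surely) continuous paths and covariance
`E[B_t B_s] = (t^{2H} + s^{2H} - |t - s|^{2H}) / 2`. Processes are indexed by `ℝ`, but only
times `t ≥ 0` matter. -/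
structure IsFractionalBrownianMotion {Ω : Type*} [MeasurableSpace Ω] (H : ℝ)
    (B : ℝ → Ω → ℝ) (P : Measure Ω) : Prop where
  isGaussianProcess : IsGaussianProcess (fun t : ℝ≥0 => B (t : ℝ)) P
  centered : ∀ t : ℝ, 0 ≤ t → ∫ ω, B t ω ∂P = 0
  covariance : ∀ t s : ℝ, 0 ≤ t → 0 ≤ s →
    ∫ ω, B t ω * B s ω ∂P
      = 1 / 2 * (t ^ (2 * H) + s ^ (2 * H) - |t - s| ^ (2 * H))
  continuous_paths : ∀ᵐ ω ∂P, ContinuousOn (fun t => B t ω) (Set.Ici 0)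

/-- The real process `(X_t)_{0 ≤ t ≤ T}` has continuous paths and solves
`X_t = B_t - a ∫_0^t ∫_0^u (X_u - X_v) dv du`, `0 ≤ t ≤ T`, almost surely. -/
structure IsLinearSelfAttractingDiffusion {Ω : Type*} [MeasurableSpace Ω] (a T : ℝ)
    (B X : ℝ → Ω → ℝ) (P : Measure Ω) : Prop where
  aemeasurable : ∀ t ∈ Set.Icc 0 T, AEMeasurable (X t) P
  continuous_paths : ∀ᵐ ω ∂P, ContinuousOn (fun t => X t ω) (Set.Icc 0 T)
  equation : ∀ᵐ ω ∂P, ∀ t ∈ Set.Icc 0 T,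
    X t ω = B t ω - a * ∫ u in (0 : ℝ)..t, ∫ v in (0 : ℝ)..u, (X u ω - X v ω)

/-- The planar linear fractional self-attracting diffusion `X = (X^1, X^2)` on `[0, T]`, driven
by two independent fractional Brownian motions `B^1, B^2` with Hurst index `H`. -/
structure IsPlanarFractionalSelfAttractingDiffusion {Ω : Type*} [MeasurableSpace Ω]
    (H a T : ℝ) (B : Fin 2 → ℝ → Ω → ℝ) (X : ℝ → Ω → EuclideanSpace ℝ (Fin 2))
    (P : Measure Ω) : Prop where
  fbm : ∀ j, IsFractionalBrownianMotion H (B j) P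
  indep : iIndepFun (fun (j : Fin 2) (ω : Ω) (t : ℝ≥0) => B j (t : ℝ) ω) P
  solution : ∀ j, IsLinearSelfAttractingDiffusion a T (B j) (fun t ω => X t ω j) P

/-- The heat kernel `p_ε(x) = (2πε)⁻¹ exp(-|x|² / (2ε))` on the Euclidean plane. -/
noncomputable def planarHeatKernel (ε : ℝ) (x : EuclideanSpace ℝ (Fin 2)) : ℝ :=
  1 / (2 * Real.pi * ε) * Real.exp (-(‖x‖ ^ 2 / (2 * ε)))

/-- The smoothed self-intersection local time
`β_T^ε = ∫_0^T ∫_0^t p_ε(X_t - X_s) ds dt`. -/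
noncomputable def smoothedSelfIntersectionLocalTime {Ω : Type*}
    (X : ℝ → Ω → EuclideanSpace ℝ (Fin 2)) (T ε : ℝ) (ω : Ω) : ℝ :=
  ∫ t in (0 : ℝ)..T, ∫ s in (0 : ℝ)..t, planarHeatKernel ε (X t ω - X s ω)

/-! A family in `L²` converges as `ε ↓ 0` as soon as the inner products of its members at `ε` and
`η` converge when `ε` and `η` tend to `0` independently
(`exists_tendsto_eLpNorm_of_tendsto_integral_mul`). For the centered local times, Fubini turns this
inner product into an integral, over pairs of time intervals `[s, t]` and `[s', t']`, of the
covariance of the two kernels. Let `λ`, `ρ` be the variances of the increments of one coordinate of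
`X` over these intervals and `μ` their covariance. Independence of the two coordinates squares the
one-dimensional Gaussian density, so the square roots disappear, and the covariance is `(4π²)⁻¹ μ² /
(λ_ε ρ_η (λ_ε ρ_η - μ²))` with `λ_ε = λ + ε`, `ρ_η = ρ + η` (`covariance_incrementKernel`).
Smoothing only enlarges the denominator, so dominated convergence applies once the expression at `ε
= η = 0` is integrable.

That integrability is the heart of the matter (`exists_ratio_le_pairWeight`): the ratio is at most a
constant times the product of the powers `-4H/3` of the three gaps between the four ordered end
points. Each factor is integrable because `4H/3 < 1`, and the product is integrated along the chain
of points.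

The pointwise bound rests on two facts. The first is local nondeterminism
(`exists_le_incrementCov_form`): the quadratic form of the two increments dominates `(q - p)^(2H)`
times the square of the weight that it puts on a gap `[p, q]`. It follows by Cauchy-Schwarz from a
dual variable `ζ` with `E[ζ²] ≤ M (q - p)^(-2H)` for which `E[ζ X_t]` rises from `0` to `1` across
`[p, q]`. The solution map is linear, so `E[ζ X]` solves the equation driven by `E[ζ B]`; it is thus
enough to find a path in the Cameron-Martin space of `B` whose solution is a smooth step
(`exists_localized_path`). Its norm is estimated by writing `|x|^(2H)` as a mixture of exponentials,
which makes the covariance of `B` a mixture of covariances of integrated Ornstein-Uhlenbeck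
processes (`sum_fbmCov_eq`), and by keeping only the frequencies of order `1/(q - p)`.

The second fact is an upper bound for `μ`. For fractional Brownian motion it comes from differences
of `x ↦ x^(2H)`, and the drift changes `μ` by at most a multiple of the product of the two lengths
(`exists_abs_incrementCov_sub_le`). When the intervals overlap partially, local nondeterminism alone
suffices; nested and disjoint intervals need both facts. -/

/-! ### The self-attracting equation for a deterministic driving path. -/

/-- The weighted memory `∫₀ᵘ v dX_v` of the solution of the linear self-attracting equation driven
by the path `b`. -/
noncomputable def memoryDrift (a : ℝ) (b : ℝ → ℝ) (u : ℝ) : ℝ :=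
  u * b u - Real.exp (-(a * u ^ 2 / 2)) *
    ∫ v in (0 : ℝ)..u, (1 + a * v ^ 2) * Real.exp (a * v ^ 2 / 2) * b v

/-- The explicit solution of the linear self-attracting equation driven by the path `b`. -/
noncomputable def selfAttractingPath (a : ℝ) (b : ℝ → ℝ) (t : ℝ) : ℝ :=
  b t - a * ∫ u in (0 : ℝ)..t, memoryDrift a b u

/-- The inner integral `y u` is formally `∫₀ᵘ v dx_v`, so `dy = t db - a t y dt`. This is a linear
equation with integrating factor `exp (a t² / 2)`; integrating by parts leaves `b` undifferentiated
and gives `memoryDrift`. -/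
lemma eq_selfAttractingPath_of_continuous {a T : ℝ} {b x : ℝ → ℝ} (hx : Continuous x)
    (h : ∀ t ∈ Set.Icc 0 T,
      x t = b t - a * ∫ u in (0 : ℝ)..t, ∫ v in (0 : ℝ)..u, (x u - x v)) :
    ∀ t ∈ Set.Icc 0 T, x t = selfAttractingPath a b t := by
  set y : ℝ → ℝ := fun u => u * x u - ∫ v in (0 : ℝ)..u, x v with hy
  have hI : ∀ t, HasDerivAt (fun t => ∫ v in (0 : ℝ)..t, x v) (x t) t := fun t =>
    hx.integral_hasStrictDerivAt 0 t |>.hasDerivAt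
  have hIc : Continuous (fun t => ∫ v in (0 : ℝ)..t, x v) :=
    continuous_iff_continuousAt.2 fun t => (hI t).continuousAt
  have hyc : Continuous y := (continuous_id.mul hx).sub hIc
  have hyeq : ∀ u, (∫ v in (0 : ℝ)..u, (x u - x v)) = y u := fun u => by
    rw [intervalIntegral.integral_sub (by simp) (hx.intervalIntegrable _ _)]
    simp [hy]
  simp only [hyeq] at h
  have hJ : ∀ t, HasDerivAt (fun t => ∫ v in (0 : ℝ)..t, y v) (y t) t := fun t =>
    hyc.integral_hasStrictDerivAt 0 t |>.hasDerivAt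
  have hE : ∀ t : ℝ, HasDerivAt (fun t : ℝ => Real.exp (a * t ^ 2 / 2))
      (Real.exp (a * t ^ 2 / 2) * (a * t)) t := fun t => by
    have : HasDerivAt (fun t : ℝ => a * t ^ 2 / 2) (a * t) t := by
      exact (((hasDerivAt_id t).pow 2).const_mul a |>.div_const 2).congr_deriv (by simp; ring)
    exact this.exp
  -- On `[0, T]` this is `exp (a t² / 2) * (y t - t * b t)`. Written through the primitives of `y`
  -- and `x` it is differentiable although `b` has no assumed regularity.
  set N : ℝ → ℝ := fun t => Real.exp (a * t ^ 2 / 2) *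
    (-(a * t * ∫ v in (0 : ℝ)..t, y v) - ∫ v in (0 : ℝ)..t, x v) with hN
  set N' : ℝ → ℝ := fun t => Real.exp (a * t ^ 2 / 2) * (a * t) *
    (-(a * t * ∫ v in (0 : ℝ)..t, y v) - ∫ v in (0 : ℝ)..t, x v) +
    Real.exp (a * t ^ 2 / 2) * (-(a * (∫ v in (0 : ℝ)..t, y v) + a * t * y t) - x t) with hN'
  have hND : ∀ t, HasDerivAt N (N' t) t := fun t => by
    have h1 : HasDerivAt (fun t => a * t) a t := by simpa using (hasDerivAt_id t).const_mul a
    exact (hE t).mul (((h1.mul (hJ t)).neg).sub (hI t))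
  have hJc : Continuous (fun t => ∫ v in (0 : ℝ)..t, y v) :=
    continuous_iff_continuousAt.2 fun t => (hJ t).continuousAt
  have hN'c : Continuous N' := by
    simp only [hN']; fun_prop
  have key : ∀ t ∈ Set.Icc 0 T, y t = memoryDrift a b t := fun t ht => by
    have h1 := intervalIntegral.integral_eq_sub_of_hasDerivAt (a := 0) (b := t)
      (fun s _ => hND s) (hN'c.intervalIntegrable _ _)
    have h2 : (∫ s in (0 : ℝ)..t, N' s) =
        ∫ s in (0 : ℝ)..t, -((1 + a * s ^ 2) * Real.exp (a * s ^ 2 / 2) * b s) := by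
      refine intervalIntegral.integral_congr fun s hs => ?_
      rw [Set.uIcc_of_le ht.1] at hs
      have hs' := h s ⟨hs.1, hs.2.trans ht.2⟩
      simp only [hN']
      have e1 : (∫ v in (0 : ℝ)..s, x v) = s * x s - y s := by simp [hy]
      rw [e1]
      have e2 : a * (∫ v in (0 : ℝ)..s, y v) = b s - x s := by linarith
      have e3 : a * s * (∫ v in (0 : ℝ)..s, y v) = s * (b s - x s) := by rw [← e2]; ring
      rw [e2, e3]; ring
    rw [h2, intervalIntegral.integral_neg] at h1
    have h3 : N 0 = 0 := by simp [hN]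
    have h4 : N t = Real.exp (a * t ^ 2 / 2) * (y t - t * b t) := by
      have ht' := h t ht
      have e1 : (∫ v in (0 : ℝ)..t, x v) = t * x t - y t := by simp [hy]
      have e3 : a * t * (∫ v in (0 : ℝ)..t, y v) = t * (b t - x t) := by
        have e2 : a * (∫ v in (0 : ℝ)..t, y v) = b t - x t := by linarith
        rw [← e2]; ring
      simp only [hN]; rw [e1, e3]; ring
    rw [h3, h4, sub_zero] at h1
    have h5 : Real.exp (-(a * t ^ 2 / 2)) * Real.exp (a * t ^ 2 / 2) = 1 := by
      rw [← Real.exp_add]; simp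
    unfold memoryDrift
    linear_combination Real.exp (-(a * t ^ 2 / 2)) * (-h1) - (y t - t * b t) * h5
  intro t ht
  rw [h t ht, selfAttractingPath]
  congr 2
  refine intervalIntegral.integral_congr fun s hs => ?_
  rw [Set.uIcc_of_le ht.1] at hs
  exact key s ⟨hs.1, hs.2.trans ht.2⟩

/-- Every solution of the linear self-attracting equation is given by the explicit formula. -/
lemma eq_selfAttractingPath {a T : ℝ} (hT : 0 ≤ T) {b x : ℝ → ℝ}
    (hx : ContinuousOn x (Set.Icc 0 T))
    (h : ∀ t ∈ Set.Icc 0 T,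
      x t = b t - a * ∫ u in (0 : ℝ)..t, ∫ v in (0 : ℝ)..u, (x u - x v)) :
    ∀ t ∈ Set.Icc 0 T, x t = selfAttractingPath a b t := by
  -- The equation only involves times in `[0, T]`, so `x` may be continued by constants to a
  -- continuous function on the line.
  set z : ℝ → ℝ := Set.IccExtend hT ((Set.Icc 0 T).domRestrict x) with hz
  have hzc : Continuous z := (continuousOn_iff_continuous_domRestrict.1 hx).Icc_extend'
  have hzx : ∀ t ∈ Set.Icc 0 T, z t = x t := fun t ht => by
    rw [hz, Set.IccExtend_of_mem _ _ ht]; rfl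
  intro t ht
  rw [← hzx t ht]
  refine eq_selfAttractingPath_of_continuous hzc (fun t ht => ?_) t ht
  rw [hzx t ht, h t ht]
  congr 2
  refine intervalIntegral.integral_congr fun u hu => ?_
  rw [Set.uIcc_of_le ht.1] at hu
  refine intervalIntegral.integral_congr fun v hv => ?_
  rw [Set.uIcc_of_le hu.1] at hv
  rw [hzx u ⟨hu.1, hu.2.trans ht.2⟩, hzx v ⟨hv.1, hv.2.trans (hu.2.trans ht.2)⟩]

lemma continuous_memoryDrift (a : ℝ) {b : ℝ → ℝ} (hb : Continuous b) :
    Continuous (memoryDrift a b) := by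
  have : Continuous fun u => ∫ v in (0 : ℝ)..u,
      (1 + a * v ^ 2) * Real.exp (a * v ^ 2 / 2) * b v :=
    intervalIntegral.continuous_primitive (fun _ _ =>
      Continuous.intervalIntegrable (by fun_prop) _ _) 0
  unfold memoryDrift
  fun_prop

lemma continuous_selfAttractingPath (a : ℝ) {b : ℝ → ℝ} (hb : Continuous b) :
    Continuous (selfAttractingPath a b) := by
  have : Continuous fun t => ∫ u in (0 : ℝ)..t, memoryDrift a b u :=
    intervalIntegral.continuous_primitive (fun _ _ =>
      (continuous_memoryDrift a hb).intervalIntegrable _ _) 0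
  unfold selfAttractingPath
  fun_prop

lemma memoryDrift_congr (a : ℝ) {b b' : ℝ → ℝ} {u : ℝ} (hu : 0 ≤ u)
    (h : ∀ v ∈ Set.Icc 0 u, b v = b' v) : memoryDrift a b u = memoryDrift a b' u := by
  rw [memoryDrift, memoryDrift, h u ⟨hu, le_rfl⟩]
  congr 2
  refine intervalIntegral.integral_congr fun v hv => ?_
  rw [Set.uIcc_of_le hu] at hv
  simp_rw [h v hv]

lemma selfAttractingPath_congr (a : ℝ) {b b' : ℝ → ℝ} {t : ℝ} (ht : 0 ≤ t)
    (h : ∀ v ∈ Set.Icc 0 t, b v = b' v) : selfAttractingPath a b t = selfAttractingPath a b' t := by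
  rw [selfAttractingPath, selfAttractingPath, h t ⟨ht, le_rfl⟩]
  congr 2
  refine intervalIntegral.integral_congr fun u hu => ?_
  rw [Set.uIcc_of_le ht] at hu
  exact memoryDrift_congr a hu.1 fun v hv => h v ⟨hv.1, hv.2.trans hu.2⟩

/-- The drift is bounded by the supremum of the driving path; this is what makes `X - B` Lipschitz
in time once tested against a fixed variable. -/
lemma abs_memoryDrift_le {a T M : ℝ} (ha : 0 ≤ a) {b : ℝ → ℝ}
    (hM : ∀ u ∈ Set.Icc 0 T, |b u| ≤ M) {u : ℝ} (hu : u ∈ Set.Icc 0 T) :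
    |memoryDrift a b u| ≤ T * (2 + a * T ^ 2) * Real.exp (a * T ^ 2 / 2) * M := by
  have hT : 0 ≤ T := hu.1.trans hu.2
  have hM0 : 0 ≤ M := (abs_nonneg _).trans (hM u hu)
  have hint : |∫ v in (0 : ℝ)..u, (1 + a * v ^ 2) * Real.exp (a * v ^ 2 / 2) * b v| ≤
      (1 + a * T ^ 2) * Real.exp (a * T ^ 2 / 2) * M * |u - 0| := by
    refine intervalIntegral.norm_integral_le_of_norm_le_const (f := fun v =>
      (1 + a * v ^ 2) * Real.exp (a * v ^ 2 / 2) * b v) fun v hv => ?_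
    rw [Set.uIoc_of_le hu.1] at hv
    have hv' : v ∈ Set.Icc 0 T := ⟨hv.1.le, hv.2.trans hu.2⟩
    have hv2 : v ^ 2 ≤ T ^ 2 := pow_le_pow_left₀ hv'.1 hv'.2 2
    rw [norm_mul, norm_mul, Real.norm_eq_abs, Real.norm_eq_abs, Real.norm_eq_abs, Real.abs_exp,
      abs_of_nonneg (by positivity : 0 ≤ 1 + a * v ^ 2)]
    gcongr
    exact hM v hv'
  rw [sub_zero, abs_of_nonneg hu.1] at hint
  have he : Real.exp (-(a * u ^ 2 / 2)) ≤ 1 := Real.exp_le_one_iff.2 (by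
    have := mul_nonneg ha (sq_nonneg u); linarith)
  have he1 : 1 ≤ Real.exp (a * T ^ 2 / 2) := Real.one_le_exp (by positivity)
  unfold memoryDrift
  calc _ ≤ |u * b u| + |Real.exp (-(a * u ^ 2 / 2)) * ∫ v in (0 : ℝ)..u,
          (1 + a * v ^ 2) * Real.exp (a * v ^ 2 / 2) * b v| := abs_sub _ _
    _ ≤ T * M * Real.exp (a * T ^ 2 / 2) +
        1 * ((1 + a * T ^ 2) * Real.exp (a * T ^ 2 / 2) * M * T) := by
      rw [abs_mul, abs_mul, Real.abs_exp, abs_of_nonneg hu.1]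
      refine add_le_add ?_ ?_
      · calc u * |b u| ≤ T * M := by gcongr; exacts [hu.2, hM u hu]
          _ ≤ _ := le_mul_of_one_le_right (by positivity) he1
      · refine mul_le_mul he (hint.trans ?_) (abs_nonneg _) zero_le_one
        gcongr
        exact hu.2
    _ = _ := by ring

/-! ### Fractional Brownian covariance as a mixture of Ornstein-Uhlenbeck covariances. -/

/-- The Cauchy-Schwarz inequality for interval integrals of continuous functions. -/
lemma sq_intervalIntegral_mul_le {f e : ℝ → ℝ} (hf : Continuous f) (he : Continuous e) {p q : ℝ}
    (hpq : p ≤ q) :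
    (∫ w in p..q, f w * e w) ^ 2 ≤ (∫ w in p..q, f w ^ 2) * ∫ w in p..q, e w ^ 2 := by
  have hquad : ∀ t : ℝ, 0 ≤ (∫ w in p..q, e w ^ 2) * (t * t) +
      (2 * ∫ w in p..q, f w * e w) * t + ∫ w in p..q, f w ^ 2 := fun t => by
    have h2 : (∫ w in p..q, (f w + t * e w) ^ 2) = (∫ w in p..q, e w ^ 2) * (t * t) +
        (2 * ∫ w in p..q, f w * e w) * t + ∫ w in p..q, f w ^ 2 := by
      have h3 : ∀ w, (f w + t * e w) ^ 2 = t * t * e w ^ 2 + 2 * t * (f w * e w) + f w ^ 2 :=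
        fun w => by ring
      simp_rw [h3]
      rw [intervalIntegral.integral_add (Continuous.intervalIntegrable (by fun_prop) _ _)
        (Continuous.intervalIntegrable (by fun_prop) _ _),
        intervalIntegral.integral_add (Continuous.intervalIntegrable (by fun_prop) _ _)
        (Continuous.intervalIntegrable (by fun_prop) _ _),
        intervalIntegral.integral_const_mul, intervalIntegral.integral_const_mul]
      ring
    rw [← h2]
    exact intervalIntegral.integral_nonneg hpq fun w _ => sq_nonneg _
  have hd := discrim_le_zero hquad
  unfold discrim at hd
  linarith

/-- The covariance function of fractional Brownian motion. -/
noncomputable def fbmCov (H u v : ℝ) : ℝ :=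
  1 / 2 * (u ^ (2 * H) + v ^ (2 * H) - |u - v| ^ (2 * H))

/-- The remainder `e^{-y} - 1 + y`. -/
noncomputable def expRemainder (y : ℝ) : ℝ := Real.exp (-y) - 1 + y

lemma expRemainder_nonneg (y : ℝ) : 0 ≤ expRemainder y := by
  have := Real.add_one_le_exp (-y); unfold expRemainder; linarith

lemma expRemainder_pos {y : ℝ} (hy : y ≠ 0) : 0 < expRemainder y := by
  have := Real.add_one_lt_exp (neg_ne_zero.2 hy); unfold expRemainder; linarith

lemma expRemainder_le_self {y : ℝ} (hy : 0 ≤ y) : expRemainder y ≤ y := by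
  have := Real.exp_le_one_iff.2 (neg_nonpos.2 hy); unfold expRemainder; linarith

lemma expRemainder_le_sq {y : ℝ} (hy : 0 ≤ y) (hy1 : y ≤ 1) : expRemainder y ≤ y ^ 2 := by
  have h := Real.abs_exp_sub_one_sub_id_le (x := -y) (by rwa [abs_neg, abs_of_nonneg hy])
  have := (abs_le.1 h).2
  unfold expRemainder
  nlinarith

lemma continuous_expRemainder : Continuous expRemainder := by unfold expRemainder; fun_prop

/-- Near `0` the remainder is quadratic and the integrand is `O(θ^(1-2H))`, integrable since `H <
1`; at infinity it is linear and the integrand is `O(θ^(-2H))`, integrable since `2H > 1`. -/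
lemma integrableOn_rpow_mul_expRemainder {H : ℝ} (hH : 1 / 2 < H) (hH1 : H < 1) :
    IntegrableOn (fun θ : ℝ => θ ^ (-1 - 2 * H) * expRemainder θ) (Set.Ioi 0) := by
  have hm : ∀ s : Set ℝ, AEStronglyMeasurable (fun θ : ℝ => θ ^ (-1 - 2 * H) * expRemainder θ)
      (volume.restrict s) := fun s =>
    ((measurable_id.pow_const _).mul continuous_expRemainder.measurable).aestronglyMeasurable
  rw [← Set.Ioc_union_Ioi_eq_Ioi zero_le_one]
  refine IntegrableOn.union ?_ ?_
  · have h1 : IntegrableOn (fun θ : ℝ => θ ^ (1 - 2 * H)) (Set.Ioc 0 1) := by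
      rw [← intervalIntegrable_iff_integrableOn_Ioc_of_le zero_le_one]
      exact intervalIntegral.intervalIntegrable_rpow' (by linarith)
    refine h1.mono' (hm _) ?_
    filter_upwards [ae_restrict_mem measurableSet_Ioc] with θ hθ
    have hp := Real.rpow_nonneg hθ.1.le (-1 - 2 * H)
    rw [Real.norm_of_nonneg (mul_nonneg hp (expRemainder_nonneg _))]
    calc _ ≤ θ ^ (-1 - 2 * H) * θ ^ (2 : ℕ) :=
          mul_le_mul_of_nonneg_left (expRemainder_le_sq hθ.1.le hθ.2) hp
      _ = _ := by
        rw [← Real.rpow_natCast, ← Real.rpow_add hθ.1]; congr 1; push_cast; ring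
  · have h1 : IntegrableOn (fun θ : ℝ => θ ^ (-2 * H)) (Set.Ioi 1) :=
      integrableOn_Ioi_rpow_of_lt (by linarith) one_pos
    refine h1.mono' (hm _) ?_
    filter_upwards [ae_restrict_mem measurableSet_Ioi] with θ hθ
    have h0 : (0 : ℝ) < θ := one_pos.trans hθ
    have hp := Real.rpow_nonneg h0.le (-1 - 2 * H)
    rw [Real.norm_of_nonneg (mul_nonneg hp (expRemainder_nonneg _))]
    calc _ ≤ θ ^ (-1 - 2 * H) * θ ^ (1 : ℝ) := by
          rw [Real.rpow_one]
          exact mul_le_mul_of_nonneg_left (expRemainder_le_self h0.le) hp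
      _ = _ := by rw [← Real.rpow_add h0]; congr 1; ring

/-- The normalizing constant in `K |x|^{2H} = ∫₀^∞ θ^{-1-2H} (e^{-θ|x|} - 1 + θ|x|) dθ`. -/
noncomputable def fbmConst (H : ℝ) : ℝ :=
  ∫ θ in Set.Ioi (0 : ℝ), θ ^ (-1 - 2 * H) * expRemainder θ

lemma fbmConst_pos {H : ℝ} (hH : 1 / 2 < H) (hH1 : H < 1) : 0 < fbmConst H := by
  have hpos : ∀ θ ∈ Set.Ioi (0 : ℝ), 0 < θ ^ (-1 - 2 * H) * expRemainder θ := fun θ hθ =>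
    mul_pos (Real.rpow_pos_of_pos hθ _) (expRemainder_pos (ne_of_gt hθ))
  refine (setIntegral_pos_iff_support_of_nonneg_ae ?_
    (integrableOn_rpow_mul_expRemainder hH hH1)).2 ?_
  · filter_upwards [ae_restrict_mem measurableSet_Ioi] with θ hθ using (hpos θ hθ).le
  · have h : Set.Ioi (0 : ℝ) ⊆
        Function.support fun θ : ℝ => θ ^ (-1 - 2 * H) * expRemainder θ :=
      fun θ hθ => (hpos θ hθ).ne'
    rw [Set.inter_eq_right.2 h]
    simp

lemma scaled_expRemainder {H x : ℝ} (hx : 0 < x) :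
    (fun θ : ℝ => θ ^ (-1 - 2 * H) * expRemainder (θ * x)) =ᵐ[volume.restrict (Set.Ioi 0)]
    (fun θ : ℝ => x ^ (1 + 2 * H) * ((x * θ) ^ (-1 - 2 * H) * expRemainder (x * θ))) := by
  filter_upwards [ae_restrict_mem measurableSet_Ioi] with θ hθ
  have hθ' : (0 : ℝ) < θ := hθ
  rw [Real.mul_rpow hx.le hθ'.le, mul_comm θ x]
  have : x ^ (1 + 2 * H) * x ^ (-1 - 2 * H) = 1 := by
    rw [← Real.rpow_add hx]; ring_nf; simp
  linear_combination (-θ ^ (-1 - 2 * H) * expRemainder (x * θ)) * this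

lemma integrableOn_scaled_expRemainder {H : ℝ} (hH : 1 / 2 < H) (hH1 : H < 1) {x : ℝ}
    (hx : 0 ≤ x) :
    IntegrableOn (fun θ : ℝ => θ ^ (-1 - 2 * H) * expRemainder (θ * x)) (Set.Ioi 0) := by
  rcases hx.eq_or_lt with rfl | hx
  · simp [expRemainder]
  · rw [IntegrableOn, integrable_congr (scaled_expRemainder hx)]
    refine Integrable.const_mul ?_ _
    have := (integrableOn_Ioi_comp_mul_left_iff
      (fun θ : ℝ => θ ^ (-1 - 2 * H) * expRemainder θ) 0 hx).2
      (by simpa using integrableOn_rpow_mul_expRemainder hH hH1)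
    exact this

lemma integral_scaled_expRemainder {H : ℝ} (hH : 1 / 2 < H) {x : ℝ} (hx : 0 ≤ x) :
    ∫ θ in Set.Ioi (0 : ℝ), θ ^ (-1 - 2 * H) * expRemainder (θ * x) =
      fbmConst H * x ^ (2 * H) := by
  rcases hx.eq_or_lt with rfl | hx
  · rw [Real.zero_rpow (by linarith)]; simp [expRemainder]
  · rw [integral_congr_ae (scaled_expRemainder hx), integral_const_mul,
      integral_comp_mul_left_Ioi (fun θ : ℝ => θ ^ (-1 - 2 * H) * expRemainder θ) 0 hx, mul_zero]
    change _ * (x⁻¹ * fbmConst H) = _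
    have : x ^ (1 + 2 * H) * x⁻¹ = x ^ (2 * H) := by
      rw [← Real.rpow_neg_one, ← Real.rpow_add hx]; ring_nf
    rw [← this]; ring

/-- `1 - e^{-θ (u - w)₊}`, the kernel of the integrated Ornstein-Uhlenbeck process. -/
noncomputable def ouKernel (θ u w : ℝ) : ℝ := 1 - Real.exp (-(θ * max (u - w) 0))

lemma continuous_ouKernel (θ u : ℝ) : Continuous (ouKernel θ u) := by
  unfold ouKernel; fun_prop

lemma ouKernel_of_le {θ u w : ℝ} (h : u ≤ w) : ouKernel θ u w = 0 := by
  simp [ouKernel, max_eq_right (sub_nonpos.2 h)]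

lemma ouKernel_of_ge {θ u w : ℝ} (h : w ≤ u) : ouKernel θ u w = 1 - Real.exp (-(θ * (u - w))) := by
  simp [ouKernel, max_eq_left (sub_nonneg.2 h)]

lemma integral_mul_ouKernel_eq {θ T u : ℝ} {f : ℝ → ℝ} (hf : Continuous f)
    (hu : u ∈ Set.Icc 0 T) :
    ∫ w in (0 : ℝ)..T, f w * ouKernel θ u w =
      ∫ w in (0 : ℝ)..u, f w * (1 - Real.exp (-(θ * (u - w)))) := by
  have hc := continuous_ouKernel θ u
  rw [← intervalIntegral.integral_add_adjacent_intervals (b := u)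
    (Continuous.intervalIntegrable (by fun_prop) _ _)
    (Continuous.intervalIntegrable (by fun_prop) _ _)]
  have h2 : ∫ w in u..T, f w * ouKernel θ u w = 0 := by
    refine intervalIntegral.integral_zero_ae (Eventually.of_forall fun w hw => ?_)
    rw [Set.uIoc_of_le hu.2] at hw
    rw [ouKernel_of_le hw.1.le, mul_zero]
  rw [h2, add_zero]
  refine intervalIntegral.integral_congr fun w hw => ?_
  rw [Set.uIcc_of_le hu.1] at hw
  simp only [ouKernel_of_ge hw.2]

/-- Both sides are `θ²` times the covariance of the integral of a stationary Ornstein-Uhlenbeck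
process of rate `θ`. On the right the initial value gives the product term and the driving white
noise gives the integral of the kernels. -/
lemma expRemainder_covariance {θ T u v : ℝ} (hθ : 0 < θ) (hu : u ∈ Set.Icc 0 T)
    (hv : v ∈ Set.Icc 0 T) :
    expRemainder (θ * u) + expRemainder (θ * v) - expRemainder (θ * |u - v|) =
      (1 - Real.exp (-(θ * u))) * (1 - Real.exp (-(θ * v))) +
        2 * θ * ∫ w in (0 : ℝ)..T, ouKernel θ u w * ouKernel θ v w := by
  wlog h : u ≤ v generalizing u v
  · have := this hv hu (le_of_not_ge h)
    rw [abs_sub_comm, mul_comm (1 - _), add_comm (expRemainder _), this]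
    simp_rw [mul_comm (ouKernel θ v _)]
  simp_rw [mul_comm (ouKernel θ u _)]
  rw [integral_mul_ouKernel_eq (continuous_ouKernel θ v) hu]
  have hα : ∀ x w : ℝ, Real.exp (-(θ * (x - w))) = Real.exp (-(θ * x)) * Real.exp (θ * w) :=
    fun x w => by rw [← Real.exp_add]; ring_nf
  set α := Real.exp (-(θ * u)) with hαd
  set β := Real.exp (-(θ * v)) with hβd
  have hexp : ∀ w : ℝ, HasDerivAt (fun w => Real.exp (θ * w)) (Real.exp (θ * w) * θ) w :=
    fun w => by
      simpa using (((hasDerivAt_id w).const_mul θ).exp)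
  have h1 : ∫ w in (0 : ℝ)..u, ouKernel θ v w * (1 - Real.exp (-(θ * (u - w)))) =
      (u - (α + β) * Real.exp (θ * u) / θ + α * β * Real.exp (θ * u) ^ 2 / (2 * θ)) -
      (0 - (α + β) * Real.exp (θ * 0) / θ + α * β * Real.exp (θ * 0) ^ 2 / (2 * θ)) := by
    have hc := continuous_ouKernel θ v
    refine intervalIntegral.integral_eq_sub_of_hasDerivAt (f := fun w =>
      (w - (α + β) * Real.exp (θ * w) / θ + α * β * Real.exp (θ * w) ^ 2 / (2 * θ)))
      (fun w hw => ?_) (Continuous.intervalIntegrable (by fun_prop) _ _)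
    rw [Set.uIcc_of_le hu.1] at hw
    rw [ouKernel_of_ge (hw.2.trans h), hα, hα]
    refine ((((hasDerivAt_id w).sub (((hexp w).const_mul (α + β)).div_const θ))).add
      ((((hexp w).pow 2).const_mul (α * β)).div_const (2 * θ))).congr_deriv ?_
    field_simp
    simp
    ring
  have h2 : α * Real.exp (θ * u) = 1 := by rw [hαd, ← Real.exp_add]; simp
  have h3 : Real.exp (-(θ * |u - v|)) = β * Real.exp (θ * u) := by
    rw [abs_sub_comm, abs_of_nonneg (sub_nonneg.2 h), hα]
  have h4 : |u - v| = v - u := by rw [abs_sub_comm, abs_of_nonneg (sub_nonneg.2 h)]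
  rw [h1]
  unfold expRemainder
  rw [h3, h4]
  simp only [mul_zero, Real.exp_zero]
  rw [← hαd, ← hβd]
  field_simp
  linear_combination (-1 + β * Real.exp (θ * u)) * (-h2 * 1) + h2

/-- The function `w ↦ χ w / θ * (1 - exp (-(θ * (u - w)))) + c w` is a primitive of the integrand on
`[0, u]`. A `C²` path is thereby represented at every frequency `θ`, with density `χ' / θ + χ`. -/
lemma eq_integral_ouKernel {θ T u : ℝ} {c χ χ' : ℝ → ℝ} (hθ : 0 < θ)
    (hc : ∀ t, HasDerivAt c (χ t) t) (hχ : ∀ t, HasDerivAt χ (χ' t) t) (hχ' : Continuous χ')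
    (hc0 : c 0 = 0) (hχ0 : χ 0 = 0) (hu : u ∈ Set.Icc 0 T) :
    c u = ∫ w in (0 : ℝ)..T, (χ' w / θ + χ w) * ouKernel θ u w := by
  have hχc : Continuous χ := continuous_iff_continuousAt.2 fun t => (hχ t).continuousAt
  rw [integral_mul_ouKernel_eq (by fun_prop) hu]
  rw [intervalIntegral.integral_eq_sub_of_hasDerivAt (f := fun w =>
    χ w / θ * (1 - Real.exp (-(θ * (u - w)))) + c w) (fun w _ => ?_)
    (Continuous.intervalIntegrable (by fun_prop) _ _)]
  · simp [hc0, hχ0]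
  · have hexp : HasDerivAt (fun w => Real.exp (-(θ * (u - w))))
        (Real.exp (-(θ * (u - w))) * θ) w := by
      have : HasDerivAt (fun w => -(θ * (u - w))) θ w :=
        (((hasDerivAt_id w).const_sub u).const_mul θ).neg.congr_deriv (by simp)
      exact this.exp
    refine ((((hχ w).div_const θ).mul (hexp.const_sub 1)).add (hc w)).congr_deriv ?_
    field_simp
    ring

/-- Integrating `expRemainder_covariance` against `θ^(-1-2H) dθ` writes the covariance form as an
integral of sums of squares, from which lower bounds can be read off frequency by frequency. -/
lemma sum_fbmCov_eq {H T : ℝ} (hH : 1 / 2 < H) (hH1 : H < 1) (s : Finset ℝ)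
    (hs : ∀ u ∈ s, u ∈ Set.Icc 0 T) (x : ℝ → ℝ) :
    IntegrableOn (fun θ : ℝ => θ ^ (-1 - 2 * H) * ((∑ u ∈ s, x u * (1 - Real.exp (-(θ * u)))) ^ 2
      + 2 * θ * ∫ w in (0 : ℝ)..T, (∑ u ∈ s, x u * ouKernel θ u w) ^ 2)) (Set.Ioi 0) ∧
    2 * fbmConst H * ∑ u ∈ s, ∑ v ∈ s, x u * x v * fbmCov H u v =
      ∫ θ in Set.Ioi (0 : ℝ), θ ^ (-1 - 2 * H) *
        ((∑ u ∈ s, x u * (1 - Real.exp (-(θ * u)))) ^ 2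
          + 2 * θ * ∫ w in (0 : ℝ)..T, (∑ u ∈ s, x u * ouKernel θ u w) ^ 2) := by
  set g : ℝ → ℝ → ℝ := fun x θ => θ ^ (-1 - 2 * H) * expRemainder (θ * x) with hg
  have hgi : ∀ x, 0 ≤ x → IntegrableOn (g x) (Set.Ioi 0) := fun x hx =>
    integrableOn_scaled_expRemainder hH hH1 hx
  have hi : ∀ u ∈ s, ∀ v ∈ s, IntegrableOn
      (fun θ => x u * x v * (g u θ + g v θ - g |u - v| θ)) (Set.Ioi 0) := fun u hu v hv =>
    (((hgi u (hs u hu).1).add (hgi v (hs v hv).1)).sub (hgi _ (abs_nonneg _))).const_mul _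
  have heq : (fun θ : ℝ => ∑ u ∈ s, ∑ v ∈ s, x u * x v * (g u θ + g v θ - g |u - v| θ))
      =ᵐ[volume.restrict (Set.Ioi 0)] (fun θ : ℝ => θ ^ (-1 - 2 * H) *
        ((∑ u ∈ s, x u * (1 - Real.exp (-(θ * u)))) ^ 2
          + 2 * θ * ∫ w in (0 : ℝ)..T, (∑ u ∈ s, x u * ouKernel θ u w) ^ 2)) := by
    filter_upwards [ae_restrict_mem measurableSet_Ioi] with θ hθ
    have hi2 : ∀ u ∈ s, ∀ v ∈ s, IntervalIntegrable
        (fun w => x u * ouKernel θ u w * (x v * ouKernel θ v w)) volume 0 T := fun u _ v _ =>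
      Continuous.intervalIntegrable (by have := continuous_ouKernel θ; fun_prop) _ _
    simp_rw [sq, Finset.sum_mul_sum]
    rw [intervalIntegral.integral_finsetSum fun u _ => Continuous.intervalIntegrable
      (continuous_finsetSum _ fun v _ => by have := continuous_ouKernel θ; fun_prop) _ _]
    rw [Finset.mul_sum, ← Finset.sum_add_distrib, Finset.mul_sum]
    refine Finset.sum_congr rfl fun u hu => ?_
    rw [intervalIntegral.integral_finsetSum fun v hv => hi2 u hu v hv, Finset.mul_sum,
      ← Finset.sum_add_distrib, Finset.mul_sum]
    refine Finset.sum_congr rfl fun v hv => ?_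
    have h1 := expRemainder_covariance (T := T) hθ (hs u hu) (hs v hv)
    have h2 : (∫ w in (0 : ℝ)..T, x u * ouKernel θ u w * (x v * ouKernel θ v w)) =
        x u * x v * ∫ w in (0 : ℝ)..T, ouKernel θ u w * ouKernel θ v w := by
      rw [← intervalIntegral.integral_const_mul]
      congr 1; ext w; ring
    rw [h2]
    simp only [hg]
    linear_combination x u * x v * θ ^ (-1 - 2 * H) * h1
  have hint : IntegrableOn (fun θ : ℝ => ∑ u ∈ s, ∑ v ∈ s,
      x u * x v * (g u θ + g v θ - g |u - v| θ)) (Set.Ioi 0) :=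
    integrable_finsetSum _ fun u hu => integrable_finsetSum _ fun v hv => hi u hu v hv
  refine ⟨(integrable_congr heq).1 hint, ?_⟩
  rw [← integral_congr_ae heq, integral_finsetSum _ fun u hu =>
    integrable_finsetSum _ fun v hv => hi u hu v hv, Finset.mul_sum]
  refine Finset.sum_congr rfl fun u hu => ?_
  rw [integral_finsetSum _ fun v hv => hi u hu v hv, Finset.mul_sum]
  refine Finset.sum_congr rfl fun v hv => ?_
  have hu0 := hgi u (hs u hu).1
  have hv0 := hgi v (hs v hv).1
  have e : ∀ y, 0 ≤ y → ∫ θ in Set.Ioi (0 : ℝ), g y θ = fbmConst H * y ^ (2 * H) :=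
    fun y hy => integral_scaled_expRemainder hH hy
  rw [integral_const_mul, integral_sub (f := fun θ => g u θ + g v θ) (hu0.add hv0)
      (hgi _ (abs_nonneg _)),
    integral_add hu0 hv0, e _ (hs u hu).1, e _ (hs v hv).1, e _ (abs_nonneg _)]
  unfold fbmCov
  ring

/-- Cameron-Martin type lower bound for the covariance of fractional Brownian motion: a path `c`
of class `C²` that is small at scale `r` is dominated by the covariance. -/
lemma sq_sum_le_sum_fbmCov {H T r D : ℝ} (hH : 1 / 2 < H) (hH1 : H < 1) (hT : 0 ≤ T) (hr : 0 < r)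
    (hD : 0 ≤ D) {c χ χ' : ℝ → ℝ}
    (hc : ∀ t, HasDerivAt c (χ t) t) (hχ : ∀ t, HasDerivAt χ (χ' t) t) (hχ' : Continuous χ')
    (hc0 : c 0 = 0) (hχ0 : χ 0 = 0)
    (hφ : ∀ θ ∈ Set.Ioc (1 / r) (2 / r), ∫ w in (0 : ℝ)..T, (χ' w / θ + χ w) ^ 2 ≤ D)
    (s : Finset ℝ) (hs : ∀ u ∈ s, u ∈ Set.Icc 0 T) (x : ℝ → ℝ) :
    (∑ u ∈ s, x u * c u) ^ 2 ≤ fbmConst H * 2 ^ (2 * H) * r ^ (1 - 2 * H) * D *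
      ∑ u ∈ s, ∑ v ∈ s, x u * x v * fbmCov H u v := by
  obtain ⟨hint, heq⟩ := sum_fbmCov_eq hH hH1 s hs x
  set S := ∑ u ∈ s, ∑ v ∈ s, x u * x v * fbmCov H u v with hS
  set A := (∑ u ∈ s, x u * c u) ^ 2 with hA
  have hχc : Continuous χ := continuous_iff_continuousAt.2 fun t => (hχ t).continuousAt
  have hcs : ∀ θ ∈ Set.Ioc (1 / r) (2 / r),
      A ≤ D * ∫ w in (0 : ℝ)..T, (∑ u ∈ s, x u * ouKernel θ u w) ^ 2 := fun θ hθ => by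
    have hθ0 : 0 < θ := lt_trans (by positivity) hθ.1
    have hec : Continuous fun w => ∑ u ∈ s, x u * ouKernel θ u w :=
      continuous_finsetSum _ fun v _ => by have := continuous_ouKernel θ; fun_prop
    have hfc : Continuous fun w => χ' w / θ + χ w := by fun_prop
    have h1 : ∑ u ∈ s, x u * c u =
        ∫ w in (0 : ℝ)..T, (χ' w / θ + χ w) * ∑ u ∈ s, x u * ouKernel θ u w := by
      simp_rw [Finset.mul_sum]
      rw [intervalIntegral.integral_finsetSum fun u _ => Continuous.intervalIntegrable
        (by have := continuous_ouKernel θ; fun_prop) _ _]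
      refine Finset.sum_congr rfl fun u hu => ?_
      rw [eq_integral_ouKernel hθ0 hc hχ hχ' hc0 hχ0 (hs u hu),
        ← intervalIntegral.integral_const_mul]
      congr 1; ext w; ring
    rw [hA, h1]
    refine (sq_intervalIntegral_mul_le hfc hec hT).trans ?_
    exact mul_le_mul_of_nonneg_right (hφ θ hθ)
      (intervalIntegral.integral_nonneg hT fun w _ => sq_nonneg _)
  -- The least value of `θ^(-2H)` on the window `(1/r, 2/r]`. The other frequencies and the square
  -- coming from the initial value are nonnegative and are dropped.
  set m : ℝ := (2 / r) ^ (-2 * H) with hm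
  have hm0 : 0 < m := by positivity
  have hlow : 2 * m * A * (1 / r) ≤ D * (2 * fbmConst H * S) := by
    rw [heq, ← integral_const_mul]
    have hsub : Set.Ioc (1 / r) (2 / r) ⊆ Set.Ioi (0 : ℝ) := fun θ hθ =>
      lt_trans (by positivity) hθ.1
    have hc1 : ∫ θ in Set.Ioc (1 / r) (2 / r), 2 * m * A = 2 * m * A * (1 / r) := by
      have : (2 / r - 1 / r) = 1 / r := by ring
      rw [setIntegral_const, measureReal_def, Real.volume_Ioc, this,
        ENNReal.toReal_ofReal (by positivity), smul_eq_mul, mul_comm]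
    rw [← hc1]
    refine (setIntegral_mono_on continuous_const.integrableOn_Ioc
      ((hint.mono_set hsub).const_mul D) measurableSet_Ioc fun θ hθ => ?_).trans
      (setIntegral_mono_set (hint.const_mul D) ?_ (Eventually.of_forall hsub))
    · have hθ0 : 0 < θ := hsub hθ
      have h1 := hcs θ hθ
      have h2 : m ≤ θ ^ (-2 * H) :=
        Real.rpow_le_rpow_of_nonpos hθ0 hθ.2 (by linarith)
      have h3 : θ ^ (-1 - 2 * H) * θ = θ ^ (-2 * H) := by
        nth_rw 2 [← Real.rpow_one θ]
        rw [← Real.rpow_add hθ0]; ring_nf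
      set I := ∫ w in (0 : ℝ)..T, (∑ u ∈ s, x u * ouKernel θ u w) ^ 2
      have hp := Real.rpow_nonneg hθ0.le (-1 - 2 * H)
      calc 2 * m * A ≤ 2 * θ ^ (-2 * H) * (D * I) := by gcongr
        _ = D * (θ ^ (-1 - 2 * H) * (2 * θ * I)) := by rw [← h3]; ring
        _ ≤ _ := by
          gcongr
          exact le_add_of_nonneg_left (sq_nonneg _)
    · filter_upwards [ae_restrict_mem measurableSet_Ioi] with θ hθ
      have hθ0 : (0 : ℝ) < θ := hθ
      have he0 : 0 ≤ ∫ w in (0 : ℝ)..T, (∑ u ∈ s, x u * ouKernel θ u w) ^ 2 :=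
        intervalIntegral.integral_nonneg hT fun w _ => sq_nonneg _
      positivity
  have hmr : m⁻¹ * r = 2 ^ (2 * H) * r ^ (1 - 2 * H) := by
    rw [hm, Real.div_rpow zero_le_two hr.le, ← Real.rpow_neg_one, Real.div_rpow (by positivity)
      (by positivity), ← Real.rpow_mul zero_le_two, ← Real.rpow_mul hr.le]
    rw [div_mul_eq_mul_div, mul_div_assoc]
    congr 1
    · ring_nf
    · nth_rw 1 [← Real.rpow_one r]
      rw [← Real.rpow_sub hr]; ring_nf
  have h5 : A ≤ m⁻¹ * r * (D * (fbmConst H * S)) := by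
    have : A = m⁻¹ * r * (m * A * (1 / r)) := by field_simp
    rw [this]
    refine mul_le_mul_of_nonneg_left ?_ (by positivity)
    linarith
  calc A ≤ _ := h5
    _ = _ := by rw [hmr]; ring

/-! ### Bump functions and localized Cameron-Martin paths. -/

lemma hasDerivAt_sq_max_zero (x : ℝ) : HasDerivAt (fun x : ℝ => (max 0 x) ^ 2) (2 * max 0 x) x := by
  rcases lt_trichotomy x 0 with h | rfl | h
  · rw [max_eq_left h.le, mul_zero]
    refine (hasDerivAt_const x (0 : ℝ)).congr_of_eventuallyEq ?_
    filter_upwards [gt_mem_nhds h] with y hy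
    simp [max_eq_left hy.le]
  · have : (fun x : ℝ => (max 0 x) ^ 2) =O[𝓝 0] fun x : ℝ => ‖x - 0‖ ^ 2 := by
      refine Asymptotics.IsBigO.of_bound 1 (Eventually.of_forall fun x => ?_)
      rw [one_mul, norm_pow, norm_pow, norm_norm, sub_zero, Real.norm_eq_abs, Real.norm_eq_abs,
        sq_abs, sq_abs]
      rcases le_total 0 x with h | h
      · rw [max_eq_right h]
      · rw [max_eq_left h, zero_pow two_ne_zero]; exact sq_nonneg x
    simpa using (this.hasFDerivAt one_lt_two).hasDerivAt
  · rw [max_eq_right h.le]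
    refine ((hasDerivAt_id x).pow 2 |>.congr_deriv (by simp)).congr_of_eventuallyEq ?_
    filter_upwards [lt_mem_nhds h] with y hy
    simp [max_eq_right hy.le]

/-- A `C¹` bump function supported in `[p, q]`. -/
noncomputable def bump (p q v : ℝ) : ℝ := (max 0 ((v - p) * (q - v))) ^ 2

/-- The derivative of `bump`. -/
noncomputable def bumpDeriv (p q v : ℝ) : ℝ := 2 * max 0 ((v - p) * (q - v)) * (p + q - 2 * v)

lemma hasDerivAt_bump (p q v : ℝ) : HasDerivAt (bump p q) (bumpDeriv p q v) v := by
  have h : HasDerivAt (fun v => (v - p) * (q - v)) (p + q - 2 * v) v :=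
    (((hasDerivAt_id v).sub_const p).mul ((hasDerivAt_id v).const_sub q)).congr_deriv
      (by simp; ring)
  exact (hasDerivAt_sq_max_zero _).comp v h

lemma continuous_bump (p q : ℝ) : Continuous (bump p q) := by unfold bump; fun_prop

lemma continuous_bumpDeriv (p q : ℝ) : Continuous (bumpDeriv p q) := by
  unfold bumpDeriv; fun_prop

lemma bump_nonneg (p q v : ℝ) : 0 ≤ bump p q v := sq_nonneg _

lemma max_bump_eq_zero {p q v : ℝ} (hpq : p < q) (hv : v ∉ Set.Ioo p q) :
    max 0 ((v - p) * (q - v)) = 0 := by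
  refine max_eq_left ?_
  by_cases h : p < v
  · have : q ≤ v := not_lt.1 fun h' => hv ⟨h, h'⟩
    nlinarith
  · nlinarith [not_lt.1 h]

lemma bump_eq_zero {p q v : ℝ} (hpq : p < q) (hv : v ∉ Set.Ioo p q) : bump p q v = 0 := by
  simp [bump, max_bump_eq_zero hpq hv]

lemma bumpDeriv_eq_zero {p q v : ℝ} (hpq : p < q) (hv : v ∉ Set.Ioo p q) :
    bumpDeriv p q v = 0 := by
  simp [bumpDeriv, max_bump_eq_zero hpq hv]

lemma max_bump_le {p q : ℝ} (v : ℝ) : max 0 ((v - p) * (q - v)) ≤ (q - p) ^ 2 :=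
  max_le (sq_nonneg _) (by nlinarith [sq_nonneg (v - p - (q - v))])

lemma bump_le {p q : ℝ} (v : ℝ) : bump p q v ≤ (q - p) ^ 4 := by
  calc bump p q v ≤ ((q - p) ^ 2) ^ 2 := pow_le_pow_left₀ (le_max_left _ _) (max_bump_le v) 2
    _ = _ := by ring

lemma abs_bumpDeriv_le {p q v : ℝ} (hpq : p < q) : |bumpDeriv p q v| ≤ 2 * (q - p) ^ 3 := by
  by_cases hv : v ∈ Set.Ioo p q
  · rw [bumpDeriv, abs_mul, abs_of_nonneg (mul_nonneg zero_le_two (le_max_left _ _))]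
    have h1 := max_bump_le (p := p) (q := q) v
    have h2 : |p + q - 2 * v| ≤ q - p := abs_le.2 ⟨by linarith [hv.2], by linarith [hv.1]⟩
    calc _ ≤ 2 * (q - p) ^ 2 * (q - p) := by gcongr
      _ = _ := by ring
  · rw [bumpDeriv_eq_zero hpq hv, abs_zero]
    have := sub_pos.2 hpq
    positivity

lemma integral_bump_eq_zero {p q t : ℝ} (hpq : p < q) (ht : 0 ≤ t) (htp : t ≤ p) :
    ∫ v in (0 : ℝ)..t, bump p q v = 0 := by
  refine intervalIntegral.integral_zero_ae (Eventually.of_forall fun v hv => ?_)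
  rw [Set.uIoc_of_le ht] at hv
  exact bump_eq_zero hpq fun h => absurd h.1 (not_lt.2 (hv.2.trans htp))

lemma integral_bump_eq {p q t : ℝ} (hp : 0 ≤ p) (hpq : p < q) (ht : q ≤ t) :
    ∫ v in (0 : ℝ)..t, bump p q v = (q - p) ^ 5 / 30 := by
  have hi : ∀ x y, IntervalIntegrable (bump p q) volume x y := fun x y =>
    (continuous_bump p q).intervalIntegrable _ _
  rw [← intervalIntegral.integral_add_adjacent_intervals (hi 0 p) (hi p t),
    integral_bump_eq_zero hpq hp le_rfl,
    ← intervalIntegral.integral_add_adjacent_intervals (hi p q) (hi q t)]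
  have h1 : ∫ v in q..t, bump p q v = 0 := by
    refine intervalIntegral.integral_zero_ae (Eventually.of_forall fun v hv => ?_)
    rw [Set.uIoc_of_le ht] at hv
    exact bump_eq_zero hpq fun h => absurd h.2 (not_lt.2 hv.1.le)
  have h2 : ∫ v in p..q, bump p q v =
      ((q - p) ^ 2 * (q - p) ^ 3 / 3 - (q - p) * (q - p) ^ 4 / 2 + (q - p) ^ 5 / 5) -
      ((q - p) ^ 2 * (p - p) ^ 3 / 3 - (q - p) * (p - p) ^ 4 / 2 + (p - p) ^ 5 / 5) := by
    refine intervalIntegral.integral_eq_sub_of_hasDerivAt (f := fun v =>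
      (q - p) ^ 2 * (v - p) ^ 3 / 3 - (q - p) * (v - p) ^ 4 / 2 + (v - p) ^ 5 / 5)
      (fun v hv => ?_) (hi p q)
    rw [Set.uIcc_of_le hpq.le] at hv
    have h0 := (hasDerivAt_id v).sub_const p
    refine (((((h0.pow 3).const_mul ((q - p) ^ 2)).div_const 3).sub
      (((h0.pow 4).const_mul (q - p)).div_const 2)).add ((h0.pow 5).div_const 5)).congr_deriv ?_
    rw [bump, max_eq_right (mul_nonneg (sub_nonneg.2 hv.1) (sub_nonneg.2 hv.2))]
    simp
    ring
  rw [h1, h2]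
  ring

/-- For every interval `[p, q]` there is a path in the Cameron-Martin space of fractional Brownian
motion, of squared norm `O((q-p)^{-2H})`, whose associated solution of the self-attracting
equation moves from `0` to `1` during `[p, q]` and is constant elsewhere. -/
lemma exists_localized_path {H a T : ℝ} (hH : 1 / 2 < H) (hH1 : H < 1) (ha : 0 ≤ a) (hT : 0 < T) :
    ∃ M : ℝ, 0 < M ∧ ∀ p q : ℝ, 0 ≤ p → p < q → q ≤ T → ∃ c : ℝ → ℝ, Continuous c ∧
      (∀ t ∈ Set.Icc 0 T, t ≤ p → selfAttractingPath a c t = 0) ∧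
      (∀ t ∈ Set.Icc 0 T, q ≤ t → selfAttractingPath a c t = 1) ∧
      ∀ (s : Finset ℝ) (x : ℝ → ℝ), (∀ u ∈ s, u ∈ Set.Icc 0 T) →
        (∑ u ∈ s, x u * c u) ^ 2 ≤
          M * (q - p) ^ (-2 * H) * ∑ u ∈ s, ∑ v ∈ s, x u * x v * fbmCov H u v := by
  set D₀ : ℝ := (3 + 2 * a * T ^ 2) ^ 2 + a ^ 2 * T ^ 4 with hD₀
  have hD₀p : 0 < D₀ := by positivity
  have hK := fbmConst_pos hH hH1
  -- The factor `900` is the square of the normalization `30 / r⁵`; with the energy bound `r⁹ * D₀`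
  -- and the factor `r^(1-2H)` the powers of `r` combine to `r^(-2H)`.
  refine ⟨900 * fbmConst H * 2 ^ (2 * H) * D₀, by positivity, fun p q hp hpq hq => ?_⟩
  set r := q - p with hr
  have hr0 : 0 < r := sub_pos.2 hpq
  have hrT : r ≤ T := by linarith
  set ψ := bump p q with hψ
  have hψc : Continuous ψ := continuous_bump p q
  have hψc' := continuous_bumpDeriv p q
  set Ψ : ℝ → ℝ := fun u => ∫ v in (0 : ℝ)..u, v * ψ v with hΨ
  set cX : ℝ → ℝ := fun u => ∫ v in (0 : ℝ)..u, ψ v with hcX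
  have hΨd : ∀ u, HasDerivAt Ψ (u * ψ u) u := fun u =>
    (((continuous_id.mul hψc).integral_hasStrictDerivAt 0 u).hasDerivAt)
  have hcXd : ∀ u, HasDerivAt cX (ψ u) u := fun u =>
    ((hψc.integral_hasStrictDerivAt 0 u).hasDerivAt)
  have hΨc : Continuous Ψ := continuous_iff_continuousAt.2 fun u => (hΨd u).continuousAt
  have hcXc : Continuous cX := continuous_iff_continuousAt.2 fun u => (hcXd u).continuousAt
  -- The solution `cX` is prescribed and the noise is recovered from the equation, where `Ψ u` is
  -- the memory integral of `cX`. The bump being `C¹`, the path `cB` is `C²`.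
  set cB : ℝ → ℝ := fun t => cX t + a * ∫ u in (0 : ℝ)..t, Ψ u with hcB
  set χ : ℝ → ℝ := fun t => ψ t + a * Ψ t with hχ
  set χ' : ℝ → ℝ := fun t => bumpDeriv p q t + a * (t * ψ t) with hχ'
  have hcBd : ∀ t, HasDerivAt cB (χ t) t := fun t =>
    (hcXd t).add (((hΨc.integral_hasStrictDerivAt 0 t).hasDerivAt).const_mul a)
  have hχd : ∀ t, HasDerivAt χ (χ' t) t := fun t =>
    (hasDerivAt_bump p q t).add ((hΨd t).const_mul a)
  have hχc : Continuous χ := by fun_prop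
  have hχ'c : Continuous χ' := by fun_prop
  have hmem : ∀ u, (∫ v in (0 : ℝ)..u, (cX u - cX v)) = Ψ u := fun u => by
    have h1 : ∀ w, HasDerivAt (fun w => w * cX w - ∫ v in (0 : ℝ)..w, cX v) (w * ψ w) w :=
      fun w => (((hasDerivAt_id w).mul (hcXd w)).sub
        (hcXc.integral_hasStrictDerivAt 0 w).hasDerivAt).congr_deriv (by simp)
    have h2 := intervalIntegral.integral_eq_sub_of_hasDerivAt (a := 0) (b := u)
      (fun w _ => h1 w) (Continuous.intervalIntegrable (by fun_prop) _ _)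
    rw [intervalIntegral.integral_sub (by simp) (hcXc.intervalIntegrable _ _)]
    simp only [hΨ]
    rw [h2]
    simp
  have hpath : ∀ k : ℝ, ∀ t ∈ Set.Icc 0 T,
      k * cX t = selfAttractingPath a (fun u => k * cB u) t := fun k =>
    eq_selfAttractingPath_of_continuous (x := fun u => k * cX u) (by fun_prop) fun t _ => by
      simp_rw [← mul_sub, intervalIntegral.integral_const_mul, hmem, hcB]
      ring
  set k : ℝ := 30 / r ^ 5 with hk
  have hcBc : Continuous cB := continuous_iff_continuousAt.2 fun u => (hcBd u).continuousAt
  have hD : ∀ θ ∈ Set.Ioc (1 / r) (2 / r),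
      ∫ w in (0 : ℝ)..T, (χ' w / θ + χ w) ^ 2 ≤ r ^ 9 * D₀ := fun θ hθ => by
    have hθ0 : 0 < θ := lt_trans (by positivity) hθ.1
    have hθr : 1 / θ ≤ r := by
      rw [div_le_iff₀ hθ0]
      have := hθ.1
      rw [div_lt_iff₀ hr0] at this
      linarith
    set g : ℝ → ℝ := fun w => (Set.Ioc p q).indicator (fun _ => r ^ 8 * (3 + 2 * a * T ^ 2) ^ 2) w
      + (a * T * r ^ 5) ^ 2 with hg
    have hΨb : ∀ w ∈ Set.Icc 0 T, |Ψ w| ≤ T * r ^ 5 := fun w hw => by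
      have h0 : 0 ≤ Ψ w := intervalIntegral.integral_nonneg hw.1 fun v hv =>
        mul_nonneg hv.1 (bump_nonneg p q v)
      rw [abs_of_nonneg h0]
      calc Ψ w ≤ ∫ v in (0 : ℝ)..w, T * ψ v := by
            refine intervalIntegral.integral_mono_on hw.1
              (Continuous.intervalIntegrable (by fun_prop) _ _)
              (Continuous.intervalIntegrable (by fun_prop) _ _) fun v hv => ?_
            exact mul_le_mul_of_nonneg_right (hv.2.trans hw.2) (bump_nonneg p q v)
        _ ≤ ∫ v in (0 : ℝ)..T, T * ψ v :=
            intervalIntegral.integral_mono_interval le_rfl hw.1 hw.2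
              (Eventually.of_forall fun v => mul_nonneg hT.le (bump_nonneg p q v))
              (Continuous.intervalIntegrable (by fun_prop) _ _)
        _ = T * (r ^ 5 / 30) := by
            rw [intervalIntegral.integral_const_mul, hψ, integral_bump_eq hp hpq hq]
        _ ≤ T * r ^ 5 := by
            gcongr
            have : 0 ≤ r ^ 5 := by positivity
            linarith
    have hpt : ∀ w ∈ Set.Icc 0 T, (χ' w / θ + χ w) ^ 2 ≤ g w := fun w hw => by
      have hb := hΨb w hw
      by_cases hw2 : w ∈ Set.Ioo p q
      · have hw3 : w ∈ Set.Ioc p q := ⟨hw2.1, hw2.2.le⟩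
        simp only [hg]
        rw [Set.indicator_of_mem hw3]
        have h1 := abs_bumpDeriv_le (v := w) hpq
        have h2 := bump_le (p := p) (q := q) w
        have h3 := bump_nonneg p q w
        have h4 : |χ' w| ≤ 2 * r ^ 3 + a * (T * r ^ 4) :=
          (abs_add_le _ _).trans (add_le_add h1 (by
            rw [abs_mul, abs_mul, abs_of_nonneg ha, abs_of_nonneg hw.1, abs_of_nonneg h3]
            gcongr
            exact hw.2))
        have h5 : |χ w| ≤ r ^ 4 + a * (T * r ^ 5) :=
          (abs_add_le _ _).trans (add_le_add (by rwa [abs_of_nonneg h3]) (by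
            rw [abs_mul, abs_of_nonneg ha]
            gcongr))
        have h6 : |χ' w / θ + χ w| ≤ r ^ 4 * (3 + 2 * a * T ^ 2) := by
          calc _ ≤ |χ' w / θ| + |χ w| := abs_add_le _ _
            _ = |χ' w| * (1 / θ) + |χ w| := by rw [abs_div, abs_of_pos hθ0]; ring
            _ ≤ (2 * r ^ 3 + a * (T * r ^ 4)) * r + (r ^ 4 + a * (T * r ^ 5)) := by gcongr
            _ = r ^ 4 * (3 + 2 * a * T * r) := by ring
            _ ≤ r ^ 4 * (3 + 2 * a * T * T) := by gcongr
            _ = _ := by ring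
        rw [← sq_abs]
        calc _ ≤ (r ^ 4 * (3 + 2 * a * T ^ 2)) ^ 2 := by gcongr
          _ = r ^ 8 * (3 + 2 * a * T ^ 2) ^ 2 := by ring
          _ ≤ _ := le_add_of_nonneg_right (sq_nonneg _)
      · have h1 : χ' w / θ + χ w = a * Ψ w := by
          simp only [hχ, hχ', hψ]
          rw [bump_eq_zero hpq hw2, bumpDeriv_eq_zero hpq hw2]; simp
        rw [h1, ← sq_abs, abs_mul, abs_of_nonneg ha]
        calc (a * |Ψ w|) ^ 2 ≤ (a * (T * r ^ 5)) ^ 2 := by gcongr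
          _ = (a * T * r ^ 5) ^ 2 := by ring
          _ ≤ _ := le_add_of_nonneg_left (Set.indicator_nonneg (fun _ _ => by positivity) _)
    have hind : IntervalIntegrable
        ((Set.Ioc p q).indicator (fun _ => r ^ 8 * (3 + 2 * a * T ^ 2) ^ 2)) volume 0 T := by
      rw [intervalIntegrable_iff_integrableOn_Ioc_of_le hT.le]
      exact (continuous_const.integrableOn_Ioc (μ := volume) (a := 0) (b := T)).indicator
        measurableSet_Ioc
    have hgi : IntervalIntegrable g volume 0 T := hind.add (by simp)
    calc _ ≤ ∫ w in (0 : ℝ)..T, g w := intervalIntegral.integral_mono_on hT.le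
          (Continuous.intervalIntegrable (by fun_prop) _ _) hgi hpt
      _ = r * (r ^ 8 * (3 + 2 * a * T ^ 2) ^ 2) + T * (a * T * r ^ 5) ^ 2 := by
          rw [intervalIntegral.integral_add hind (by simp), intervalIntegral.integral_const,
            intervalIntegral.integral_of_le hT.le, setIntegral_indicator measurableSet_Ioc,
            Set.inter_eq_right.2 (Set.Ioc_subset_Ioc hp hq), setIntegral_const]
          rw [measureReal_def, Real.volume_Ioc, ENNReal.toReal_ofReal hr0.le]
          simp
      _ = r ^ 9 * ((3 + 2 * a * T ^ 2) ^ 2 + a ^ 2 * T ^ 3 * r) := by ring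
      _ ≤ r ^ 9 * ((3 + 2 * a * T ^ 2) ^ 2 + a ^ 2 * T ^ 3 * T) := by gcongr
      _ = _ := by rw [hD₀]; ring
  refine ⟨fun u => k * cB u, by fun_prop, fun t ht htp => ?_, fun t ht htq => ?_,
    fun s x hs => ?_⟩
  · rw [← hpath k t ht]
    simp only [hcX]
    rw [integral_bump_eq_zero hpq ht.1 htp, mul_zero]
  · rw [← hpath k t ht]
    simp only [hcX]
    rw [integral_bump_eq hp hpq htq, hk, ← hr]
    field_simp
  · have hmain := sq_sum_le_sum_fbmCov hH hH1 hT.le hr0 (by positivity) hcBd hχd hχ'c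
      (by simp [hcB, hcX]) (by
        simp only [hχ, hΨ, hψ]
        rw [bump_eq_zero hpq fun h => absurd h.1 (not_lt.2 hp)]; simp) hD s hs x
    have h1 : ∑ u ∈ s, x u * (k * cB u) = k * ∑ u ∈ s, x u * cB u := by
      rw [Finset.mul_sum]; exact Finset.sum_congr rfl fun u _ => by ring
    rw [h1, mul_pow]
    refine (mul_le_mul_of_nonneg_left hmain (sq_nonneg k)).trans (le_of_eq ?_)
    have h2 : r ^ (1 - 2 * H) = r * r ^ (-2 * H) := by
      nth_rw 2 [← Real.rpow_one r]
      rw [← Real.rpow_add hr0]; ring_nf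
    rw [h2, hk]
    field_simp
    ring

/-! ### Measurability and expectations of the solution map. -/

section Measurability

variable {Ω : Type*} [MeasurableSpace Ω]

lemma measurable_intervalIntegral {Z : ℝ → Ω → ℝ} (hc : ∀ ω, Continuous fun t => Z t ω)
    (hm : ∀ t, Measurable (Z t)) (f : ℝ → ℝ) (hf : Continuous f) (s t : ℝ) :
    Measurable fun ω => ∫ v in s..t, f v * Z v ω := by
  have h := measurable_uncurry_of_continuous_of_measurable hc hm
  have h2 : StronglyMeasurable (Function.uncurry fun (ω : Ω) (v : ℝ) => f v * Z v ω) :=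
    ((hf.measurable.comp measurable_snd).mul (h.comp measurable_swap)).stronglyMeasurable
  exact (StronglyMeasurable.integral_prod_right h2
    (ν := volume.restrict (Set.Ioc s t))).measurable.sub
    (StronglyMeasurable.integral_prod_right h2 (ν := volume.restrict (Set.Ioc t s))).measurable

lemma measurable_memoryDrift (a : ℝ) {b : ℝ → Ω → ℝ} (hc : ∀ ω, Continuous fun t => b t ω)
    (hm : ∀ t, Measurable (b t)) (u : ℝ) :
    Measurable fun ω => memoryDrift a (fun v => b v ω) u :=
  ((hm u).const_mul _).sub
    ((measurable_intervalIntegral hc hm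
      (fun v => (1 + a * v ^ 2) * Real.exp (a * v ^ 2 / 2)) (by fun_prop) 0 u).const_mul _)

lemma measurable_selfAttractingPath (a : ℝ) {b : ℝ → Ω → ℝ} (hc : ∀ ω, Continuous fun t => b t ω)
    (hm : ∀ t, Measurable (b t)) (t : ℝ) :
    Measurable fun ω => selfAttractingPath a (fun v => b v ω) t := by
  have := measurable_intervalIntegral (Z := fun u ω => memoryDrift a (fun v => b v ω) u)
    (fun ω => continuous_memoryDrift a (hc ω)) (measurable_memoryDrift a hc hm)
    (fun _ => 1) (by fun_prop) 0 t
  simp only [one_mul] at this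
  exact (hm t).sub (this.const_mul _)

end Measurability

/-- A process with continuous paths and uniformly bounded second moments on `[0, T]`. -/
structure IsContinuousL2Process {Ω : Type*} [MeasurableSpace Ω] (T : ℝ) (Z : ℝ → Ω → ℝ)
    (P : Measure Ω) : Prop where
  continuous_path : ∀ ω, Continuous fun t => Z t ω
  measurable_eval : ∀ t, Measurable (Z t)
  memLp : ∀ t ∈ Set.Icc 0 T, MemLp (Z t) 2 P
  bound : ∃ K, 0 ≤ K ∧ ∀ t ∈ Set.Icc 0 T, ∫ ω, Z t ω ^ 2 ∂P ≤ K

section L2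

variable {Ω : Type*} [MeasurableSpace Ω] {P : Measure Ω}

lemma abs_integral_mul_le_sqrt {f g : Ω → ℝ} (hf : MemLp f 2 P) (hg : MemLp g 2 P) :
    ∫ ω, |f ω * g ω| ∂P ≤ √(∫ ω, f ω ^ 2 ∂P) * √(∫ ω, g ω ^ 2 ∂P) := by
  have hfa : MemLp (fun ω => |f ω|) (ENNReal.ofReal 2) P := by
    rw [ENNReal.ofReal_ofNat]; exact hf.abs
  have hga : MemLp (fun ω => |g ω|) (ENNReal.ofReal 2) P := by
    rw [ENNReal.ofReal_ofNat]; exact hg.abs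
  have h := integral_mul_le_Lp_mul_Lq_of_nonneg (μ := P) (p := 2) (q := 2)
    (Real.holderConjugate_iff.2 ⟨by norm_num, by norm_num⟩)
    (f := fun ω => |f ω|) (g := fun ω => |g ω|) (Eventually.of_forall fun _ => abs_nonneg _)
    (Eventually.of_forall fun _ => abs_nonneg _) hfa hga
  simp_rw [abs_mul]
  refine h.trans (le_of_eq ?_)
  simp [Real.sqrt_eq_rpow]

lemma integral_sub_sq_le {f g : Ω → ℝ} (hf : MemLp f 2 P) (hg : MemLp g 2 P) :
    ∫ ω, (f ω - g ω) ^ 2 ∂P ≤ 2 * (∫ ω, f ω ^ 2 ∂P) + 2 * ∫ ω, g ω ^ 2 ∂P := by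
  rw [← integral_const_mul, ← integral_const_mul,
    ← integral_add (hf.integrable_sq.const_mul 2) (hg.integrable_sq.const_mul 2)]
  refine integral_mono (hf.sub hg).integrable_sq
    ((hf.integrable_sq.const_mul 2).add (hg.integrable_sq.const_mul 2)) fun ω => ?_
  change (f ω - g ω) ^ 2 ≤ 2 * f ω ^ 2 + 2 * g ω ^ 2
  nlinarith [sq_nonneg (f ω + g ω)]

variable [IsProbabilityMeasure P] {T : ℝ} {Z : ℝ → Ω → ℝ}

lemma IsContinuousL2Process.integrable_prod (hZ : IsContinuousL2Process T Z P) {ζ : Ω → ℝ}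
    (hζ : MemLp ζ 2 P) {f : ℝ → ℝ} (hf : Continuous f) {s t : ℝ} (hs : 0 ≤ s) (ht : t ≤ T) :
    Integrable (fun z : ℝ × Ω => f z.1 * (ζ z.2 * Z z.1 z.2))
      ((volume.restrict (Set.Ioc s t)).prod P) := by
  obtain ⟨K, hK, hKb⟩ := hZ.bound
  have hm := measurable_uncurry_of_continuous_of_measurable hZ.continuous_path hZ.measurable_eval
  have hmem : ∀ v ∈ Set.Ioc s t, v ∈ Set.Icc 0 T := fun v hv => ⟨hs.trans hv.1.le, hv.2.trans ht⟩
  have haes : AEStronglyMeasurable (fun z : ℝ × Ω => f z.1 * (ζ z.2 * Z z.1 z.2))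
      ((volume.restrict (Set.Ioc s t)).prod P) :=
    (hf.measurable.comp measurable_fst).aestronglyMeasurable.mul
      (hζ.aestronglyMeasurable.comp_snd.mul hm.aestronglyMeasurable)
  rw [integrable_prod_iff haes]
  constructor
  · filter_upwards [ae_restrict_mem measurableSet_Ioc] with v hv
    exact (hζ.integrable_mul (hZ.memLp v (hmem v hv))).const_mul _
  · have hg : IntegrableOn (fun v => |f v| * (√(∫ ω, ζ ω ^ 2 ∂P) * √K)) (Set.Ioc s t) :=
      Continuous.integrableOn_Ioc (by fun_prop)
    refine Integrable.mono' hg haes.norm.integral_prod_right' ?_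
    filter_upwards [ae_restrict_mem measurableSet_Ioc] with v hv
    rw [Real.norm_of_nonneg (integral_nonneg fun _ => norm_nonneg _)]
    simp_rw [norm_mul (f v), Real.norm_eq_abs]
    rw [integral_const_mul]
    refine mul_le_mul_of_nonneg_left ?_ (abs_nonneg _)
    refine (abs_integral_mul_le_sqrt hζ (hZ.memLp v (hmem v hv))).trans ?_
    gcongr
    exact hKb v (hmem v hv)

lemma IsContinuousL2Process.integral_mul_intervalIntegral (hZ : IsContinuousL2Process T Z P)
    {ζ : Ω → ℝ} (hζ : MemLp ζ 2 P) {f : ℝ → ℝ} (hf : Continuous f) {s t : ℝ} (hs : 0 ≤ s)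
    (hst : s ≤ t) (ht : t ≤ T) :
    ∫ ω, ζ ω * (∫ v in s..t, f v * Z v ω) ∂P = ∫ v in s..t, f v * ∫ ω, ζ ω * Z v ω ∂P := by
  rw [intervalIntegral.integral_of_le hst]
  simp_rw [intervalIntegral.integral_of_le hst, ← integral_const_mul]
  rw [integral_integral_swap (f := fun v ω => f v * (ζ ω * Z v ω))
    (hZ.integrable_prod hζ hf hs ht)]
  congr 1
  ext ω
  congr 1
  ext v
  ring

lemma IsContinuousL2Process.intervalIntegral_sq (hZ : IsContinuousL2Process T Z P)
    {f : ℝ → ℝ} (hf : Continuous f) {s t : ℝ} (hs : 0 ≤ s)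
    (hst : s ≤ t) (ht : t ≤ T) {K C : ℝ}
    (hKb : ∀ t ∈ Set.Icc 0 T, ∫ ω, Z t ω ^ 2 ∂P ≤ K) (hC : ∀ v ∈ Set.Icc 0 T, f v ^ 2 ≤ C) :
    MemLp (fun ω => ∫ v in s..t, f v * Z v ω) 2 P ∧
      ∫ ω, (∫ v in s..t, f v * Z v ω) ^ 2 ∂P ≤ T ^ 2 * C * K := by
  have hmem : ∀ v ∈ Set.Ioc s t, v ∈ Set.Icc 0 T := fun v hv => ⟨hs.trans hv.1.le, hv.2.trans ht⟩
  have hT : 0 ≤ T := hs.trans (hst.trans ht)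
  have hC0 : 0 ≤ C := (sq_nonneg (f 0)).trans (hC 0 ⟨le_rfl, hT⟩)
  have hK0 : 0 ≤ K := (integral_nonneg fun _ => sq_nonneg _).trans (hKb 0 ⟨le_rfl, hT⟩)
  have hm := measurable_uncurry_of_continuous_of_measurable hZ.continuous_path hZ.measurable_eval
  have hmeas := measurable_intervalIntegral hZ.continuous_path hZ.measurable_eval f hf s t
  have haes : AEStronglyMeasurable (fun z : ℝ × Ω => (f z.1 * Z z.1 z.2) ^ 2)
      ((volume.restrict (Set.Ioc s t)).prod P) :=
    (((hf.measurable.comp measurable_fst).mul hm).pow_const 2).aestronglyMeasurable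
  have hbd : ∀ v ∈ Set.Ioc s t, ∫ ω, (f v * Z v ω) ^ 2 ∂P ≤ C * K := fun v hv => by
    simp_rw [mul_pow]
    rw [integral_const_mul]
    exact mul_le_mul (hC v (hmem v hv)) (hKb v (hmem v hv))
      (integral_nonneg fun _ => sq_nonneg _) hC0
  have hint : Integrable (fun z : ℝ × Ω => (f z.1 * Z z.1 z.2) ^ 2)
      ((volume.restrict (Set.Ioc s t)).prod P) := by
    rw [integrable_prod_iff haes]
    constructor
    · filter_upwards [ae_restrict_mem measurableSet_Ioc] with v hv
      exact ((hZ.memLp v (hmem v hv)).const_mul (f v)).integrable_sq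
    · refine Integrable.mono' (integrable_const (C * K)) haes.norm.integral_prod_right' ?_
      filter_upwards [ae_restrict_mem measurableSet_Ioc] with v hv
      rw [Real.norm_of_nonneg (integral_nonneg fun _ => norm_nonneg _)]
      simp_rw [norm_pow, Real.norm_eq_abs, sq_abs]
      exact hbd v hv
  have hpt : ∀ ω, (∫ v in s..t, f v * Z v ω) ^ 2 ≤
      T * ∫ v in Set.Ioc s t, (f v * Z v ω) ^ 2 := fun ω => by
    have hc := hZ.continuous_path ω
    have h := sq_intervalIntegral_mul_le (f := fun _ => 1) (e := fun v => f v * Z v ω)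
      (by fun_prop) (by fun_prop) hst
    simp only [one_mul, one_pow, intervalIntegral.integral_const, smul_eq_mul, mul_one] at h
    rw [← intervalIntegral.integral_of_le hst]
    refine h.trans (mul_le_mul_of_nonneg_right (by linarith) ?_)
    exact intervalIntegral.integral_nonneg hst fun _ _ => sq_nonneg _
  have hint2 : Integrable (fun ω => T * ∫ v in Set.Ioc s t, (f v * Z v ω) ^ 2) P :=
    hint.integral_prod_right.const_mul T
  have hint3 : Integrable (fun ω => (∫ v in s..t, f v * Z v ω) ^ 2) P :=
    hint2.mono' (hmeas.pow_const 2).aestronglyMeasurable (Eventually.of_forall fun ω => by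
      rw [Real.norm_of_nonneg (sq_nonneg _)]; exact hpt ω)
  refine ⟨(memLp_two_iff_integrable_sq hmeas.aestronglyMeasurable).2 hint3, ?_⟩
  refine (integral_mono hint3 hint2 hpt).trans ?_
  rw [integral_const_mul, ← integral_integral_swap hint]
  have : ∫ v in Set.Ioc s t, ∫ ω, (f v * Z v ω) ^ 2 ∂P ≤ ∫ v in Set.Ioc s t, C * K :=
    setIntegral_mono_on hint.integral_prod_left (integrable_const _) measurableSet_Ioc hbd
  rw [setIntegral_const, measureReal_def, Real.volume_Ioc,
    ENNReal.toReal_ofReal (sub_nonneg.2 hst), smul_eq_mul] at this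
  have h2 : (t - s) * (C * K) ≤ T * (C * K) :=
    mul_le_mul_of_nonneg_right (by linarith) (by positivity)
  calc _ ≤ T * (T * (C * K)) := mul_le_mul_of_nonneg_left (this.trans h2) hT
    _ = _ := by ring

lemma IsContinuousL2Process.exists_intervalIntegral_bound (hZ : IsContinuousL2Process T Z P)
    {f : ℝ → ℝ} (hf : Continuous f) :
    ∃ K, 0 ≤ K ∧ ∀ s t, 0 ≤ s → s ≤ t → t ≤ T → MemLp (fun ω => ∫ v in s..t, f v * Z v ω) 2 P ∧
      ∫ ω, (∫ v in s..t, f v * Z v ω) ^ 2 ∂P ≤ K := by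
  obtain ⟨K, hK, hKb⟩ := hZ.bound
  obtain ⟨C, hC⟩ := (isCompact_Icc (a := 0) (b := T)).exists_bound_of_continuousOn
    (f := fun v => f v ^ 2) (by fun_prop)
  have hC' : ∀ v ∈ Set.Icc 0 T, f v ^ 2 ≤ max C 0 := fun v hv =>
    ((le_abs_self _).trans (hC v hv)).trans (le_max_left _ _)
  exact ⟨T ^ 2 * max C 0 * K, by positivity, fun s t hs hst ht =>
    hZ.intervalIntegral_sq hf hs hst ht hKb hC'⟩

lemma IsContinuousL2Process.isContinuousL2Process_memoryDrift {a : ℝ} (ha : 0 ≤ a) {B : ℝ → Ω → ℝ}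
    (hB : IsContinuousL2Process T B P) :
    IsContinuousL2Process T (fun u ω => memoryDrift a (fun v => B v ω) u) P := by
  set k : ℝ → ℝ := fun v => (1 + a * v ^ 2) * Real.exp (a * v ^ 2 / 2) with hk
  obtain ⟨K₁, hK₁, h₁⟩ := hB.bound
  obtain ⟨K₂, hK₂, h₂⟩ := hB.exists_intervalIntegral_bound (f := k) (by fun_prop)
  have hm1 : ∀ u ∈ Set.Icc 0 T, MemLp (fun ω => u * B u ω) 2 P := fun u hu =>
    (hB.memLp u hu).const_mul u
  have hm2 : ∀ u ∈ Set.Icc 0 T, MemLp (fun ω => Real.exp (-(a * u ^ 2 / 2)) *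
      ∫ v in (0 : ℝ)..u, k v * B v ω) 2 P := fun u hu =>
    (h₂ 0 u le_rfl hu.1 hu.2).1.const_mul _
  refine ⟨fun ω => continuous_memoryDrift a (hB.continuous_path ω),
    measurable_memoryDrift a hB.continuous_path hB.measurable_eval,
    fun u hu => (hm1 u hu).sub (hm2 u hu), 2 * (T ^ 2 * K₁) + 2 * K₂, by positivity,
    fun u hu => ?_⟩
  refine (integral_sub_sq_le (hm1 u hu) (hm2 u hu)).trans ?_
  simp_rw [mul_pow]
  rw [integral_const_mul, integral_const_mul]
  have he : Real.exp (-(a * u ^ 2 / 2)) ^ 2 ≤ 1 := pow_le_one₀ (Real.exp_nonneg _)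
    (Real.exp_le_one_iff.2 (by have := mul_nonneg ha (sq_nonneg u); linarith))
  have h3 := h₁ u hu
  have h4 := (h₂ 0 u le_rfl hu.1 hu.2).2
  have h5 : 0 ≤ ∫ ω, (∫ v in (0 : ℝ)..u, k v * B v ω) ^ 2 ∂P := integral_nonneg fun _ => sq_nonneg _
  have h6 : u ^ 2 ≤ T ^ 2 := pow_le_pow_left₀ hu.1 hu.2 2
  have h7 : 0 ≤ ∫ ω, B u ω ^ 2 ∂P := integral_nonneg fun _ => sq_nonneg _
  have h8 : u ^ 2 * ∫ ω, B u ω ^ 2 ∂P ≤ T ^ 2 * K₁ := by gcongr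
  have h9 := (mul_le_of_le_one_left h5 he).trans h4
  linarith

lemma IsContinuousL2Process.integral_mul_memoryDrift {a : ℝ} {B : ℝ → Ω → ℝ}
    (hB : IsContinuousL2Process T B P) {ζ : Ω → ℝ} (hζ : MemLp ζ 2 P) {u : ℝ}
    (hu : u ∈ Set.Icc 0 T) :
    ∫ ω, ζ ω * memoryDrift a (fun v => B v ω) u ∂P =
      memoryDrift a (fun v => ∫ ω, ζ ω * B v ω ∂P) u := by
  set k : ℝ → ℝ := fun v => (1 + a * v ^ 2) * Real.exp (a * v ^ 2 / 2) with hk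
  have hkc : Continuous k := by fun_prop
  obtain ⟨K₂, hK₂, h₂⟩ := hB.exists_intervalIntegral_bound (f := k) (by fun_prop)
  have h := hB.integral_mul_intervalIntegral hζ (f := k) hkc le_rfl hu.1 hu.2
  unfold memoryDrift
  rw [← h]
  have hi1 : Integrable (fun ω => ζ ω * B u ω) P := hζ.integrable_mul (hB.memLp u hu)
  have hi2 : Integrable (fun ω => ζ ω * ∫ v in (0 : ℝ)..u, k v * B v ω) P :=
    hζ.integrable_mul (h₂ 0 u le_rfl hu.1 hu.2).1
  rw [← integral_const_mul, ← integral_const_mul,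
    ← integral_sub (hi1.const_mul u) (hi2.const_mul (Real.exp (-(a * u ^ 2 / 2))))]
  congr 1
  ext ω
  ring

lemma IsContinuousL2Process.integral_mul_increment {a : ℝ} (ha : 0 ≤ a) {B : ℝ → Ω → ℝ}
    (hB : IsContinuousL2Process T B P) {ζ : Ω → ℝ} (hζ : MemLp ζ 2 P) {s t : ℝ} (hs : 0 ≤ s)
    (hst : s ≤ t) (ht : t ≤ T) :
    ∫ ω, ζ ω * (∫ u in s..t, memoryDrift a (fun v => B v ω) u) ∂P =
      ∫ u in s..t, memoryDrift a (fun v => ∫ ω, ζ ω * B v ω ∂P) u := by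
  have h := (hB.isContinuousL2Process_memoryDrift ha).integral_mul_intervalIntegral hζ
    (f := fun _ => 1)
    continuous_const hs hst ht
  simp only [one_mul] at h
  rw [h]
  refine intervalIntegral.integral_congr fun u hu => ?_
  rw [Set.uIcc_of_le hst] at hu
  exact hB.integral_mul_memoryDrift hζ ⟨hs.trans hu.1, hu.2.trans ht⟩

lemma IsContinuousL2Process.memLp_integral_memoryDrift {a : ℝ} (ha : 0 ≤ a) {B : ℝ → Ω → ℝ}
    (hB : IsContinuousL2Process T B P) {s t : ℝ} (hs : 0 ≤ s) (hst : s ≤ t) (ht : t ≤ T) :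
    MemLp (fun ω => ∫ u in s..t, memoryDrift a (fun v => B v ω) u) 2 P := by
  obtain ⟨K₂, hK₂, h₂⟩ :=
    (hB.isContinuousL2Process_memoryDrift ha).exists_intervalIntegral_bound (f := fun _ => 1)
    continuous_const
  simpa using (h₂ s t hs hst ht).1

lemma IsContinuousL2Process.memLp_selfAttractingPath {a : ℝ} (ha : 0 ≤ a) {B : ℝ → Ω → ℝ}
    (hB : IsContinuousL2Process T B P) {t : ℝ} (ht : t ∈ Set.Icc 0 T) :
    MemLp (fun ω => selfAttractingPath a (fun v => B v ω) t) 2 P :=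
  (hB.memLp t ht).sub ((hB.memLp_integral_memoryDrift ha le_rfl ht.1 ht.2).const_mul a)

/-- The solution map is a combination of evaluation and time integrals, so Fubini lets the
expectation against `ζ` pass inside: testing the solution amounts to solving the equation with the
tested noise. -/
lemma IsContinuousL2Process.integral_mul_selfAttractingPath {a : ℝ} (ha : 0 ≤ a) {B : ℝ → Ω → ℝ}
    (hB : IsContinuousL2Process T B P) {ζ : Ω → ℝ} (hζ : MemLp ζ 2 P) {t : ℝ}
    (ht : t ∈ Set.Icc 0 T) :
    ∫ ω, ζ ω * selfAttractingPath a (fun v => B v ω) t ∂P =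
      selfAttractingPath a (fun v => ∫ ω, ζ ω * B v ω ∂P) t := by
  have hi1 : Integrable (fun ω => ζ ω * B t ω) P := hζ.integrable_mul (hB.memLp t ht)
  have hi2 : Integrable
      (fun ω => ζ ω * ∫ u in (0 : ℝ)..t, memoryDrift a (fun v => B v ω) u) P :=
    hζ.integrable_mul (hB.memLp_integral_memoryDrift ha le_rfl ht.1 ht.2)
  unfold selfAttractingPath
  rw [← hB.integral_mul_increment ha hζ le_rfl ht.1 ht.2, ← integral_const_mul,
    ← integral_sub hi1 (hi2.const_mul a)]
  congr 1
  ext ω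
  ring

end L2

/-! ### Hilbert space duality, dual variables and Gaussian laws. -/

/-- A functional on a family of vectors of a Hilbert space that is dominated by the Gram form is
represented by a vector. -/
lemma exists_inner_eq_of_sq_le {E ι : Type*} [NormedAddCommGroup E] [InnerProductSpace ℝ E]
    [CompleteSpace E] (e : ι → E) (c : ι → ℝ) {M : ℝ} (hM : 0 ≤ M)
    (h : ∀ x : ι →₀ ℝ, Finsupp.linearCombination ℝ c x ^ 2 ≤
      M * ‖Finsupp.linearCombination ℝ e x‖ ^ 2) :
    ∃ z : E, ‖z‖ ^ 2 ≤ M ∧ ∀ i, inner ℝ z (e i) = c i := by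
  set A := Finsupp.linearCombination ℝ e
  set C := Finsupp.linearCombination ℝ c
  -- Domination by the Gram form makes the functional well defined on the span of the vectors; it
  -- then extends by Hahn-Banach with the same norm and is represented by Riesz.
  have hk : LinearMap.ker A ≤ LinearMap.ker C := fun x hx => by
    have hx' : A x = 0 := hx
    have := h x
    rw [hx', norm_zero] at this
    have h0 : C x ^ 2 = 0 := le_antisymm (by simpa using this) (sq_nonneg _)
    exact pow_eq_zero_iff two_ne_zero |>.1 h0
  set f₀ : LinearMap.range A →ₗ[ℝ] ℝ :=
    ((LinearMap.ker A).liftQ C hk) ∘ₗ A.quotKerEquivRange.symm.toLinearMap with hf₀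
  have hf₀A : ∀ x, f₀ ⟨A x, LinearMap.mem_range_self A x⟩ = C x := fun x => by
    simp only [hf₀, LinearMap.comp_apply, LinearEquiv.coe_coe]
    have : A.quotKerEquivRange.symm ⟨A x, LinearMap.mem_range_self A x⟩ =
        Submodule.Quotient.mk x := by
      rw [LinearEquiv.symm_apply_eq]
      ext
      simp
    rw [this, Submodule.liftQ_apply]
  have hb : ∀ y, ‖f₀ y‖ ≤ √M * ‖y‖ := by
    rintro ⟨_, x, rfl⟩
    rw [hf₀A, Real.norm_eq_abs, ← Real.sqrt_sq_eq_abs]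
    calc √(C x ^ 2) ≤ √(M * ‖A x‖ ^ 2) := Real.sqrt_le_sqrt (h x)
      _ = _ := by rw [Real.sqrt_mul hM, Real.sqrt_sq (norm_nonneg _)]; rfl
  obtain ⟨g, hg, hgn⟩ := exists_extension_norm_eq (𝕜 := ℝ) (LinearMap.range A)
    (f₀.mkContinuous (√M) hb)
  refine ⟨(InnerProductSpace.toDual ℝ E).symm g, ?_, fun i => ?_⟩
  · rw [LinearIsometryEquiv.norm_map, hgn]
    have hn := LinearMap.mkContinuous_norm_le f₀ (Real.sqrt_nonneg M) hb
    exact (pow_le_pow_left₀ (norm_nonneg _) hn 2).trans (Real.sq_sqrt hM).le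
  · rw [InnerProductSpace.toDual_symm_apply]
    have hAi : A (Finsupp.single i 1) = e i := by simp [A]
    have := hg ⟨A (Finsupp.single i 1), LinearMap.mem_range_self A _⟩
    rw [LinearMap.mkContinuous_apply, hf₀A] at this
    rw [← hAi]
    refine this.trans ?_
    simp [C]

section L2

variable {Ω : Type*} [MeasurableSpace Ω] {P : Measure Ω}

lemma inner_toLp_eq {f g : Ω → ℝ} (hf : MemLp f 2 P) (hg : MemLp g 2 P) :
    inner ℝ (hf.toLp f) (hg.toLp g) = ∫ ω, f ω * g ω ∂P := by
  rw [L2.inner_def]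
  refine integral_congr_ae ?_
  filter_upwards [hf.coeFn_toLp, hg.coeFn_toLp] with ω h1 h2
  rw [h1, h2]
  simp [mul_comm]

lemma norm_toLp_sq {f : Ω → ℝ} (hf : MemLp f 2 P) : ‖hf.toLp f‖ ^ 2 = ∫ ω, f ω ^ 2 ∂P := by
  rw [← real_inner_self_eq_norm_sq, inner_toLp_eq]
  simp_rw [sq]

/-- The square integrable variables with the characteristic function of a centered Gaussian
variable. -/
def gaussianSet (P : Measure Ω) : Set (Lp ℝ 2 P) :=
  {L | ∫ ω, Complex.exp (L ω * Complex.I) ∂P = Complex.exp (-(‖L‖ ^ 2 / 2 : ℝ))}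

lemma HasGaussianLaw.mem_gaussianSet {f : Ω → ℝ} (hf : HasGaussianLaw f P)
    (h0 : ∫ ω, f ω ∂P = 0) {L : Lp ℝ 2 P} (hL : L =ᵐ[P] f) : L ∈ gaussianSet P := by
  have hm : MemLp f 2 P := hf.memLp_two
  have h1 := charFun_gaussianReal (μ := 0) (v := Var[f; P].toNNReal) 1
  rw [← h0, ← hf.map_eq_gaussianReal, charFun_apply_real,
    integral_map hf.aemeasurable (by fun_prop), h0] at h1
  have h2 : L = hm.toLp f := Lp.ext (hL.trans hm.coeFn_toLp.symm)
  have h3 : Var[f; P] = ‖L‖ ^ 2 := by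
    rw [h2, norm_toLp_sq hm, variance_of_integral_eq_zero hf.aemeasurable h0]
  have h4 : ∫ ω, Complex.exp (L ω * Complex.I) ∂P = ∫ ω, Complex.exp (f ω * Complex.I) ∂P := by
    refine integral_congr_ae ?_
    filter_upwards [hL] with ω hω
    rw [hω]
  rw [gaussianSet, Set.mem_ofPred_eq, h4]
  simp only [Complex.ofReal_one, one_mul, h3] at h1
  rw [h1]
  congr 1
  rw [Real.coe_toNNReal _ (sq_nonneg _)]
  push_cast
  ring

variable [IsProbabilityMeasure P]

/-- Localized dual variables for the solution of the self-attracting equation: for every interval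
`[p, q]` there is `ζ` with `E[ζ²] = O((q-p)^{-2H})` and `E[ζ X_t]` equal to `0` before `p` and to
`1` after `q`. This is a form of local nondeterminism. -/
lemma exists_dual_variable {H a T : ℝ} (hH : 1 / 2 < H) (hH1 : H < 1) (ha : 0 ≤ a) (hT : 0 < T) :
    ∃ M : ℝ, 0 < M ∧ ∀ B : ℝ → Ω → ℝ, IsContinuousL2Process T B P →
      (∀ u ∈ Set.Icc 0 T, ∀ v ∈ Set.Icc 0 T, ∫ ω, B u ω * B v ω ∂P = fbmCov H u v) →
      ∀ p q : ℝ, 0 ≤ p → p < q → q ≤ T → ∃ ζ : Ω → ℝ, MemLp ζ 2 P ∧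
        ∫ ω, ζ ω ^ 2 ∂P ≤ M * (q - p) ^ (-2 * H) ∧
        (∀ t ∈ Set.Icc 0 T, t ≤ p →
          ∫ ω, ζ ω * selfAttractingPath a (fun v => B v ω) t ∂P = 0) ∧
        (∀ t ∈ Set.Icc 0 T, q ≤ t →
          ∫ ω, ζ ω * selfAttractingPath a (fun v => B v ω) t ∂P = 1) := by
  obtain ⟨M, hM, h⟩ := exists_localized_path hH hH1 ha hT
  refine ⟨M, hM, fun B hB hcov p q hp hpq hq => ?_⟩
  obtain ⟨c, hc, hc0, hc1, hcs⟩ := h p q hp hpq hq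
  have hr : 0 < q - p := sub_pos.2 hpq
  set e : Set.Icc 0 T → Lp ℝ 2 P := fun u => (hB.memLp u u.2).toLp (B u) with he
  obtain ⟨z, hz, hzc⟩ := exists_inner_eq_of_sq_le e (fun u => c u)
    (M := M * (q - p) ^ (-2 * H)) (by positivity) fun x => by
      classical
      have h1 := hcs (x.support.map (Function.Embedding.subtype _))
        -- The coefficients live on points of `[0, T]`, while the localized path is tested on finite
        -- sets of reals; the value `0` outside is never evaluated.
        (fun u => if hu : u ∈ Set.Icc 0 T then x ⟨u, hu⟩ else 0) fun u hu => by
          obtain ⟨v, -, rfl⟩ := Finset.mem_map.1 hu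
          exact v.2
      simp only [Finset.sum_map, Function.Embedding.subtype_apply, Subtype.coe_prop, dite_true,
        Subtype.coe_eta] at h1
      rw [Finsupp.linearCombination_apply, Finsupp.linearCombination_apply, Finsupp.sum,
        Finsupp.sum]
      refine h1.trans (le_of_eq ?_)
      congr 1
      rw [← real_inner_self_eq_norm_sq, sum_inner]
      refine Finset.sum_congr rfl fun u _ => ?_
      rw [inner_sum]
      refine Finset.sum_congr rfl fun v _ => ?_
      rw [real_inner_smul_left, real_inner_smul_right, inner_toLp_eq, hcov u u.2 v v.2]
      ring
  have hzm : MemLp (z : Ω → ℝ) 2 P := Lp.memLp z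
  have hzB : ∀ u ∈ Set.Icc 0 T, ∫ ω, z ω * B u ω ∂P = c u := fun u hu => by
    rw [← inner_toLp_eq hzm (hB.memLp u hu), Lp.toLp_coeFn]
    exact hzc ⟨u, hu⟩
  have hpath : ∀ t ∈ Set.Icc 0 T,
      ∫ ω, z ω * selfAttractingPath a (fun v => B v ω) t ∂P = selfAttractingPath a c t :=
    fun t ht => by
      rw [hB.integral_mul_selfAttractingPath ha hzm ht]
      exact selfAttractingPath_congr a ht.1 fun v hv => hzB v ⟨hv.1, hv.2.trans ht.2⟩
  refine ⟨z, hzm, ?_, fun t ht htp => ?_, fun t ht htq => ?_⟩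
  · rw [← norm_toLp_sq hzm, Lp.toLp_coeFn]; exact hz
  · rw [hpath t ht, hc0 t ht htp]
  · rw [hpath t ht, hc1 t ht htq]

/-- From `|exp (i x) - exp (i y)| ≤ |x - y|` and the comparison of the `L¹` and `L²` norms. It makes
the Gaussian condition closed in `L²`. -/
lemma lipschitz_integral_exp :
    LipschitzWith 1 fun L : Lp ℝ 2 P => ∫ ω, Complex.exp (L ω * Complex.I) ∂P := by
  refine LipschitzWith.of_dist_le_mul fun L L' => ?_
  have hi : ∀ L : Lp ℝ 2 P, Integrable (fun ω => Complex.exp (L ω * Complex.I)) P := fun L => by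
    refine Integrable.of_bound (C := 1) ?_ (Eventually.of_forall fun ω => ?_)
    · exact Complex.measurable_exp.comp_aemeasurable
        ((Complex.measurable_ofReal.comp_aemeasurable
          (Lp.aestronglyMeasurable L).aemeasurable).mul_const
          _) |>.aestronglyMeasurable
    · rw [Complex.norm_exp_ofReal_mul_I]
  have hd : MemLp (fun ω => (L - L') ω) 2 P := Lp.memLp _
  have hpt : ∀ x y : ℝ, ‖Complex.exp (x * Complex.I) - Complex.exp (y * Complex.I)‖ ≤ |x - y| :=
    fun x y => by
      have h1 : Complex.exp (x * Complex.I) - Complex.exp (y * Complex.I) =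
          Complex.exp (y * Complex.I) * (Complex.exp (Complex.I * (x - y : ℝ)) - 1) := by
        rw [mul_sub, mul_one, ← Complex.exp_add]
        congr 2
        push_cast; ring
      rw [h1, norm_mul, Complex.norm_exp_ofReal_mul_I, one_mul]
      exact Real.norm_exp_I_mul_ofReal_sub_one_le
  rw [NNReal.coe_one, one_mul, dist_eq_norm, dist_eq_norm, ← integral_sub (hi L) (hi L')]
  have h1 : ∫ ω, |(L - L') ω| ∂P ≤ ‖L - L'‖ := by
    have h2 := abs_integral_mul_le_sqrt hd (memLp_const (1 : ℝ) (μ := P))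
    simp only [mul_one, one_pow, integral_const, probReal_univ, smul_eq_mul,
      Real.sqrt_one] at h2
    rw [← norm_toLp_sq hd, Lp.toLp_coeFn, Real.sqrt_sq (norm_nonneg _)] at h2
    exact h2
  refine (norm_integral_le_of_norm_le (hd.integrable one_le_two).abs ?_).trans h1
  filter_upwards [Lp.coeFn_sub L L'] with ω hω
  rw [hω]
  exact hpt _ _

lemma isClosed_gaussianSet : IsClosed (gaussianSet P) :=
  isClosed_eq lipschitz_integral_exp.continuous (by fun_prop)

/-- A linear combination of values of the solution of the self-attracting equation driven by a
centered Gaussian process is centered Gaussian. -/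
lemma closure_span_le_gaussianSet {T : ℝ} {B : ℝ → Ω → ℝ} (hB : IsContinuousL2Process T B P)
    (hG : IsGaussianProcess (fun u : Set.Icc 0 T => B u) P)
    (h0 : ∀ u ∈ Set.Icc 0 T, ∫ ω, B u ω ∂P = 0) :
    ((Submodule.span ℝ (Set.range fun u : Set.Icc 0 T =>
      (hB.memLp u u.2).toLp (B u))).topologicalClosure : Set (Lp ℝ 2 P)) ⊆ gaussianSet P := by
  rw [Submodule.topologicalClosure_coe]
  refine closure_minimal (fun L hL => ?_) isClosed_gaussianSet
  obtain ⟨x, rfl⟩ := (Finsupp.mem_span_range_iff_exists_finsupp).1 hL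
  refine HasGaussianLaw.mem_gaussianSet (f := fun ω => ∑ u ∈ x.support, x u • B u ω)
    ((hG.smul x).hasGaussianLaw_fun_sum) ?_ ?_
  · rw [integral_finsetSum (f := fun (u : Set.Icc 0 T) ω => x u • B u ω) _ fun u _ =>
      ((hB.memLp u u.2).integrable one_le_two).const_mul (x u)]
    refine Finset.sum_eq_zero fun u _ => ?_
    simp_rw [smul_eq_mul]
    rw [integral_const_mul, h0 u u.2, mul_zero]
  · rw [Finsupp.sum]
    have h1 : ∀ s : Finset (Set.Icc 0 T), (⇑(∑ u ∈ s, x u • (hB.memLp u u.2).toLp (B u)) : Ω → ℝ)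
        =ᵐ[P] fun ω => ∑ u ∈ s, x u • B u ω := fun s => by
      classical
      induction s using Finset.induction_on with
      | empty => simpa [Pi.zero_def] using Lp.coeFn_zero ℝ 2 P
      | insert u s hu ih =>
        rw [Finset.sum_insert hu]
        filter_upwards [Lp.coeFn_add (x u • (hB.memLp u u.2).toLp (B u))
          (∑ u ∈ s, x u • (hB.memLp u u.2).toLp (B u)), ih,
          Lp.coeFn_smul (x u) ((hB.memLp u u.2).toLp (B u)), (hB.memLp u u.2).coeFn_toLp]
          with ω h1 h2 h3 h4
        rw [h1, Pi.add_apply, h2, h3, Pi.smul_apply, h4, Finset.sum_insert hu]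
    exact h1 _

/-- By the double orthogonal complement: a variable orthogonal to every `B u` sees the solution
driven by the zero path, which is zero. No approximation of the time integrals by Riemann sums is
needed. -/
lemma selfAttractingPath_mem_closure_span {a T : ℝ} (ha : 0 ≤ a) {B : ℝ → Ω → ℝ}
    (hB : IsContinuousL2Process T B P) {t : ℝ} (ht : t ∈ Set.Icc 0 T) :
    (hB.memLp_selfAttractingPath ha ht).toLp _ ∈ (Submodule.span ℝ (Set.range
      fun u : Set.Icc 0 T => (hB.memLp u u.2).toLp (B u))).topologicalClosure := by
  rw [← Submodule.orthogonal_orthogonal_eq_closure, Submodule.mem_orthogonal]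
  intro z hz
  have hzm : MemLp (z : Ω → ℝ) 2 P := Lp.memLp z
  have hzB : ∀ u ∈ Set.Icc 0 T, ∫ ω, z ω * B u ω ∂P = 0 := fun u hu => by
    rw [← inner_toLp_eq hzm (hB.memLp u hu), Lp.toLp_coeFn, real_inner_comm]
    exact (Submodule.mem_orthogonal _ _).1 hz _ (Submodule.subset_span ⟨⟨u, hu⟩, rfl⟩)
  have h1 := inner_toLp_eq hzm (hB.memLp_selfAttractingPath ha ht)
  rw [Lp.toLp_coeFn] at h1
  rw [h1, hB.integral_mul_selfAttractingPath ha hzm ht,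
    selfAttractingPath_congr a ht.1 (b' := fun _ => 0) fun v hv => hzB v ⟨hv.1, hv.2.trans ht.2⟩]
  simp [selfAttractingPath, memoryDrift]

end L2

/-! ### Continuous versions. -/

/-- A process with almost surely continuous paths on `[0, ∞)` has a jointly measurable version
all of whose paths are continuous. -/
lemma exists_continuous_version {Ω : Type*} [MeasurableSpace Ω] {P : Measure Ω}
    {B : ℝ → Ω → ℝ} (hm : ∀ t, 0 ≤ t → AEMeasurable (B t) P)
    (hc : ∀ᵐ ω ∂P, ContinuousOn (fun t => B t ω) (Set.Ici 0)) :
    ∃ C : ℝ → Ω → ℝ, (∀ ω, Continuous fun t => C t ω) ∧ (∀ t, Measurable (C t)) ∧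
      (∀ t, C t = C (max t 0)) ∧ ∀ᵐ ω ∂P, ∀ t, 0 ≤ t → C t ω = B t ω := by
  have hq0 : ∀ q : ℚ, (0 : ℝ) ≤ max (q : ℝ) 0 := fun q => le_max_right _ _
  have hae : ∀ᵐ ω ∂P, ContinuousOn (fun t => B t ω) (Set.Ici 0) ∧
      ∀ q : ℚ, B (max (q : ℝ) 0) ω = (hm _ (hq0 q)).mk (B (max (q : ℝ) 0)) ω :=
    hc.and (ae_all_iff.2 fun q => (hm _ (hq0 q)).ae_eq_mk)
  -- A measurable null set off which the path is continuous and agrees at all times `max q 0`, `q`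
  -- rational, with measurable modifications. Setting the path to `0` on it keeps every path
  -- continuous; measurability at the other times follows by limits along the rationals.
  set N := toMeasurable P {ω | ¬ (ContinuousOn (fun t => B t ω) (Set.Ici 0) ∧
      ∀ q : ℚ, B (max (q : ℝ) 0) ω = (hm _ (hq0 q)).mk (B (max (q : ℝ) 0)) ω)} with hN
  have hNm : MeasurableSet N := measurableSet_toMeasurable _ _
  have hN0 : P N = 0 := by rw [hN, measure_toMeasurable]; exact hae
  have hNc : ∀ ω ∉ N, ContinuousOn (fun t => B t ω) (Set.Ici 0) ∧
      ∀ q : ℚ, B (max (q : ℝ) 0) ω = (hm _ (hq0 q)).mk (B (max (q : ℝ) 0)) ω := fun ω hω => by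
    by_contra h
    exact hω (subset_toMeasurable _ _ h)
  classical
  set C : ℝ → Ω → ℝ := fun t ω => if ω ∈ N then 0 else B (max t 0) ω with hC
  have hCc : ∀ ω, Continuous fun t => C t ω := fun ω => by
    by_cases hω : ω ∈ N
    · simp only [hC, hω, if_true]; exact continuous_const
    · simp only [hC, hω, if_false]
      exact (hNc ω hω).1.comp_continuous (by fun_prop) fun t => le_max_right t 0
  have hCq : ∀ q : ℚ, Measurable (C q) := fun q => by
    have : C q = fun ω => if ω ∈ N then 0 else (hm _ (hq0 q)).mk (B (max (q : ℝ) 0)) ω := by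
      ext ω
      by_cases hω : ω ∈ N
      · simp [hC, hω]
      · simp only [hC, hω, if_false]
        exact (hNc ω hω).2 q
    rw [this]
    exact Measurable.ite hNm measurable_const (AEMeasurable.measurable_mk _)
  refine ⟨C, hCc, fun t => ?_, fun t => by simp [hC], ?_⟩
  · obtain ⟨x, hx, hxt⟩ := mem_closure_iff_seq_limit.1 ((Rat.denseRange_cast (𝕜 := ℝ)) t)
    refine measurable_of_tendsto_metrizable (f := fun n => C (x n)) (fun n => ?_)
      (tendsto_pi_nhds.2 fun ω => ((hCc ω).tendsto t).comp hxt)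
    obtain ⟨q, hq⟩ := hx n
    rw [← hq]
    exact hCq q
  · have hNae : ∀ᵐ ω ∂P, ω ∉ N := measure_eq_zero_iff_ae_notMem.1 hN0
    filter_upwards [hNae] with ω hω t ht
    simp [hC, hω, max_eq_left ht]

/-! ### Gram determinants and increment covariances of fractional Brownian motion. -/

lemma abs_rpow_sub_rpow_le {p x y L : ℝ} (hp : 1 ≤ p) (hx : x ∈ Set.Icc 0 L)
    (hy : y ∈ Set.Icc 0 L) : |x ^ p - y ^ p| ≤ p * L ^ (p - 1) * |x - y| := by
  have := (convex_Icc 0 L).norm_image_sub_le_of_norm_hasDerivWithin_le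
    (f := fun x : ℝ => x ^ p) (f' := fun x => p * x ^ (p - 1))
    (C := p * L ^ (p - 1)) (fun z hz =>
      (Real.hasDerivAt_rpow_const (Or.inr hp)).hasDerivWithinAt) (fun z hz => by
        rw [Real.norm_of_nonneg (mul_nonneg (by linarith) (Real.rpow_nonneg hz.1 _))]
        exact mul_le_mul_of_nonneg_left (Real.rpow_le_rpow hz.1 hz.2 (by linarith))
          (by linarith)) hy hx
  simpa using this

lemma abs_fbmCov_increment_le {H T : ℝ} (hH : 1 / 2 < H) {s t u : ℝ} (hs : 0 ≤ s) (hst : s ≤ t)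
    (ht : t ≤ T) (hu : u ∈ Set.Icc 0 T) :
    |fbmCov H t u - fbmCov H s u| ≤ 2 * H * T ^ (2 * H - 1) * (t - s) := by
  have hT : 0 ≤ T := hu.1.trans hu.2
  have hlip : ∀ x ∈ Set.Icc 0 T, ∀ y ∈ Set.Icc 0 T,
      |x ^ (2 * H) - y ^ (2 * H)| ≤ 2 * H * T ^ (2 * H - 1) * |x - y| := fun x hx y hy =>
    abs_rpow_sub_rpow_le (by linarith) hx hy
  have h1 := hlip t ⟨hs.trans hst, ht⟩ s ⟨hs, hst.trans ht⟩
  have h2 := hlip |t - u| ⟨abs_nonneg _, abs_le.2 ⟨by linarith [hu.2], by linarith [hu.1]⟩⟩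
    |s - u| ⟨abs_nonneg _, abs_le.2 ⟨by linarith [hu.2], by linarith [hu.1]⟩⟩
  have h3 : |(|t - u| - |s - u|)| ≤ |t - s| := by
    have := abs_abs_sub_abs_le_abs_sub (t - u) (s - u)
    simpa using this
  have hC : 0 ≤ 2 * H * T ^ (2 * H - 1) :=
    mul_nonneg (by linarith) (Real.rpow_nonneg hT _)
  have h4 := h2.trans (mul_le_mul_of_nonneg_left h3 hC)
  rw [abs_of_nonneg (sub_nonneg.2 hst)] at h1 h4
  unfold fbmCov
  rw [abs_le] at h1 h4 ⊢
  constructor <;> linarith [h1.1, h1.2, h4.1, h4.2]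

/-- For `x = 1` the form is minimal at `y = -mu / rho`, where its value is the Gram determinant
divided by `rho`. -/
lemma mul_le_gramDet_of_form {lam rho mu m₁ m₂ : ℝ} (hm₁ : 0 ≤ m₁) (hm₂ : 0 < m₂)
    (h₁ : ∀ x y, m₁ * x ^ 2 ≤ lam * x ^ 2 + 2 * mu * x * y + rho * y ^ 2) (h₂ : m₂ ≤ rho) :
    m₁ * m₂ ≤ lam * rho - mu ^ 2 := by
  have hr : 0 < rho := hm₂.trans_le h₂
  have h := h₁ 1 (-mu / rho)
  have h3 : lam * 1 ^ 2 + 2 * mu * 1 * (-mu / rho) + rho * (-mu / rho) ^ 2 =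
      (lam * rho - mu ^ 2) / rho := by field_simp; ring
  rw [h3, one_pow, mul_one, le_div_iff₀ hr] at h
  exact (mul_le_mul_of_nonneg_left h₂ hm₁).trans h

lemma ratio_le_inv_of_le_gramDet {lam rho mu m : ℝ} (hm : 0 < m) (hd : m ≤ lam * rho - mu ^ 2) :
    mu ^ 2 / (lam * rho * (lam * rho - mu ^ 2)) ≤ 1 / m := by
  have hlr : 0 < lam * rho := by nlinarith [sq_nonneg mu]
  rw [← div_div]
  refine div_le_div₀ zero_le_one ?_ hm hd
  rw [div_le_one hlr]
  linarith

/-- Applied with `α`, `β`, `γ` the powers `H/3` of the gaps, so that sixth powers are variances at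
the scale of a gap. Any two of the three lower bounds control the determinant, and the geometric
mean of the three resulting estimates is `κ² (αβγ)⁴`. -/
lemma ratio_le_of_overlap {lam rho mu κ α β γ : ℝ} (hκ : 0 < κ) (hα : 0 < α) (hβ : 0 < β)
    (hγ : 0 < γ)
    (ha : ∀ x y, κ * α ^ 6 * x ^ 2 ≤ lam * x ^ 2 + 2 * mu * x * y + rho * y ^ 2)
    (hb : ∀ x y, κ * β ^ 6 * (x + y) ^ 2 ≤ lam * x ^ 2 + 2 * mu * x * y + rho * y ^ 2)
    (hc : ∀ x y, κ * γ ^ 6 * y ^ 2 ≤ lam * x ^ 2 + 2 * mu * x * y + rho * y ^ 2) :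
    0 < lam * rho - mu ^ 2 ∧
    mu ^ 2 / (lam * rho * (lam * rho - mu ^ 2)) ≤ 1 / (κ ^ 2 * (α * β * γ) ^ 4) := by
  have hAB := mul_le_gramDet_of_form (by positivity) (by positivity) ha
    (by simpa using hb 0 1 : κ * β ^ 6 ≤ rho)
  have hAC := mul_le_gramDet_of_form (by positivity) (by positivity) ha
    (by simpa using hc 0 1 : κ * γ ^ 6 ≤ rho)
  have hCB := mul_le_gramDet_of_form (lam := rho) (rho := lam) (mu := mu) (m₁ := κ * γ ^ 6)
    (m₂ := κ * β ^ 6) (by positivity) (by positivity) (fun x y => by linarith [hc y x])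
    (by simpa using hb 1 0)
  rw [mul_comm rho] at hCB
  have hd : κ ^ 2 * (α * β * γ) ^ 4 ≤ lam * rho - mu ^ 2 := by
    refine le_of_pow_le_pow_left₀ three_ne_zero
      ((by positivity : (0 : ℝ) ≤ κ * α ^ 6 * (κ * β ^ 6)).trans hAB) ?_
    calc (κ ^ 2 * (α * β * γ) ^ 4) ^ 3 =
          (κ * α ^ 6 * (κ * β ^ 6)) * (κ * α ^ 6 * (κ * γ ^ 6)) * (κ * γ ^ 6 * (κ * β ^ 6)) := by
          ring
      _ ≤ (lam * rho - mu ^ 2) * (lam * rho - mu ^ 2) * (lam * rho - mu ^ 2) := by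
          have h0 : 0 ≤ lam * rho - mu ^ 2 :=
            (by positivity : (0 : ℝ) ≤ κ * α ^ 6 * (κ * β ^ 6)).trans hAB
          gcongr
      _ = _ := by ring
  exact ⟨lt_of_lt_of_le (by positivity) hd, ratio_le_inv_of_le_gramDet (by positivity) hd⟩

lemma ratio_le_of_bounds {lam rho mu l r d m : ℝ} (hl : 0 < l) (hr : 0 < r) (hd : 0 < d)
    (h₁ : l ≤ lam) (h₂ : r ≤ rho) (h₃ : d ≤ lam * rho - mu ^ 2) (h₄ : |mu| ≤ m) :
    mu ^ 2 / (lam * rho * (lam * rho - mu ^ 2)) ≤ m ^ 2 / (l * r * d) := by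
  have h5 : mu ^ 2 ≤ m ^ 2 := by rw [← sq_abs]; gcongr
  refine div_le_div₀ (sq_nonneg m) h5 (by positivity) ?_
  have := hl.le.trans h₁
  have := hr.le.trans h₂
  gcongr

/-- Here `β` is the inner interval, `α` and `γ` are the two margins and `L` is the outer interval.
The geometric mean of two determinant bounds is `κ² α³ β⁶ γ³`; with the bound on `mu` this leaves `1
/ (L² α³ β⁴ γ³)`, and `α γ ≤ L²` restores the symmetric product. -/
lemma ratio_le_of_nested {lam rho mu κ K α β γ L : ℝ} (hκ : 0 < κ) (hα : 0 < α)
    (hβ : 0 < β) (hγ : 0 < γ) (hαL : α ≤ L) (hγL : γ ≤ L)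
    (ha : ∀ x y, κ * α ^ 6 * x ^ 2 ≤ lam * x ^ 2 + 2 * mu * x * y + rho * y ^ 2)
    (hb : ∀ x y, κ * β ^ 6 * (x + y) ^ 2 ≤ lam * x ^ 2 + 2 * mu * x * y + rho * y ^ 2)
    (hc : ∀ x y, κ * γ ^ 6 * x ^ 2 ≤ lam * x ^ 2 + 2 * mu * x * y + rho * y ^ 2)
    (hl : κ * L ^ 6 ≤ lam) (hmu : |mu| ≤ K * (β ^ 4 * L ^ 2)) :
    0 < lam * rho - mu ^ 2 ∧
    mu ^ 2 / (lam * rho * (lam * rho - mu ^ 2)) ≤ K ^ 2 / (κ ^ 4 * (α * β * γ) ^ 4) := by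
  have hL : 0 < L := hα.trans_le hαL
  have hrho : κ * β ^ 6 ≤ rho := by simpa using hb 0 1
  have hAB := mul_le_gramDet_of_form (by positivity) (by positivity) ha hrho
  have hCB := mul_le_gramDet_of_form (by positivity) (by positivity) hc hrho
  have h0 : 0 ≤ lam * rho - mu ^ 2 := (by positivity : (0 : ℝ) ≤ κ * α ^ 6 * (κ * β ^ 6)).trans hAB
  have hd : κ ^ 2 * (β ^ 6 * α ^ 3 * γ ^ 3) ≤ lam * rho - mu ^ 2 := by
    refine le_of_pow_le_pow_left₀ two_ne_zero h0 ?_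
    calc (κ ^ 2 * (β ^ 6 * α ^ 3 * γ ^ 3)) ^ 2 =
          (κ * α ^ 6 * (κ * β ^ 6)) * (κ * γ ^ 6 * (κ * β ^ 6)) := by ring
      _ ≤ (lam * rho - mu ^ 2) * (lam * rho - mu ^ 2) := by gcongr
      _ = _ := by ring
  refine ⟨lt_of_lt_of_le (by positivity) hd, (ratio_le_of_bounds (by positivity) (by positivity)
    (by positivity) hl hrho hd hmu).trans ?_⟩
  rw [div_le_div_iff₀ (by positivity) (by positivity)]
  calc (K * (β ^ 4 * L ^ 2)) ^ 2 * (κ ^ 4 * (α * β * γ) ^ 4) =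
        K ^ 2 * (κ ^ 4 * β ^ 12 * α ^ 3 * γ ^ 3 * L ^ 4) * (α * γ) := by ring
    _ ≤ K ^ 2 * (κ ^ 4 * β ^ 12 * α ^ 3 * γ ^ 3 * L ^ 4) * (L * L) := by gcongr
    _ = _ := by ring

/-- Here `β` is the gap between the intervals. The decay `β⁻²` of `mu` supplies the factor `β⁻⁴`,
which the two variances alone could not give. -/
lemma ratio_le_of_disjoint {lam rho mu κ K α β γ : ℝ} (hκ : 0 < κ) (hα : 0 < α)
    (hβ : 0 < β) (hγ : 0 < γ)
    (ha : ∀ x y, κ * α ^ 6 * x ^ 2 ≤ lam * x ^ 2 + 2 * mu * x * y + rho * y ^ 2)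
    (hc : ∀ x y, κ * γ ^ 6 * y ^ 2 ≤ lam * x ^ 2 + 2 * mu * x * y + rho * y ^ 2)
    (hmu : |mu| ≤ K * (α ^ 4 * γ ^ 4 / β ^ 2)) :
    0 < lam * rho - mu ^ 2 ∧
    mu ^ 2 / (lam * rho * (lam * rho - mu ^ 2)) ≤ K ^ 2 / (κ ^ 4 * (α * β * γ) ^ 4) := by
  have hrho : κ * γ ^ 6 ≤ rho := by simpa using hc 0 1
  have hlam : κ * α ^ 6 ≤ lam := by simpa using ha 1 0
  have hd := mul_le_gramDet_of_form (by positivity) (by positivity) ha hrho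
  refine ⟨lt_of_lt_of_le (by positivity) hd, (ratio_le_of_bounds (by positivity) (by positivity)
    (by positivity) hlam hrho hd hmu).trans (le_of_eq ?_)⟩
  field_simp

/-- The covariance of the increments of a process with covariance function `γ`. -/
def incrementCov (γ : ℝ → ℝ → ℝ) (s t s' t' : ℝ) : ℝ := γ t t' - γ t s' - γ s t' + γ s s'

/-- The mean value inequality gives the order `L^(2H-1) * b` with `L = a + b + c`; since `b ≤ L` and
`1 - 4H/3 > 0`, part of `b` may be traded for `L` to reach the exponents `4H/3` and `2H/3`. -/
lemma abs_incrementCov_fbmCov_nested {H a b c s : ℝ} (hH : 1 / 2 < H) (hH' : H < 3 / 4)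
    (ha : 0 < a) (hb : 0 < b) (hc : 0 < c) :
    |incrementCov (fbmCov H) s (s + a + b + c) (s + a) (s + a + b)| ≤
      2 * H * (b ^ (4 * H / 3) * (a + b + c) ^ (2 * H / 3)) := by
  have h1 : incrementCov (fbmCov H) s (s + a + b + c) (s + a) (s + a + b) =
      1 / 2 * (((a + b) ^ (2 * H) - a ^ (2 * H)) + ((b + c) ^ (2 * H) - c ^ (2 * H))) := by
    simp only [incrementCov, fbmCov]
    have e1 : |s + a + b + c - (s + a + b)| = c := by
      rw [show s + a + b + c - (s + a + b) = c by ring, abs_of_pos hc]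
    have e2 : |s + a + b + c - (s + a)| = b + c := by
      rw [show s + a + b + c - (s + a) = b + c by ring, abs_of_pos (add_pos hb hc)]
    have e3 : |s - (s + a + b)| = a + b := by
      rw [abs_sub_comm, show s + a + b - s = a + b by ring, abs_of_pos (add_pos ha hb)]
    have e4 : |s - (s + a)| = a := by
      rw [abs_sub_comm, show s + a - s = a by ring, abs_of_pos ha]
    rw [e1, e2, e3, e4]
    ring
  have hL : 0 < a + b + c := by positivity
  have h2 := abs_rpow_sub_rpow_le (p := 2 * H) (L := a + b + c) (by linarith)
    (x := a + b) (y := a) ⟨by positivity, by linarith⟩ ⟨ha.le, by linarith⟩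
  have h3 := abs_rpow_sub_rpow_le (p := 2 * H) (L := a + b + c) (by linarith)
    (x := b + c) (y := c) ⟨by positivity, by linarith⟩ ⟨hc.le, by linarith⟩
  rw [show a + b - a = b by ring, abs_of_pos hb] at h2
  rw [show b + c - c = b by ring, abs_of_pos hb] at h3
  have h4 : (a + b + c) ^ (2 * H - 1) * b ≤ b ^ (4 * H / 3) * (a + b + c) ^ (2 * H / 3) := by
    have e1 : b = b ^ (4 * H / 3) * b ^ (1 - 4 * H / 3) := by
      rw [← Real.rpow_add hb]; simp
    have e2 : (a + b + c) ^ (2 * H / 3) =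
        (a + b + c) ^ (1 - 4 * H / 3) * (a + b + c) ^ (2 * H - 1) := by
      rw [← Real.rpow_add hL]; ring_nf
    have h5 : b ^ (1 - 4 * H / 3) ≤ (a + b + c) ^ (1 - 4 * H / 3) :=
      Real.rpow_le_rpow hb.le (by linarith) (by linarith)
    calc (a + b + c) ^ (2 * H - 1) * b =
          b ^ (4 * H / 3) * (b ^ (1 - 4 * H / 3) * (a + b + c) ^ (2 * H - 1)) := by
          nth_rw 2 [e1]; ring
      _ ≤ _ := by rw [e2]; gcongr
  rw [h1, abs_mul, abs_of_pos (by norm_num : (0 : ℝ) < 1 / 2)]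
  calc _ ≤ 1 / 2 * (2 * H * (a + b + c) ^ (2 * H - 1) * b +
        2 * H * (a + b + c) ^ (2 * H - 1) * b) := by
        gcongr
        exact (abs_add_le _ _).trans (add_le_add h2 h3)
    _ = 2 * H * ((a + b + c) ^ (2 * H - 1) * b) := by ring
    _ ≤ _ := by gcongr

/-- For `c ≤ b`, Bernoulli's inequality bounds the difference by `c * b^(2H-2)`; for `b ≤ c`,
subadditivity bounds it by `c^(2H-1)`. Both are absorbed in the stated product, whose exponents add
up to `2H - 1`. -/
lemma rpow_add_sub_rpow_le {H b c ξ : ℝ} (hH : 1 / 2 < H) (hH' : H < 3 / 4) (hb : 0 < b)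
    (hc : 0 < c) (hξ : b ≤ ξ) :
    (ξ + c) ^ (2 * H - 1) - ξ ^ (2 * H - 1) ≤ c ^ (8 * H / 3 - 1) * b ^ (-(2 * H / 3)) := by
  have hξ0 : 0 < ξ := hb.trans_le hξ
  rcases le_total c b with h | h
  · have h1 : (ξ + c) ^ (2 * H - 1) ≤ ξ ^ (2 * H - 1) + c * ξ ^ (2 * H - 2) := by
      have h2 := rpow_one_add_le_one_add_mul_self (s := c / ξ) (p := 2 * H - 1)
        (by have := div_pos hc hξ0; linarith) (by linarith) (by linarith)
      have h3 : ξ + c = ξ * (1 + c / ξ) := by field_simp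
      rw [h3, Real.mul_rpow hξ0.le (by positivity)]
      have h4 : ξ ^ (2 * H - 2) = ξ ^ (2 * H - 1) / ξ := by
        rw [show 2 * H - 2 = 2 * H - 1 - 1 by ring, Real.rpow_sub_one hξ0.ne']
      rw [h4]
      have h5 : (1 + c / ξ) ^ (2 * H - 1) ≤ 1 + c / ξ := by
        have : 0 < c / ξ := by positivity
        nlinarith
      calc _ ≤ ξ ^ (2 * H - 1) * (1 + c / ξ) := by gcongr
        _ = _ := by ring
    have h2 : ξ ^ (2 * H - 2) ≤ b ^ (2 * H - 2) :=
      Real.rpow_le_rpow_of_nonpos hb hξ (by linarith)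
    have h3 : b ^ (2 * H - 2) = b ^ (8 * H / 3 - 2) * b ^ (-(2 * H / 3)) := by
      rw [← Real.rpow_add hb]; ring_nf
    have h4 : b ^ (8 * H / 3 - 2) ≤ c ^ (8 * H / 3 - 2) :=
      Real.rpow_le_rpow_of_nonpos hc h (by linarith)
    have h5 : c ^ (8 * H / 3 - 1) = c * c ^ (8 * H / 3 - 2) := by
      rw [show 8 * H / 3 - 1 = 1 + (8 * H / 3 - 2) by ring, Real.rpow_add hc, Real.rpow_one]
    calc _ ≤ c * ξ ^ (2 * H - 2) := by linarith
      _ ≤ c * (b ^ (8 * H / 3 - 2) * b ^ (-(2 * H / 3))) := by rw [← h3]; gcongr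
      _ ≤ c * (c ^ (8 * H / 3 - 2) * b ^ (-(2 * H / 3))) := by gcongr
      _ = _ := by rw [h5]; ring
  · have h1 : (ξ + c) ^ (2 * H - 1) ≤ ξ ^ (2 * H - 1) + c ^ (2 * H - 1) :=
      Real.rpow_add_le_add_rpow hξ0.le hc.le (by linarith) (by linarith)
    have h2 : c ^ (2 * H - 1) = c ^ (8 * H / 3 - 1) * c ^ (-(2 * H / 3)) := by
      rw [← Real.rpow_add hc]; ring_nf
    have h3 : c ^ (-(2 * H / 3)) ≤ b ^ (-(2 * H / 3)) :=
      Real.rpow_le_rpow_of_nonpos hb h (by linarith)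
    calc _ ≤ c ^ (2 * H - 1) := by linarith
      _ ≤ _ := by rw [h2]; gcongr

/-- The expression is symmetric in `a` and `c`. The mean value inequality is applied in the smaller
of the two, and `1 - 4H/3 > 0` then shares the powers equally. -/
lemma abs_second_difference_rpow_le {H a b c : ℝ} (hH : 1 / 2 < H) (hH' : H < 3 / 4)
    (ha : 0 < a) (hb : 0 < b) (hc : 0 < c) :
    |(b + a + c) ^ (2 * H) - (b + a) ^ (2 * H) - ((b + c) ^ (2 * H) - b ^ (2 * H))| ≤
      2 * H * (a ^ (4 * H / 3) * c ^ (4 * H / 3) * b ^ (-(2 * H / 3))) := by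
  wlog hac : a ≤ c generalizing a c
  · have := this hc ha (le_of_not_ge hac)
    rw [show b + c + a = b + a + c by ring] at this
    rw [mul_comm (a ^ _)]
    convert this using 2
    ring
  have h := (convex_Icc b (b + a)).norm_image_sub_le_of_norm_hasDerivWithin_le
    (f := fun x : ℝ => (x + c) ^ (2 * H) - x ^ (2 * H))
    (f' := fun x => 2 * H * (x + c) ^ (2 * H - 1) - 2 * H * x ^ (2 * H - 1))
    (C := 2 * H * (c ^ (8 * H / 3 - 1) * b ^ (-(2 * H / 3))))
    (fun z hz => by
      have h1 := ((hasDerivAt_id z).add_const c).rpow_const (p := 2 * H)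
        (Or.inr (by linarith))
      have h2 := Real.hasDerivAt_rpow_const (x := z) (p := 2 * H) (Or.inr (by linarith))
      exact ((h1.sub h2).congr_deriv (by simp)).hasDerivWithinAt)
    (fun z hz => by
      have hz0 : 0 < z := hb.trans_le hz.1
      rw [← mul_sub, Real.norm_of_nonneg (mul_nonneg (by linarith) (sub_nonneg.2
        (Real.rpow_le_rpow hz0.le (by linarith) (by linarith))))]
      exact mul_le_mul_of_nonneg_left (rpow_add_sub_rpow_le hH hH' hb hc hz.1) (by linarith))
    (x := b) (y := b + a) ⟨le_rfl, by linarith⟩ ⟨by linarith, le_rfl⟩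
  simp only [Real.norm_eq_abs, add_sub_cancel_left, abs_of_pos ha] at h
  refine h.trans ?_
  have e1 : a = a ^ (4 * H / 3) * a ^ (1 - 4 * H / 3) := by
    rw [← Real.rpow_add ha]; simp
  have e2 : a ^ (1 - 4 * H / 3) ≤ c ^ (1 - 4 * H / 3) :=
    Real.rpow_le_rpow ha.le hac (by linarith)
  have e3 : c ^ (8 * H / 3 - 1) * c ^ (1 - 4 * H / 3) = c ^ (4 * H / 3) := by
    rw [← Real.rpow_add hc]; ring_nf
  calc _ = 2 * H * (a ^ (4 * H / 3) * (c ^ (8 * H / 3 - 1) * a ^ (1 - 4 * H / 3))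
        * b ^ (-(2 * H / 3))) := by nth_rw 1 [e1]; ring
    _ ≤ 2 * H * (a ^ (4 * H / 3) * (c ^ (8 * H / 3 - 1) * c ^ (1 - 4 * H / 3))
        * b ^ (-(2 * H / 3))) := by gcongr
    _ = _ := by rw [e3]

lemma abs_incrementCov_fbmCov_disjoint {H a b c s : ℝ} (hH : 1 / 2 < H) (hH' : H < 3 / 4)
    (ha : 0 < a) (hb : 0 < b) (hc : 0 < c) :
    |incrementCov (fbmCov H) s (s + a) (s + a + b) (s + a + b + c)| ≤
      2 * H * (a ^ (4 * H / 3) * c ^ (4 * H / 3) * b ^ (-(2 * H / 3))) := by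
  have h1 : incrementCov (fbmCov H) s (s + a) (s + a + b) (s + a + b + c) =
      1 / 2 * ((b + a + c) ^ (2 * H) - (b + a) ^ (2 * H) - ((b + c) ^ (2 * H) - b ^ (2 * H))) := by
    simp only [incrementCov, fbmCov]
    have e1 : |s + a - (s + a + b + c)| = b + c := by
      rw [abs_sub_comm, show s + a + b + c - (s + a) = b + c by ring, abs_of_pos (add_pos hb hc)]
    have e2 : |s + a - (s + a + b)| = b := by
      rw [abs_sub_comm, show s + a + b - (s + a) = b by ring, abs_of_pos hb]
    have e3 : |s - (s + a + b + c)| = b + a + c := by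
      rw [abs_sub_comm, show s + a + b + c - s = b + a + c by ring,
        abs_of_pos (add_pos (add_pos hb ha) hc)]
    have e4 : |s - (s + a + b)| = b + a := by
      rw [abs_sub_comm, show s + a + b - s = b + a by ring, abs_of_pos (add_pos hb ha)]
    rw [e1, e2, e3, e4]
    ring
  rw [h1, abs_mul, abs_of_pos (by norm_num : (0 : ℝ) < 1 / 2)]
  have := abs_second_difference_rpow_le hH hH' ha hb hc
  have h0 := abs_nonneg
    ((b + a + c) ^ (2 * H) - (b + a) ^ (2 * H) - ((b + c) ^ (2 * H) - b ^ (2 * H)))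
  linarith

/-! ### Local nondeterminism and covariance comparison for the diffusion. -/

/-- A version of fractional Brownian motion on `[0, T]` with continuous paths. -/
structure IsContinuousFbm {Ω : Type*} [MeasurableSpace Ω] (H T : ℝ) (B : ℝ → Ω → ℝ)
    (P : Measure Ω) : Prop extends IsContinuousL2Process T B P where
  covariance : ∀ u ∈ Set.Icc 0 T, ∀ v ∈ Set.Icc 0 T, ∫ ω, B u ω * B v ω ∂P = fbmCov H u v
  gaussian : IsGaussianProcess (fun u : Set.Icc 0 T => B u) P
  centered : ∀ u ∈ Set.Icc 0 T, ∫ ω, B u ω ∂P = 0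

/-- The covariance function of the fractional self-attracting diffusion. -/
noncomputable def selfAttractingCov (H a s t : ℝ) : ℝ :=
  selfAttractingPath a (fun u => selfAttractingPath a (fun v => fbmCov H u v) s) t

section Covariance

variable {Ω : Type*} [MeasurableSpace Ω] {P : Measure Ω}

lemma integral_mul_linear_combination {ζ U V : Ω → ℝ} (hζ : MemLp ζ 2 P) (hU : MemLp U 2 P)
    (hV : MemLp V 2 P) (x y : ℝ) :
    ∫ ω, ζ ω * (x * U ω + y * V ω) ∂P = x * (∫ ω, ζ ω * U ω ∂P) + y * ∫ ω, ζ ω * V ω ∂P := by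
  have i1 : Integrable (fun ω => ζ ω * U ω) P := hζ.integrable_mul hU
  have i2 : Integrable (fun ω => ζ ω * V ω) P := hζ.integrable_mul hV
  rw [← integral_const_mul, ← integral_const_mul, ← integral_add (i1.const_mul x) (i2.const_mul y)]
  congr 1
  ext ω
  ring

lemma integral_mul_sub {ζ U V : Ω → ℝ} (hζ : MemLp ζ 2 P) (hU : MemLp U 2 P)
    (hV : MemLp V 2 P) :
    ∫ ω, ζ ω * (U ω - V ω) ∂P = (∫ ω, ζ ω * U ω ∂P) - ∫ ω, ζ ω * V ω ∂P := by
  have := integral_mul_linear_combination hζ hU hV 1 (-1)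
  simpa [sub_eq_add_neg] using this

lemma integral_sub_mul {ζ U V : Ω → ℝ} (hζ : MemLp ζ 2 P) (hU : MemLp U 2 P)
    (hV : MemLp V 2 P) :
    ∫ ω, (U ω - V ω) * ζ ω ∂P = (∫ ω, U ω * ζ ω ∂P) - ∫ ω, V ω * ζ ω ∂P := by
  simp_rw [mul_comm _ (ζ _)]
  exact integral_mul_sub hζ hU hV

lemma integral_linear_combination_sq {U V : Ω → ℝ} (hU : MemLp U 2 P) (hV : MemLp V 2 P)
    (x y : ℝ) : ∫ ω, (x * U ω + y * V ω) ^ 2 ∂P =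
      (∫ ω, U ω * U ω ∂P) * x ^ 2 + 2 * (∫ ω, U ω * V ω ∂P) * x * y
        + (∫ ω, V ω * V ω ∂P) * y ^ 2 := by
  have hW : MemLp (fun ω => x * U ω + y * V ω) 2 P := (hU.const_mul x).add (hV.const_mul y)
  simp_rw [sq (_ + _)]
  rw [integral_mul_linear_combination hW hU hV]
  simp_rw [mul_comm (_ + _) _]
  rw [integral_mul_linear_combination hU hU hV, integral_mul_linear_combination hV hU hV]
  simp_rw [mul_comm (V _) (U _)]
  ring

lemma sq_integral_mul_le {f g : Ω → ℝ} (hf : MemLp f 2 P) (hg : MemLp g 2 P) :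
    (∫ ω, f ω * g ω ∂P) ^ 2 ≤ (∫ ω, f ω ^ 2 ∂P) * ∫ ω, g ω ^ 2 ∂P := by
  rw [← inner_toLp_eq hf hg, ← norm_toLp_sq hf, ← norm_toLp_sq hg, ← mul_pow, ← sq_abs]
  exact pow_le_pow_left₀ (abs_nonneg _) (abs_real_inner_le_norm _ _) 2

variable {H a T : ℝ} {B : ℝ → Ω → ℝ}

lemma integral_increment_mul {Z : ℝ → Ω → ℝ} {γ : ℝ → ℝ → ℝ}
    (hZ : ∀ t ∈ Set.Icc 0 T, MemLp (Z t) 2 P)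
    (hγ : ∀ s ∈ Set.Icc 0 T, ∀ t ∈ Set.Icc 0 T, ∫ ω, Z s ω * Z t ω ∂P = γ s t) {s t s' t' : ℝ}
    (hs : s ∈ Set.Icc 0 T) (ht : t ∈ Set.Icc 0 T) (hs' : s' ∈ Set.Icc 0 T)
    (ht' : t' ∈ Set.Icc 0 T) :
    ∫ ω, (Z t ω - Z s ω) * (Z t' ω - Z s' ω) ∂P = incrementCov γ s t s' t' := by
  rw [integral_mul_sub (ζ := fun ω => Z t ω - Z s ω) ((hZ t ht).sub (hZ s hs)) (hZ t' ht')
      (hZ s' hs'), integral_sub_mul (hZ t' ht') (hZ t ht) (hZ s hs),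
    integral_sub_mul (hZ s' hs') (hZ t ht) (hZ s hs), hγ t ht t' ht', hγ t ht s' hs',
    hγ s hs t' ht', hγ s hs s' hs', incrementCov]
  ring

lemma IsContinuousFbm.abs_integral_mul_le (hH : 1 / 2 < H) (hB : IsContinuousFbm H T B P)
    {s t u : ℝ} (hs : 0 ≤ s) (hst : s ≤ t) (ht : t ≤ T) (hu : u ∈ Set.Icc 0 T) :
    |∫ ω, (B t ω - B s ω) * B u ω ∂P| ≤ 2 * H * T ^ (2 * H - 1) * (t - s) := by
  have hBt := hB.memLp t ⟨hs.trans hst, ht⟩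
  have hBs := hB.memLp s ⟨hs, hst.trans ht⟩
  have hBu := hB.memLp u hu
  rw [integral_sub_mul hBu hBt hBs,
    hB.covariance t ⟨hs.trans hst, ht⟩ u hu, hB.covariance s ⟨hs, hst.trans ht⟩ u hu]
  exact abs_fbmCov_increment_le hH hs hst ht hu

variable [IsProbabilityMeasure P]

lemma IsContinuousFbm.integral_mul_eq_cov (ha : 0 ≤ a) (hB : IsContinuousFbm H T B P) {s t : ℝ}
    (hs : s ∈ Set.Icc 0 T) (ht : t ∈ Set.Icc 0 T) :
    ∫ ω, selfAttractingPath a (fun v => B v ω) s * selfAttractingPath a (fun v => B v ω) t ∂P =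
      selfAttractingCov H a s t := by
  rw [hB.integral_mul_selfAttractingPath ha (hB.memLp_selfAttractingPath ha hs) ht]
  refine selfAttractingPath_congr a ht.1 fun u hu => ?_
  have hu' : u ∈ Set.Icc 0 T := ⟨hu.1, hu.2.trans ht.2⟩
  simp_rw [mul_comm _ (B u _)]
  rw [hB.integral_mul_selfAttractingPath ha (hB.memLp u hu') hs]
  exact selfAttractingPath_congr a hs.1 fun v hv =>
    hB.covariance u hu' v ⟨hv.1, hv.2.trans hs.2⟩

lemma IsContinuousFbm.integral_increment_mul_increment (ha : 0 ≤ a) (hB : IsContinuousFbm H T B P)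
    {s t s' t' : ℝ} (hs : s ∈ Set.Icc 0 T) (ht : t ∈ Set.Icc 0 T) (hs' : s' ∈ Set.Icc 0 T)
    (ht' : t' ∈ Set.Icc 0 T) :
    ∫ ω, (selfAttractingPath a (fun v => B v ω) t - selfAttractingPath a (fun v => B v ω) s) *
      (selfAttractingPath a (fun v => B v ω) t' - selfAttractingPath a (fun v => B v ω) s') ∂P =
      incrementCov (selfAttractingCov H a) s t s' t' :=
  integral_increment_mul (Z := fun t ω => selfAttractingPath a (fun v => B v ω) t)
    (fun _ ht => hB.memLp_selfAttractingPath ha ht)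
    (fun _ hs _ ht => hB.integral_mul_eq_cov ha hs ht) hs ht hs' ht'

/-- `i` is the constant value on `[p, q]` of the indicator function of `[s, t]`. -/
def IsIndicatorOn (i s t p q : ℝ) : Prop := (i = 1 ∧ s ≤ p ∧ q ≤ t) ∨ (i = 0 ∧ (t ≤ p ∨ q ≤ s))

/-- Local nondeterminism of the fractional self-attracting diffusion. -/
lemma exists_le_incrementCov_form (hH : 1 / 2 < H) (hH1 : H < 1) (ha : 0 ≤ a) (hT : 0 < T)
    (hB : IsContinuousFbm H T B P) :
    ∃ κ : ℝ, 0 < κ ∧ ∀ p q s t s' t' i j : ℝ, 0 ≤ p → p < q → q ≤ T →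
      s ∈ Set.Icc 0 T → t ∈ Set.Icc 0 T → s ≤ t → s' ∈ Set.Icc 0 T → t' ∈ Set.Icc 0 T → s' ≤ t' →
      IsIndicatorOn i s t p q → IsIndicatorOn j s' t' p q → ∀ x y : ℝ,
      κ * (q - p) ^ (2 * H) * (i * x + j * y) ^ 2 ≤
        incrementCov (selfAttractingCov H a) s t s t * x ^ 2 +
        2 * incrementCov (selfAttractingCov H a) s t s' t' * x * y +
        incrementCov (selfAttractingCov H a) s' t' s' t' * y ^ 2 := by
  obtain ⟨M, hM, h⟩ := exists_dual_variable (P := P) hH hH1 ha hT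
  refine ⟨1 / M, by positivity,
    fun p q s t s' t' i j hp hpq hq hs ht hst hs' ht' hst' hi hj x y => ?_⟩
  obtain ⟨ζ, hζ, hζn, hζ0, hζ1⟩ := h B hB.toIsContinuousL2Process hB.covariance p q hp hpq hq
  set X : ℝ → Ω → ℝ := fun t ω => selfAttractingPath a (fun v => B v ω) t
  have hX : ∀ t ∈ Set.Icc 0 T, MemLp (X t) 2 P := fun t ht => hB.memLp_selfAttractingPath ha ht
  -- The dual variable of `[p, q]` detects whether an increment runs across that interval;
  -- Cauchy-Schwarz against the combination of both increments then yields the lower bound.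
  have hinc : ∀ i s t, s ∈ Set.Icc 0 T → t ∈ Set.Icc 0 T → s ≤ t → IsIndicatorOn i s t p q →
      ∫ ω, ζ ω * (X t ω - X s ω) ∂P = i := fun i s t hs ht hst hi => by
    rw [integral_mul_sub hζ (hX t ht) (hX s hs)]
    rcases hi with ⟨rfl, h1, h2⟩ | ⟨rfl, h1 | h1⟩
    · rw [hζ1 t ht h2, hζ0 s hs h1, sub_zero]
    · rw [hζ0 t ht h1, hζ0 s hs (hst.trans h1), sub_zero]
    · rw [hζ1 t ht (h1.trans hst), hζ1 s hs h1, sub_self]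
  have hU : MemLp (fun ω => X t ω - X s ω) 2 P := (hX t ht).sub (hX s hs)
  have hV : MemLp (fun ω => X t' ω - X s' ω) 2 P := (hX t' ht').sub (hX s' hs')
  have hW : MemLp (fun ω => x * (X t ω - X s ω) + y * (X t' ω - X s' ω)) 2 P :=
    (hU.const_mul x).add (hV.const_mul y)
  have h1 : ∫ ω, ζ ω * (x * (X t ω - X s ω) + y * (X t' ω - X s' ω)) ∂P = i * x + j * y := by
    rw [integral_mul_linear_combination hζ hU hV, hinc i s t hs ht hst hi,
      hinc j s' t' hs' ht' hst' hj]
    ring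
  have h2 := sq_integral_mul_le hζ hW
  have h3 := integral_linear_combination_sq hU hV x y
  simp only [X] at h3
  rw [hB.integral_increment_mul_increment ha hs ht hs ht,
    hB.integral_increment_mul_increment ha hs ht hs' ht',
    hB.integral_increment_mul_increment ha hs' ht' hs' ht'] at h3
  rw [← h3]
  rw [h1] at h2
  have hr : 0 < q - p := sub_pos.2 hpq
  have h4 : 0 ≤ ∫ ω, (x * (X t ω - X s ω) + y * (X t' ω - X s' ω)) ^ 2 ∂P :=
    integral_nonneg fun _ => sq_nonneg _
  have h5 := h2.trans (mul_le_mul_of_nonneg_right hζn h4)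
  have h6 : (q - p) ^ (2 * H) * (q - p) ^ (-2 * H) = 1 := by
    rw [← Real.rpow_add hr]; ring_nf; simp
  set I := ∫ ω, (x * (X t ω - X s ω) + y * (X t' ω - X s' ω)) ^ 2 ∂P
  calc 1 / M * (q - p) ^ (2 * H) * (i * x + j * y) ^ 2 ≤
        1 / M * (q - p) ^ (2 * H) * (M * (q - p) ^ (-2 * H) * I) := by gcongr
    _ = (1 / M * M) * ((q - p) ^ (2 * H) * (q - p) ^ (-2 * H)) * I := by ring
    _ = (q - p) ^ (2 * H) * (q - p) ^ (-2 * H) * I := by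
        rw [one_div, inv_mul_cancel₀ hM.ne', one_mul]
    _ = _ := by rw [h6, one_mul]

/-- The increments of `X` and `B` differ by `-a` times the integral of the drift over `[s, t]`.
Tested against `ζ`, that drift is the drift of the path `E[ζ B]`, bounded by `abs_memoryDrift_le`.
-/
lemma IsContinuousFbm.abs_integral_increment_sub_le (ha : 0 ≤ a) (hB : IsContinuousFbm H T B P)
    {ζ : Ω → ℝ} (hζ : MemLp ζ 2 P) {M : ℝ}
    (hM : ∀ u ∈ Set.Icc 0 T, |∫ ω, ζ ω * B u ω ∂P| ≤ M) {s t : ℝ} (hs : 0 ≤ s) (hst : s ≤ t)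
    (ht : t ≤ T) :
    |∫ ω, ζ ω * (selfAttractingPath a (fun v => B v ω) t -
        selfAttractingPath a (fun v => B v ω) s) ∂P - ∫ ω, ζ ω * (B t ω - B s ω) ∂P| ≤
      a * (T * (2 + a * T ^ 2) * Real.exp (a * T ^ 2 / 2)) * M * (t - s) := by
  have hBt := hB.memLp t ⟨hs.trans hst, ht⟩
  have hBs := hB.memLp s ⟨hs, hst.trans ht⟩
  have hXt := hB.memLp_selfAttractingPath ha (t := t) ⟨hs.trans hst, ht⟩
  have hXs := hB.memLp_selfAttractingPath ha (t := s) ⟨hs, hst.trans ht⟩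
  have i1 : Integrable (fun ω => ζ ω * (selfAttractingPath a (fun v => B v ω) t -
      selfAttractingPath a (fun v => B v ω) s)) P := hζ.integrable_mul (hXt.sub hXs)
  have i2 : Integrable (fun ω => ζ ω * (B t ω - B s ω)) P := hζ.integrable_mul (hBt.sub hBs)
  rw [← integral_sub i1 i2]
  have h1 : ∀ ω, ζ ω * (selfAttractingPath a (fun v => B v ω) t -
      selfAttractingPath a (fun v => B v ω) s) - ζ ω * (B t ω - B s ω) =
      -a * (ζ ω * ∫ u in s..t, memoryDrift a (fun v => B v ω) u) := fun ω => by
    have hc := continuous_memoryDrift a (hB.continuous_path ω)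
    rw [← intervalIntegral.integral_interval_sub_left (hc.intervalIntegrable 0 t)
      (hc.intervalIntegrable 0 s), selfAttractingPath, selfAttractingPath]
    ring
  have h2 := hB.integral_mul_increment ha hζ hs hst ht
  have h1' := funext h1
  rw [show (∫ ω, (ζ ω * (selfAttractingPath a (fun v => B v ω) t -
      selfAttractingPath a (fun v => B v ω) s) - ζ ω * (B t ω - B s ω)) ∂P) =
      ∫ ω, -a * (ζ ω * ∫ u in s..t, memoryDrift a (fun v => B v ω) u) ∂P by rw [h1'],
    integral_const_mul, h2, abs_mul, abs_neg, abs_of_nonneg ha, mul_assoc, mul_assoc]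
  refine mul_le_mul_of_nonneg_left ?_ ha
  have := intervalIntegral.norm_integral_le_of_norm_le_const (a := s) (b := t)
    (f := memoryDrift a (fun v => ∫ ω, ζ ω * B v ω ∂P))
    (C := T * (2 + a * T ^ 2) * Real.exp (a * T ^ 2 / 2) * M) fun u hu => by
      rw [Set.uIoc_of_le hst] at hu
      exact abs_memoryDrift_le ha hM ⟨hs.trans hu.1.le, hu.2.trans ht⟩
  rw [abs_of_nonneg (sub_nonneg.2 hst), mul_assoc _ M] at this
  exact this

/-- The covariance of increments of the diffusion differs from that of fractional Brownian motion
by a term of the order of the product of the lengths. -/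
lemma exists_abs_incrementCov_sub_le (hH : 1 / 2 < H) (ha : 0 ≤ a) (hT : 0 < T)
    (hB : IsContinuousFbm H T B P) :
    ∃ C : ℝ, 0 ≤ C ∧ ∀ s t s' t' : ℝ, 0 ≤ s → s ≤ t → t ≤ T → 0 ≤ s' → s' ≤ t' → t' ≤ T →
      |incrementCov (selfAttractingCov H a) s t s' t' - incrementCov (fbmCov H) s t s' t'| ≤
        C * ((t - s) * (t' - s')) := by
  set D := a * (T * (2 + a * T ^ 2) * Real.exp (a * T ^ 2 / 2)) with hD
  set C₁ := 2 * H * T ^ (2 * H - 1) with hC₁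
  have hD0 : 0 ≤ D := by positivity
  have hC0 : 0 ≤ C₁ := mul_nonneg (by linarith) (by positivity)
  -- The increments of `B` are replaced by those of `X` one at a time: `D * C₁` is the cost of the
  -- first replacement tested against an increment of `B`, the other term that of the second tested
  -- against an increment of `X`.
  refine ⟨D * C₁ + D * (C₁ + D * (C₁ * T)), by positivity,
    fun s t s' t' hs hst ht hs' hst' ht' => ?_⟩
  have hsT : s ∈ Set.Icc 0 T := ⟨hs, hst.trans ht⟩
  have htT : t ∈ Set.Icc 0 T := ⟨hs.trans hst, ht⟩
  have hsT' : s' ∈ Set.Icc 0 T := ⟨hs', hst'.trans ht'⟩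
  have htT' : t' ∈ Set.Icc 0 T := ⟨hs'.trans hst', ht'⟩
  set X : ℝ → Ω → ℝ := fun t ω => selfAttractingPath a (fun v => B v ω) t with hX
  have hΔB' : MemLp (fun ω => B t' ω - B s' ω) 2 P := (hB.memLp t' htT').sub (hB.memLp s' hsT')
  have hΔX : MemLp (fun ω => X t ω - X s ω) 2 P :=
    (hB.memLp_selfAttractingPath ha htT).sub (hB.memLp_selfAttractingPath ha hsT)
  have h1 := hB.abs_integral_increment_sub_le ha hΔB'
    (fun u hu => hB.abs_integral_mul_le hH hs' hst' ht' hu) hs hst ht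
  have hcov0 : ∀ u ∈ Set.Icc 0 T, ∀ v ∈ Set.Icc 0 T, |∫ ω, B u ω * B v ω ∂P| ≤ C₁ * T :=
    fun u hu v hv => by
      have h2 := abs_fbmCov_increment_le (H := H) hH le_rfl hu.1 hu.2 hv
      have h3 : fbmCov H 0 v = 0 := by
        rw [fbmCov, zero_sub, abs_neg, abs_of_nonneg hv.1, Real.zero_rpow (by linarith)]; ring
      rw [hB.covariance u hu v hv]
      rw [h3, sub_zero, sub_zero] at h2
      exact h2.trans (mul_le_mul_of_nonneg_left hu.2 hC0)
  have hm2 : ∀ u ∈ Set.Icc 0 T, |∫ ω, (X t ω - X s ω) * B u ω ∂P| ≤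
      (C₁ + D * (C₁ * T)) * (t - s) := fun u hu => by
    have h2 := hB.abs_integral_increment_sub_le ha (hB.memLp u hu) (hcov0 u hu) hs hst ht
    have h3 := hB.abs_integral_mul_le hH hs hst ht hu
    simp_rw [mul_comm (_ - _) (B u _)] at h3 ⊢
    have h4 := abs_sub_abs_le_abs_sub (∫ ω, B u ω * (X t ω - X s ω) ∂P)
      (∫ ω, B u ω * (B t ω - B s ω) ∂P)
    linarith
  have h5 := hB.abs_integral_increment_sub_le ha hΔX hm2 hs' hst' ht'
  rw [hB.integral_increment_mul_increment ha hsT htT hsT' htT'] at h5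
  have h6 : ∫ ω, (B t' ω - B s' ω) * (B t ω - B s ω) ∂P = incrementCov (fbmCov H) s t s' t' := by
    simp_rw [mul_comm (B t' _ - B s' _)]
    exact integral_increment_mul hB.memLp hB.covariance hsT htT hsT' htT'
  rw [h6] at h1
  have h7 : ∫ ω, (B t' ω - B s' ω) * (X t ω - X s ω) ∂P =
      ∫ ω, (X t ω - X s ω) * (B t' ω - B s' ω) ∂P := by
    simp_rw [mul_comm (B t' _ - B s' _)]
  rw [h7] at h1
  have h8 := abs_sub_le (incrementCov (selfAttractingCov H a) s t s' t')
    (∫ ω, (X t ω - X s ω) * (B t' ω - B s' ω) ∂P) (incrementCov (fbmCov H) s t s' t')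
  refine h8.trans ((add_le_add h5 h1).trans (le_of_eq ?_))
  ring

end Covariance

/-! ### The pointwise bound for the variance integrand. -/

/-- The product of the `-δ`-powers of the three consecutive distances in a chain of four points. -/
noncomputable def chainWeight (δ p q r w : ℝ) : ℝ :=
  |p - q| ^ (-δ) * |q - r| ^ (-δ) * |r - w| ^ (-δ)

/-- The sum of the chain weights over the possible orderings of the end points of `[s, t]` and
`[s', t']`. -/
noncomputable def pairWeight (δ s t s' t' : ℝ) : ℝ :=
  chainWeight δ s s' t t' + chainWeight δ s s' t' t + chainWeight δ s t s' t' +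
    (chainWeight δ s' s t' t + chainWeight δ s' s t t' + chainWeight δ s' t' s t)

lemma chainWeight_nonneg (δ p q r w : ℝ) : 0 ≤ chainWeight δ p q r w := by
  unfold chainWeight; positivity

lemma rpow_div_three_pow {x : ℝ} (hx : 0 < x) (H : ℝ) (n : ℕ) :
    (x ^ (H / 3)) ^ n = x ^ (n * H / 3) := by
  rw [← Real.rpow_natCast, ← Real.rpow_mul hx.le]; ring_nf

lemma inv_pow_four_eq_chainWeight {H p q r w : ℝ} (hpq : p < q) (hqr : q < r) (hrw : r < w) :
    1 / ((q - p) ^ (H / 3) * (r - q) ^ (H / 3) * (w - r) ^ (H / 3)) ^ 4 =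
      chainWeight (4 * H / 3) p q r w := by
  have h1 := sub_pos.2 hpq
  have h2 := sub_pos.2 hqr
  have h3 := sub_pos.2 hrw
  rw [chainWeight, abs_sub_comm p q, abs_sub_comm q r, abs_sub_comm r w, abs_of_pos h1,
    abs_of_pos h2,
    abs_of_pos h3, Real.rpow_neg h1.le, Real.rpow_neg h2.le, Real.rpow_neg h3.le, mul_pow, mul_pow,
    rpow_div_three_pow h1, rpow_div_three_pow h2, rpow_div_three_pow h3]
  push_cast
  rw [one_div, mul_inv, mul_inv]

lemma le_rpow_mul_rpow {x T e : ℝ} (hx : 0 < x) (hxT : x ≤ T) (he : e ≤ 1) :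
    x ≤ T ^ (1 - e) * x ^ e := by
  calc x = x ^ (1 - e) * x ^ e := by rw [← Real.rpow_add hx]; simp
    _ ≤ _ := by
      gcongr

section Covariance

variable {Ω : Type*} [MeasurableSpace Ω] {P : Measure Ω} [IsProbabilityMeasure P]
  {H a T : ℝ} {B : ℝ → Ω → ℝ}

lemma IsContinuousFbm.incrementCov_comm (ha : 0 ≤ a) (hB : IsContinuousFbm H T B P)
    {s t s' t' : ℝ} (hs : s ∈ Set.Icc 0 T) (ht : t ∈ Set.Icc 0 T) (hs' : s' ∈ Set.Icc 0 T)
    (ht' : t' ∈ Set.Icc 0 T) :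
    incrementCov (selfAttractingCov H a) s t s' t' =
      incrementCov (selfAttractingCov H a) s' t' s t := by
  rw [← hB.integral_increment_mul_increment ha hs ht hs' ht',
    ← hB.integral_increment_mul_increment ha hs' ht' hs ht]
  simp_rw [mul_comm]

/-- The key estimate for the integrand of the variance of the self-intersection local time. -/
lemma exists_ratio_le_pairWeight (hH : 1 / 2 < H) (hH' : H < 3 / 4) (ha : 0 ≤ a) (hT : 0 < T)
    (hB : IsContinuousFbm H T B P) :
    ∃ C : ℝ, 0 ≤ C ∧ ∀ s t s' t' : ℝ, 0 ≤ s → s < t → t ≤ T → 0 ≤ s' → s' < t' → t' ≤ T →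
      s ≠ s' → t ≠ t' → s ≠ t' → s' ≠ t →
      0 < incrementCov (selfAttractingCov H a) s t s t *
        incrementCov (selfAttractingCov H a) s' t' s' t' -
          incrementCov (selfAttractingCov H a) s t s' t' ^ 2 ∧
      incrementCov (selfAttractingCov H a) s t s' t' ^ 2 /
        (incrementCov (selfAttractingCov H a) s t s t *
          incrementCov (selfAttractingCov H a) s' t' s' t' *
          (incrementCov (selfAttractingCov H a) s t s t *
            incrementCov (selfAttractingCov H a) s' t' s' t' -
              incrementCov (selfAttractingCov H a) s t s' t' ^ 2)) ≤
        C * pairWeight (4 * H / 3) s t s' t' := by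
  obtain ⟨κ, hκ, hform⟩ := exists_le_incrementCov_form hH (by linarith) ha hT hB
  obtain ⟨C, hC, hmu⟩ := exists_abs_incrementCov_sub_le hH ha hT hB
  set V := incrementCov (selfAttractingCov H a) with hV
  -- The powers of `T` absorb the drift error `(t - s) * (t' - s')` into the fractional Brownian
  -- bound, first for nested and then for disjoint intervals.
  set K := 2 * H + C * (T ^ (1 - 4 * H / 3) * T ^ (1 - 2 * H / 3) +
    T ^ (1 - 4 * H / 3) * T ^ (1 - 4 * H / 3) * T ^ (2 * H / 3)) with hK
  have hform' : ∀ p q s t s' t' i j : ℝ, 0 ≤ p → p < q → q ≤ T →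
      s ∈ Set.Icc 0 T → t ∈ Set.Icc 0 T → s ≤ t → s' ∈ Set.Icc 0 T → t' ∈ Set.Icc 0 T → s' ≤ t' →
      IsIndicatorOn i s t p q → IsIndicatorOn j s' t' p q → ∀ x y : ℝ,
      κ * ((q - p) ^ (H / 3)) ^ 6 * (i * x + j * y) ^ 2 ≤
        V s t s t * x ^ 2 + 2 * V s t s' t' * x * y + V s' t' s' t' * y ^ 2 := by
    intro p q s t s' t' i j hp hpq hq hs ht hst hs' ht' hst' hi hj x y
    have := hform p q s t s' t' i j hp hpq hq hs ht hst hs' ht' hst' hi hj x y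
    rw [rpow_div_three_pow (sub_pos.2 hpq)]
    have e : ((6 : ℕ) : ℝ) * H / 3 = 2 * H := by push_cast; ring
    rwa [e]
  set C' := 1 / κ ^ 2 + K ^ 2 / κ ^ 4 with hC'
  have hC'0 : 0 ≤ C' := by positivity
  have hC1 : 1 / κ ^ 2 ≤ C' := le_add_of_nonneg_right (by positivity)
  have hC2 : K ^ 2 / κ ^ 4 ≤ C' := le_add_of_nonneg_left (by positivity)
  refine ⟨C', hC'0, ?_⟩
  have main : ∀ s t s' t' : ℝ, 0 ≤ s → s < t → t ≤ T → 0 ≤ s' → s' < t' → t' ≤ T →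
      s < s' → t ≠ t' → s' ≠ t →
      0 < V s t s t * V s' t' s' t' - V s t s' t' ^ 2 ∧
      V s t s' t' ^ 2 / (V s t s t * V s' t' s' t' *
        (V s t s t * V s' t' s' t' - V s t s' t' ^ 2)) ≤
      C' * (chainWeight (4 * H / 3) s s' t t' + chainWeight (4 * H / 3) s s' t' t +
        chainWeight (4 * H / 3) s t s' t') := by
    intro s t s' t' hs hst ht hs' hst' ht' hss' htt' hs't
    have hsI : s ∈ Set.Icc 0 T := ⟨hs, hst.le.trans ht⟩
    have htI : t ∈ Set.Icc 0 T := ⟨hs.trans hst.le, ht⟩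
    have hsI' : s' ∈ Set.Icc 0 T := ⟨hs', hst'.le.trans ht'⟩
    have htI' : t' ∈ Set.Icc 0 T := ⟨hs'.trans hst'.le, ht'⟩
    have hf := fun p q i j hp hpq hq hi hj => hform' p q s t s' t' i j hp hpq hq hsI htI hst.le
      hsI' htI' hst'.le hi hj
    have w1 := chainWeight_nonneg (4 * H / 3) s s' t t'
    have w2 := chainWeight_nonneg (4 * H / 3) s s' t' t
    have w3 := chainWeight_nonneg (4 * H / 3) s t s' t'
    have hmu' := hmu s t s' t' hs hst.le ht hs' hst'.le ht'
    have htri := abs_sub_abs_le_abs_sub (V s t s' t') (incrementCov (fbmCov H) s t s' t')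
    rcases lt_or_gt_of_ne hs't with h | h
    · rcases lt_or_gt_of_ne htt' with h' | h'
      -- Partial overlap `s < s' < t < t'`: the two increments put weights `x`, `x + y` and `y` on
      -- the three gaps.
      · have ha' := hf s s' 1 0 hs hss' hsI'.2 (Or.inl ⟨rfl, le_rfl, h.le⟩)
          (Or.inr ⟨rfl, Or.inr le_rfl⟩)
        have hb' := hf s' t 1 1 hs' h ht (Or.inl ⟨rfl, hss'.le, le_rfl⟩)
          (Or.inl ⟨rfl, le_rfl, h'.le⟩)
        have hc' := hf t t' 0 1 htI.1 h' ht' (Or.inr ⟨rfl, Or.inl le_rfl⟩)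
          (Or.inl ⟨rfl, h.le, le_rfl⟩)
        simp only [one_mul, zero_mul, add_zero, zero_add] at ha' hb' hc'
        have r1 := sub_pos.2 hss'
        have r2 := sub_pos.2 h
        have r3 := sub_pos.2 h'
        obtain ⟨hd, hr⟩ := ratio_le_of_overlap hκ (by positivity) (by positivity) (by positivity)
          ha' hb' hc'
        refine ⟨hd, hr.trans ?_⟩
        rw [← div_div, div_eq_mul_one_div (1 / κ ^ 2), inv_pow_four_eq_chainWeight hss' h h']
        exact mul_le_mul hC1 (by linarith) w1 hC'0
      -- Nested intervals `s < s' < t' < t`: the weights on the three gaps are `x`, `x + y` and `x`.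
      · have ha' := hf s s' 1 0 hs hss' hsI'.2 (Or.inl ⟨rfl, le_rfl, h.le⟩)
          (Or.inr ⟨rfl, Or.inr le_rfl⟩)
        have hb' := hf s' t' 1 1 hs' hst' ht' (Or.inl ⟨rfl, hss'.le, h'.le⟩)
          (Or.inl ⟨rfl, le_rfl, le_rfl⟩)
        have hc' := hf t' t 1 0 htI'.1 h' ht (Or.inl ⟨rfl, hss'.le.trans hst'.le, le_rfl⟩)
          (Or.inr ⟨rfl, Or.inl le_rfl⟩)
        have hl' := hform' s t s t s t 1 1 hs hst ht hsI htI hst.le hsI htI hst.le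
          (Or.inl ⟨rfl, le_rfl, le_rfl⟩) (Or.inl ⟨rfl, le_rfl, le_rfl⟩) 1 0
        simp only [one_mul, zero_mul, add_zero, mul_zero, mul_one, one_pow] at ha' hb' hc' hl'
        have r1 := sub_pos.2 hss'
        have r2 := sub_pos.2 hst'
        have r3 := sub_pos.2 h'
        have r4 := sub_pos.2 hst
        have hm : |V s t s' t'| ≤ K * (((t' - s') ^ (H / 3)) ^ 4 * ((t - s) ^ (H / 3)) ^ 2) := by
          have h1 := abs_incrementCov_fbmCov_nested (s := s) hH hH' r1 r2 r3
          rw [show s + (s' - s) + (t' - s') + (t - t') = t by ring,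
            show s + (s' - s) + (t' - s') = t' by ring, show s + (s' - s) = s' by ring,
            show s' - s + (t' - s') + (t - t') = t - s by ring] at h1
          rw [rpow_div_three_pow r2, rpow_div_three_pow r4]
          push_cast
          have h2 := le_rpow_mul_rpow (T := T) (e := 4 * H / 3) r2 (by linarith) (by linarith)
          have h3 := le_rpow_mul_rpow (T := T) (e := 2 * H / 3) r4 (by linarith) (by linarith)
          have h4 : C * ((t - s) * (t' - s')) ≤ C * ((T ^ (1 - 2 * H / 3) * (t - s) ^ (2 * H / 3)) *
            (T ^ (1 - 4 * H / 3) * (t' - s') ^ (4 * H / 3))) := by gcongr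
          have h5 : 0 ≤ C * (T ^ (1 - 4 * H / 3) * T ^ (1 - 4 * H / 3) * T ^ (2 * H / 3)) *
            ((t' - s') ^ (4 * H / 3) * (t - s) ^ (2 * H / 3)) := by positivity
          rw [hK]
          linarith
        obtain ⟨hd, hr⟩ := ratio_le_of_nested hκ (by positivity) (by positivity) (by positivity)
          (Real.rpow_le_rpow r1.le (by linarith) (by linarith) :
            (s' - s) ^ (H / 3) ≤ (t - s) ^ (H / 3))
          (Real.rpow_le_rpow r3.le (by linarith) (by linarith) :
            (t - t') ^ (H / 3) ≤ (t - s) ^ (H / 3)) ha' hb' hc' (by linarith) hm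
        refine ⟨hd, hr.trans ?_⟩
        rw [← div_div, div_eq_mul_one_div (K ^ 2 / κ ^ 4),
          inv_pow_four_eq_chainWeight hss' hst' h']
        exact mul_le_mul hC2 (by linarith) w2 hC'0
    -- Disjoint intervals `s < t < s' < t'`: the middle gap carries no weight, so its power must
    -- come from the decay of the covariance.
    · have ha' := hf s t 1 0 hs hst ht (Or.inl ⟨rfl, le_rfl, le_rfl⟩)
        (Or.inr ⟨rfl, Or.inr h.le⟩)
      have hc' := hf s' t' 0 1 hs' hst' ht' (Or.inr ⟨rfl, Or.inl h.le⟩)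
        (Or.inl ⟨rfl, le_rfl, le_rfl⟩)
      simp only [one_mul, zero_mul, add_zero, zero_add] at ha' hc'
      have r1 := sub_pos.2 hst
      have r2 := sub_pos.2 h
      have r3 := sub_pos.2 hst'
      have hm : |V s t s' t'| ≤ K * (((t - s) ^ (H / 3)) ^ 4 * ((t' - s') ^ (H / 3)) ^ 4 /
          ((s' - t) ^ (H / 3)) ^ 2) := by
        have h1 := abs_incrementCov_fbmCov_disjoint (s := s) hH hH' r1 r2 r3
        rw [show s + (t - s) + (s' - t) + (t' - s') = t' by ring,
          show s + (t - s) + (s' - t) = s' by ring, show s + (t - s) = t by ring] at h1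
        rw [rpow_div_three_pow r1, rpow_div_three_pow r2, rpow_div_three_pow r3]
        push_cast
        rw [div_eq_mul_inv, ← Real.rpow_neg r2.le]
        have h2 := le_rpow_mul_rpow (T := T) (e := 4 * H / 3) r1 (by linarith) (by linarith)
        have h3 := le_rpow_mul_rpow (T := T) (e := 4 * H / 3) r3 (by linarith) (by linarith)
        have h6 : 1 ≤ T ^ (2 * H / 3) * (s' - t) ^ (-(2 * H / 3)) := by
          rw [Real.rpow_neg r2.le, ← div_eq_mul_inv, one_le_div (by positivity)]
          exact Real.rpow_le_rpow r2.le (by linarith) (by linarith)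
        have h4 : C * ((t - s) * (t' - s')) ≤ C * ((T ^ (1 - 4 * H / 3) * (t - s) ^ (4 * H / 3)) *
          (T ^ (1 - 4 * H / 3) * (t' - s') ^ (4 * H / 3)) *
          (T ^ (2 * H / 3) * (s' - t) ^ (-(2 * H / 3)))) := by
          refine mul_le_mul_of_nonneg_left ?_ hC
          refine (by gcongr : (t - s) * (t' - s') ≤ (T ^ (1 - 4 * H / 3) * (t - s) ^ (4 * H / 3)) *
            (T ^ (1 - 4 * H / 3) * (t' - s') ^ (4 * H / 3))).trans ?_
          exact le_mul_of_one_le_right (by positivity) h6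
        have h5 : 0 ≤ C * (T ^ (1 - 4 * H / 3) * T ^ (1 - 2 * H / 3)) *
          ((t - s) ^ (4 * H / 3) * (t' - s') ^ (4 * H / 3) * (s' - t) ^ (-(2 * H / 3))) := by
          positivity
        rw [hK]
        linarith
      obtain ⟨hd, hr⟩ := ratio_le_of_disjoint hκ (by positivity) (by positivity) (by positivity)
        ha' hc' hm
      refine ⟨hd, hr.trans ?_⟩
      rw [← div_div, div_eq_mul_one_div (K ^ 2 / κ ^ 4),
        inv_pow_four_eq_chainWeight hst h hst']
      exact mul_le_mul hC2 (by linarith) w3 hC'0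
  intro s t s' t' hs hst ht hs' hst' ht' hss' htt' hst'' hs't
  have w1 := chainWeight_nonneg (4 * H / 3)
  rcases lt_or_gt_of_ne hss' with h | h
  · obtain ⟨h1, h2⟩ := main s t s' t' hs hst ht hs' hst' ht' h htt' hs't
    refine ⟨h1, h2.trans (mul_le_mul_of_nonneg_left ?_ hC'0)⟩
    unfold pairWeight
    linarith [w1 s' s t' t, w1 s' s t t', w1 s' t' s t]
  · obtain ⟨h1, h2⟩ := main s' t' s t hs' hst' ht' hs hst ht h htt'.symm hst''
    have hc : V s t s' t' = V s' t' s t := hB.incrementCov_comm ha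
      ⟨hs, hst.le.trans ht⟩ ⟨hs.trans hst.le, ht⟩ ⟨hs', hst'.le.trans ht'⟩ ⟨hs'.trans hst'.le, ht'⟩
    rw [hc, mul_comm (V s t s t)]
    refine ⟨h1, h2.trans (mul_le_mul_of_nonneg_left ?_ hC'0)⟩
    unfold pairWeight
    linarith [w1 s s' t t', w1 s s' t' t, w1 s t s' t']

end Covariance

/-! ### Gaussian expectations of heat kernels. -/

/-- The one-dimensional heat kernel. -/
noncomputable def heatKernel (ε x : ℝ) : ℝ := (√(2 * Real.pi * ε))⁻¹ * Real.exp (-(x ^ 2 / (2 * ε)))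

lemma heatKernel_nonneg (ε x : ℝ) : 0 ≤ heatKernel ε x := by unfold heatKernel; positivity

lemma continuous_heatKernel (ε : ℝ) : Continuous (heatKernel ε) := by
  unfold heatKernel; fun_prop

lemma heatKernel_le {ε : ℝ} (hε : 0 < ε) (x : ℝ) : heatKernel ε x ≤ (√(2 * Real.pi * ε))⁻¹ :=
  mul_le_of_le_one_right (by positivity) (Real.exp_le_one_iff.2 (by
    have : 0 ≤ x ^ 2 / (2 * ε) := by positivity
    linarith))

lemma integral_exp_neg_quadratic {R m : ℝ} (hR : 0 < R) :
    ∫ y : ℝ, Real.exp (-(R / 2 * y ^ 2 + m * y)) =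
      √(2 * Real.pi / R) * Real.exp (m ^ 2 / (2 * R)) := by
  have h1 : ∀ y : ℝ, Real.exp (-(R / 2 * y ^ 2 + m * y)) =
      Real.exp (m ^ 2 / (2 * R)) * Real.exp (-(R / 2) * (y + m / R) ^ 2) := fun y => by
    rw [← Real.exp_add]
    congr 1
    field_simp
    ring
  simp_rw [h1]
  rw [integral_const_mul, integral_add_right_eq_self (fun y => Real.exp (-(R / 2) * y ^ 2)) (m / R),
    integral_gaussian, mul_comm]
  congr 2
  field_simp

/-- Only `lam + ε` has to be positive, since the Gaussian weight contributes the coefficient `ε`;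
below, `lam` is a Schur complement whose sign is not known. -/
lemma integral_gaussianReal_exp_neg_quadratic {ε lam m : ℝ} (hε : 0 < ε) (hlam : 0 < lam + ε) :
    ∫ y, Real.exp (-(lam / 2 * y ^ 2 + m * y)) ∂(gaussianReal 0 (Real.toNNReal (1 / ε))) =
      √(ε / (lam + ε)) * Real.exp (m ^ 2 / (2 * (lam + ε))) := by
  have hv : Real.toNNReal (1 / ε) ≠ 0 := by
    rw [Ne, Real.toNNReal_eq_zero]; exact not_le.2 (by positivity)
  rw [integral_gaussianReal_eq_integral_smul hv]
  have h1 : ∀ y : ℝ, gaussianPDFReal 0 (Real.toNNReal (1 / ε)) y •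
      Real.exp (-(lam / 2 * y ^ 2 + m * y)) =
      √(ε / (2 * Real.pi)) * Real.exp (-((lam + ε) / 2 * y ^ 2 + m * y)) := fun y => by
    rw [gaussianPDFReal, Real.coe_toNNReal _ (by positivity), smul_eq_mul, mul_assoc,
      ← Real.exp_add, ← Real.sqrt_inv]
    congr 2
    · field_simp
    · field_simp
      ring
  simp_rw [h1]
  rw [integral_const_mul, integral_exp_neg_quadratic hlam, ← mul_assoc,
    ← Real.sqrt_mul (by positivity)]
  congr 2
  field_simp

/-- Writing the heat kernel as a characteristic function moves the computation to the joint
characteristic function of the increments, so no joint density is needed even if the pair is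
degenerate. -/
lemma cexp_neg_sq_eq {ε : ℝ} (hε : 0 < ε) (u : ℝ) :
    ((Real.exp (-(u ^ 2 / (2 * ε))) : ℝ) : ℂ) =
      ∫ x, Complex.exp (u * x * Complex.I) ∂(gaussianReal 0 (Real.toNNReal (1 / ε))) := by
  rw [← charFun_apply_real, charFun_gaussianReal, Real.coe_toNNReal _ (by positivity)]
  push_cast
  congr 1
  field_simp
  ring

section Expectation

variable {Ω : Type*} [MeasurableSpace Ω] {P : Measure Ω} [IsProbabilityMeasure P]

/-- The joint density at the origin of a smoothed centered Gaussian pair. -/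
lemma integral_heatKernel_mul_heatKernel {U V : Ω → ℝ} (hU : Measurable U) (hV : Measurable V)
    {lam rho mu ε η : ℝ} (hε : 0 < ε) (hη : 0 < η) (hrho : 0 ≤ rho)
    (hdet : 0 < (lam + ε) * (rho + η) - mu ^ 2)
    (hchar : ∀ x y : ℝ, ∫ ω, Complex.exp ((x * U ω + y * V ω : ℝ) * Complex.I) ∂P =
      Complex.exp (-((lam * x ^ 2 + 2 * mu * x * y + rho * y ^ 2) / 2 : ℝ))) :
    ∫ ω, heatKernel ε (U ω) * heatKernel η (V ω) ∂P =
      1 / (2 * Real.pi * √((lam + ε) * (rho + η) - mu ^ 2)) := by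
  set γ := gaussianReal 0 (Real.toNNReal (1 / ε)) with hγ
  set γ' := gaussianReal 0 (Real.toNNReal (1 / η)) with hγ'
  have hR : 0 < rho + η := by linarith
  have h1 : ((∫ ω, Real.exp (-(U ω ^ 2 / (2 * ε))) * Real.exp (-(V ω ^ 2 / (2 * η))) ∂P : ℝ) : ℂ) =
      ∫ z : ℝ × ℝ, Complex.exp (-((lam * z.1 ^ 2 + 2 * mu * z.1 * z.2 + rho * z.2 ^ 2) / 2 : ℝ))
        ∂(γ.prod γ') := by
    rw [← integral_complex_ofReal]
    have h2 : ∀ ω, ((Real.exp (-(U ω ^ 2 / (2 * ε))) * Real.exp (-(V ω ^ 2 / (2 * η))) : ℝ) : ℂ) =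
        ∫ z : ℝ × ℝ, Complex.exp ((z.1 * U ω + z.2 * V ω : ℝ) * Complex.I) ∂(γ.prod γ') :=
        fun ω => by
      rw [Complex.ofReal_mul, cexp_neg_sq_eq hε, cexp_neg_sq_eq hη, ← integral_prod_mul]
      congr 1
      ext z
      rw [← Complex.exp_add]
      congr 1
      push_cast
      ring
    simp_rw [h2]
    rw [integral_integral_swap (f := fun ω (z : ℝ × ℝ) =>
      Complex.exp ((z.1 * U ω + z.2 * V ω : ℝ) * Complex.I))]
    · simp_rw [hchar]
    · refine Integrable.of_bound (C := 1) ?_ (Eventually.of_forall fun w => ?_)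
      · refine Measurable.aestronglyMeasurable ?_
        simp only [Function.uncurry_def]
        fun_prop
      · simp only [Function.uncurry_def]
        rw [Complex.norm_exp_ofReal_mul_I]
  have h2 : ∫ ω, Real.exp (-(U ω ^ 2 / (2 * ε))) * Real.exp (-(V ω ^ 2 / (2 * η))) ∂P =
      ∫ z : ℝ × ℝ, Real.exp (-((lam * z.1 ^ 2 + 2 * mu * z.1 * z.2 + rho * z.2 ^ 2) / 2))
        ∂(γ.prod γ') := by
    have h3 := h1
    simp_rw [← Complex.ofReal_neg, ← Complex.ofReal_exp] at h3
    rw [integral_complex_ofReal] at h3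
    exact_mod_cast h3
  have hL : 0 < lam - mu ^ 2 / (rho + η) + ε := by
    have : lam - mu ^ 2 / (rho + η) + ε = ((lam + ε) * (rho + η) - mu ^ 2) / (rho + η) := by
      field_simp; ring
    rw [this]; positivity
  have h3 : ∫ z : ℝ × ℝ, Real.exp (-((lam * z.1 ^ 2 + 2 * mu * z.1 * z.2 + rho * z.2 ^ 2) / 2))
      ∂(γ.prod γ') = √(ε * η / ((lam + ε) * (rho + η) - mu ^ 2)) := by
    -- The quadratic form is not assumed nonnegative; the bound holds because the exponential is a
    -- characteristic function by `hchar`.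
    have hle : ∀ z : ℝ × ℝ, ‖Real.exp (-((lam * z.1 ^ 2 + 2 * mu * z.1 * z.2 +
        rho * z.2 ^ 2) / 2))‖ ≤ 1 := fun z => by
      have h5 := norm_integral_le_of_norm_le_const (μ := P) (C := 1)
        (f := fun ω => Complex.exp ((z.1 * U ω + z.2 * V ω : ℝ) * Complex.I))
        (Eventually.of_forall fun ω => (Complex.norm_exp_ofReal_mul_I _).le)
      rw [hchar, ← Complex.ofReal_neg, ← Complex.ofReal_exp, Complex.norm_real, probReal_univ,
        one_mul] at h5
      exact h5
    have hint : Integrable (fun z : ℝ × ℝ => Real.exp (-((lam * z.1 ^ 2 + 2 * mu * z.1 * z.2 +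
        rho * z.2 ^ 2) / 2))) (γ.prod γ') :=
      Integrable.of_bound (by fun_prop) 1 (Eventually.of_forall hle)
    rw [integral_prod _ hint]
    have h6 : ∀ x : ℝ, ∫ y, Real.exp (-((lam * x ^ 2 + 2 * mu * x * y + rho * y ^ 2) / 2)) ∂γ' =
        √(η / (rho + η)) * Real.exp (-((lam - mu ^ 2 / (rho + η)) / 2 * x ^ 2 + 0 * x)) :=
        fun x => by
      have h7 : ∀ y : ℝ, Real.exp (-((lam * x ^ 2 + 2 * mu * x * y + rho * y ^ 2) / 2)) =
          Real.exp (-(lam * x ^ 2 / 2)) * Real.exp (-(rho / 2 * y ^ 2 + mu * x * y)) := fun y => by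
        rw [← Real.exp_add]
        congr 1
        ring
      simp_rw [h7]
      rw [integral_const_mul, integral_gaussianReal_exp_neg_quadratic hη hR, mul_left_comm,
        ← Real.exp_add]
      congr 2
      field_simp
      ring
    simp_rw [h6]
    rw [integral_const_mul, integral_gaussianReal_exp_neg_quadratic hε hL,
      ← mul_assoc, ← Real.sqrt_mul (by positivity)]
    simp only [ne_eq, OfNat.ofNat_ne_zero, not_false_eq_true, zero_pow, zero_div, Real.exp_zero,
      mul_one]
    congr 1
    have h8 : (rho + η) * (lam - mu ^ 2 / (rho + η) + ε) = (lam + ε) * (rho + η) - mu ^ 2 := by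
      field_simp; ring
    rw [← h8]
    field_simp
  have h4 : ∀ ω, heatKernel ε (U ω) * heatKernel η (V ω) = (√(2 * Real.pi * ε))⁻¹ *
      (√(2 * Real.pi * η))⁻¹ *
      (Real.exp (-(U ω ^ 2 / (2 * ε))) * Real.exp (-(V ω ^ 2 / (2 * η)))) := fun ω => by
    unfold heatKernel; ring
  simp_rw [h4]
  rw [integral_const_mul, h2, h3, ← Real.sqrt_inv, ← Real.sqrt_inv, ← Real.sqrt_mul (by positivity),
    ← Real.sqrt_mul (by positivity)]
  rw [show (2 * Real.pi * ε)⁻¹ * (2 * Real.pi * η)⁻¹ *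
    (ε * η / ((lam + ε) * (rho + η) - mu ^ 2)) =
    (1 / (2 * Real.pi)) ^ 2 * (1 / ((lam + ε) * (rho + η) - mu ^ 2)) by field_simp,
    Real.sqrt_mul (by positivity), Real.sqrt_sq (by positivity), Real.sqrt_div zero_le_one,
    Real.sqrt_one]
  field_simp

end Expectation

/-! ### Kernels of the planar increments. -/

/-- A version with continuous paths of a pair of independent fractional Brownian motions. -/
structure IsPlanarContinuousFbm {Ω : Type*} [MeasurableSpace Ω] (H T : ℝ)
    (C : Fin 2 → ℝ → Ω → ℝ) (P : Measure Ω) : Prop where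
  fbm : ∀ j, IsContinuousFbm H T (C j) P
  eval_max : ∀ j t, C j t = C j (max t 0)
  indep : IndepFun (fun (ω : Ω) (t : ℝ≥0) => C 0 t ω) (fun (ω : Ω) (t : ℝ≥0) => C 1 t ω) P

/-- The product over the two coordinates of the heat kernels of the increments. -/
noncomputable def incrementKernel {Ω : Type*} (a : ℝ) (C : Fin 2 → ℝ → Ω → ℝ) (ε s t : ℝ)
    (ω : Ω) : ℝ :=
  heatKernel ε (selfAttractingPath a (fun v => C 0 v ω) t -
      selfAttractingPath a (fun v => C 0 v ω) s) *
    heatKernel ε (selfAttractingPath a (fun v => C 1 v ω) t -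
      selfAttractingPath a (fun v => C 1 v ω) s)

lemma planarHeatKernel_eq {ε : ℝ} (hε : 0 < ε) (x : EuclideanSpace ℝ (Fin 2)) :
    planarHeatKernel ε x = heatKernel ε (x 0) * heatKernel ε (x 1) := by
  rw [planarHeatKernel, heatKernel, heatKernel, EuclideanSpace.norm_sq_eq, Fin.sum_univ_two,
    mul_mul_mul_comm, ← Real.exp_add, ← mul_inv, Real.mul_self_sqrt (by positivity)]
  simp only [Real.norm_eq_abs, sq_abs]
  congr 1
  · rw [one_div]
  · congr 1
    ring

lemma fbmCov_self {H : ℝ} (hH : 1 / 2 < H) (u : ℝ) : fbmCov H u u = u ^ (2 * H) := by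
  rw [fbmCov, sub_self, abs_zero, Real.zero_rpow (by linarith)]
  ring

/-- The solution of the self-attracting equation is adapted to the path of the noise. -/
lemma measurable_comap_selfAttractingPath {Ω : Type*} {a : ℝ} {C : ℝ → Ω → ℝ}
    (hc : ∀ ω, Continuous fun t => C t ω)
    (hmax : ∀ t, C t = C (max t 0)) (t : ℝ) :
    Measurable[MeasurableSpace.comap (fun (ω : Ω) (t : ℝ≥0) => C t ω) inferInstance]
      fun ω => selfAttractingPath a (fun v => C v ω) t := by
  let m : MeasurableSpace Ω :=
    MeasurableSpace.comap (fun (ω : Ω) (t : ℝ≥0) => C t ω) inferInstance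
  refine measurable_selfAttractingPath a hc (fun t => ?_) t
  rw [hmax t]
  have h1 : Measurable fun (ω : Ω) (t : ℝ≥0) => C t ω := comap_measurable _
  exact (measurable_pi_apply (⟨max t 0, le_max_right _ _⟩ : ℝ≥0)).comp h1

section Expectation

variable {Ω : Type*} [MeasurableSpace Ω] {P : Measure Ω} {H a T : ℝ}

/-- Each coordinate of the solution is measurable with respect to the path of its own noise, so
independence of the noises passes to the increments. -/
lemma IsPlanarContinuousFbm.integral_mul_eq {C : Fin 2 → ℝ → Ω → ℝ}
    (hC : IsPlanarContinuousFbm H T C P) {f g : ℝ → ℝ → ℝ} (hf : Measurable (Function.uncurry f))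
    (hg : Measurable (Function.uncurry g)) (s t s' t' : ℝ) :
    ∫ ω, (f (selfAttractingPath a (fun v => C 0 v ω) t - selfAttractingPath a (fun v => C 0 v ω) s)
        (selfAttractingPath a (fun v => C 0 v ω) t' - selfAttractingPath a (fun v => C 0 v ω) s')) *
      (g (selfAttractingPath a (fun v => C 1 v ω) t - selfAttractingPath a (fun v => C 1 v ω) s)
        (selfAttractingPath a (fun v => C 1 v ω) t' - selfAttractingPath a (fun v => C 1 v ω) s'))
        ∂P =
    (∫ ω, f (selfAttractingPath a (fun v => C 0 v ω) t - selfAttractingPath a (fun v => C 0 v ω) s)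
        (selfAttractingPath a (fun v => C 0 v ω) t' - selfAttractingPath a (fun v => C 0 v ω) s')
        ∂P) *
      ∫ ω, g (selfAttractingPath a (fun v => C 1 v ω) t - selfAttractingPath a (fun v => C 1 v ω) s)
        (selfAttractingPath a (fun v => C 1 v ω) t' - selfAttractingPath a (fun v => C 1 v ω) s')
        ∂P := by
  have hm : ∀ j (h : ℝ → ℝ → ℝ), Measurable (Function.uncurry h) →
      Measurable[MeasurableSpace.comap (fun (ω : Ω) (t : ℝ≥0) => C j t ω) inferInstance]
      fun ω => h (selfAttractingPath a (fun v => C j v ω) t -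
        selfAttractingPath a (fun v => C j v ω) s)
        (selfAttractingPath a (fun v => C j v ω) t' -
          selfAttractingPath a (fun v => C j v ω) s') := fun j h hh => by
    have h1 := measurable_comap_selfAttractingPath (a := a) (hC.fbm j).continuous_path
      (hC.eval_max j)
    exact hh.comp (((h1 t).sub (h1 s)).prodMk ((h1 t').sub (h1 s')))
  have hle : ∀ j, MeasurableSpace.comap (fun (ω : Ω) (t : ℝ≥0) => C j t ω) inferInstance ≤
      (inferInstance : MeasurableSpace Ω) := fun j =>
    (measurable_pi_lambda _ fun t : ℝ≥0 => (hC.fbm j).measurable_eval t).comap_le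
  refine IndepFun.integral_fun_mul_eq_mul_integral ?_
    ((hm 0 f hf).mono (hle 0) le_rfl).aestronglyMeasurable
    ((hm 1 g hg).mono (hle 1) le_rfl).aestronglyMeasurable
  rw [IndepFun_iff_Indep]
  exact indep_of_indep_of_le_left (indep_of_indep_of_le_right
    ((IndepFun_iff_Indep _ _ _).1 hC.indep) (hm 1 g hg).comap_le) (hm 0 f hf).comap_le

variable [IsProbabilityMeasure P]

/-- The combination of increments lies in the closed span of the noise, all of whose elements
satisfy the centered Gaussian identity; its squared norm is the quadratic form of the covariances.
-/
lemma IsContinuousFbm.integral_cexp_increments {B : ℝ → Ω → ℝ} (ha : 0 ≤ a)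
    (hB : IsContinuousFbm H T B P) {s t s' t' : ℝ} (hs : s ∈ Set.Icc 0 T) (ht : t ∈ Set.Icc 0 T)
    (hs' : s' ∈ Set.Icc 0 T) (ht' : t' ∈ Set.Icc 0 T) (x y : ℝ) :
    ∫ ω, Complex.exp ((x * (selfAttractingPath a (fun v => B v ω) t -
        selfAttractingPath a (fun v => B v ω) s) + y * (selfAttractingPath a (fun v => B v ω) t' -
          selfAttractingPath a (fun v => B v ω) s') : ℝ) * Complex.I) ∂P =
      Complex.exp (-((incrementCov (selfAttractingCov H a) s t s t * x ^ 2 +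
        2 * incrementCov (selfAttractingCov H a) s t s' t' * x * y +
        incrementCov (selfAttractingCov H a) s' t' s' t' * y ^ 2) / 2 : ℝ)) := by
  set X : ℝ → Ω → ℝ := fun t ω => selfAttractingPath a (fun v => B v ω) t with hX
  have hXm : ∀ t (ht : t ∈ Set.Icc 0 T), MemLp (X t) 2 P :=
    fun t ht => hB.memLp_selfAttractingPath ha ht
  have hU : MemLp (fun ω => X t ω - X s ω) 2 P := (hXm t ht).sub (hXm s hs)
  have hV : MemLp (fun ω => X t' ω - X s' ω) 2 P := (hXm t' ht').sub (hXm s' hs')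
  have hW : MemLp (fun ω => x * (X t ω - X s ω) + y * (X t' ω - X s' ω)) 2 P :=
    (hU.const_mul x).add (hV.const_mul y)
  have hWL : hW.toLp _ = x • ((hXm t ht).toLp _ - (hXm s hs).toLp _) +
      y • ((hXm t' ht').toLp _ - (hXm s' hs').toLp _) := rfl
  have hmem := closure_span_le_gaussianSet hB.toIsContinuousL2Process hB.gaussian hB.centered
    (SetLike.mem_coe.2 <| Submodule.add_mem _
      (Submodule.smul_mem _ x (Submodule.sub_mem _
        (selfAttractingPath_mem_closure_span ha hB.toIsContinuousL2Process ht)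
        (selfAttractingPath_mem_closure_span ha hB.toIsContinuousL2Process hs)))
      (Submodule.smul_mem _ y (Submodule.sub_mem _
        (selfAttractingPath_mem_closure_span ha hB.toIsContinuousL2Process ht')
        (selfAttractingPath_mem_closure_span ha hB.toIsContinuousL2Process hs'))))
  have hmem' : hW.toLp _ ∈ gaussianSet P := hWL ▸ hmem
  rw [gaussianSet, Set.mem_ofPred_eq, norm_toLp_sq hW, integral_linear_combination_sq hU hV]
    at hmem'
  simp only [hX] at hmem'
  rw [hB.integral_increment_mul_increment ha hs ht hs ht,
    hB.integral_increment_mul_increment ha hs ht hs' ht',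
    hB.integral_increment_mul_increment ha hs' ht' hs' ht'] at hmem'
  rw [← Complex.ofReal_neg] at hmem' ⊢
  rw [← hmem']
  refine integral_congr_ae ?_
  filter_upwards [hW.coeFn_toLp] with ω hω
  rw [hω]

lemma IsContinuousFbm.incrementCov_self_nonneg {B : ℝ → Ω → ℝ} (ha : 0 ≤ a)
    (hB : IsContinuousFbm H T B P) {s t : ℝ} (hs : s ∈ Set.Icc 0 T) (ht : t ∈ Set.Icc 0 T) :
    0 ≤ incrementCov (selfAttractingCov H a) s t s t := by
  rw [← hB.integral_increment_mul_increment ha hs ht hs ht]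
  exact integral_nonneg fun ω => mul_self_nonneg _

lemma IsContinuousFbm.sq_incrementCov_le {B : ℝ → Ω → ℝ} (ha : 0 ≤ a)
    (hB : IsContinuousFbm H T B P) {s t s' t' : ℝ} (hs : s ∈ Set.Icc 0 T) (ht : t ∈ Set.Icc 0 T)
    (hs' : s' ∈ Set.Icc 0 T) (ht' : t' ∈ Set.Icc 0 T) :
    incrementCov (selfAttractingCov H a) s t s' t' ^ 2 ≤
      incrementCov (selfAttractingCov H a) s t s t *
        incrementCov (selfAttractingCov H a) s' t' s' t' := by
  have h := sq_integral_mul_le (P := P)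
    ((hB.memLp_selfAttractingPath ha ht).sub (hB.memLp_selfAttractingPath ha hs))
    ((hB.memLp_selfAttractingPath ha ht').sub (hB.memLp_selfAttractingPath ha hs'))
  simp only [Pi.sub_apply, sq (_ - _)] at h
  rwa [hB.integral_increment_mul_increment ha hs ht hs ht,
    hB.integral_increment_mul_increment ha hs ht hs' ht',
    hB.integral_increment_mul_increment ha hs' ht' hs' ht'] at h

lemma IsContinuousFbm.integral_heatKernel_mul {B : ℝ → Ω → ℝ} (ha : 0 ≤ a)
    (hB : IsContinuousFbm H T B P) {ε η : ℝ} (hε : 0 < ε) (hη : 0 < η) {s t s' t' : ℝ}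
    (hs : s ∈ Set.Icc 0 T) (ht : t ∈ Set.Icc 0 T)
    (hs' : s' ∈ Set.Icc 0 T) (ht' : t' ∈ Set.Icc 0 T) :
    ∫ ω, heatKernel ε (selfAttractingPath a (fun v => B v ω) t -
        selfAttractingPath a (fun v => B v ω) s) *
        heatKernel η (selfAttractingPath a (fun v => B v ω) t' -
          selfAttractingPath a (fun v => B v ω) s') ∂P =
      1 / (2 * Real.pi * √((incrementCov (selfAttractingCov H a) s t s t + ε) *
        (incrementCov (selfAttractingCov H a) s' t' s' t' + η) -
        incrementCov (selfAttractingCov H a) s t s' t' ^ 2)) := by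
  have hm := measurable_selfAttractingPath a hB.continuous_path hB.measurable_eval
  have h1 := hB.incrementCov_self_nonneg ha hs ht
  have h2 := hB.incrementCov_self_nonneg ha hs' ht'
  have h3 := hB.sq_incrementCov_le ha hs ht hs' ht'
  exact integral_heatKernel_mul_heatKernel ((hm t).sub (hm s)) ((hm t').sub (hm s')) hε hη h2
    (by nlinarith [mul_nonneg h1 hη.le, mul_nonneg h2 hε.le, mul_pos hε hη])
    (hB.integral_cexp_increments ha hs ht hs' ht')

lemma IsContinuousFbm.integral_heatKernel {B : ℝ → Ω → ℝ} (ha : 0 ≤ a)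
    (hB : IsContinuousFbm H T B P) {ε : ℝ} (hε : 0 < ε) {s t : ℝ}
    (hs : s ∈ Set.Icc 0 T) (ht : t ∈ Set.Icc 0 T) :
    ∫ ω, heatKernel ε (selfAttractingPath a (fun v => B v ω) t -
        selfAttractingPath a (fun v => B v ω) s) ∂P =
      1 / √(2 * Real.pi * (incrementCov (selfAttractingCov H a) s t s t + ε)) := by
  have hm := measurable_selfAttractingPath a hB.continuous_path hB.measurable_eval
  have h1 := hB.incrementCov_self_nonneg ha hs ht
  -- The one-kernel formula is the pair formula with a second variable equal to `0` and `η = 1`,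
  -- divided by the constant value of the second kernel.
  have h := integral_heatKernel_mul_heatKernel (P := P) (V := fun _ => 0) (mu := 0) (rho := 0)
    (lam := incrementCov (selfAttractingCov H a) s t s t) ((hm t).sub (hm s))
    measurable_const hε one_pos le_rfl (by nlinarith) fun x y => by
      have h2 := hB.integral_cexp_increments ha hs ht hs ht x 0
      simp only [zero_mul, add_zero, mul_zero] at h2 ⊢
      rw [Pi.sub_def]
      rw [h2]
      congr 2
      push_cast
      ring
  simp only [Pi.sub_apply, heatKernel.eq_1 1] at h
  rw [integral_mul_const] at h
  simp only [mul_one, ne_eq, OfNat.ofNat_ne_zero, not_false_eq_true, zero_pow, zero_div, neg_zero,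
    Real.exp_zero, zero_add, sub_zero] at h
  rw [mul_inv_eq_iff_eq_mul₀ (by positivity)] at h
  rw [h]
  have h2 : 0 < √(2 * Real.pi) := by positivity
  rw [Real.sqrt_mul (x := 2 * Real.pi) (by positivity)
    (incrementCov (selfAttractingCov H a) s t s t + ε), div_mul_eq_mul_div, one_mul,
    div_eq_div_iff (by positivity) (by positivity), one_mul, ← mul_assoc,
    Real.mul_self_sqrt (by positivity)]

lemma IsPlanarContinuousFbm.integral_incrementKernel {C : Fin 2 → ℝ → Ω → ℝ} (ha : 0 ≤ a)
    (hC : IsPlanarContinuousFbm H T C P) {ε : ℝ} (hε : 0 < ε) {s t : ℝ}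
    (hs : s ∈ Set.Icc 0 T) (ht : t ∈ Set.Icc 0 T) :
    ∫ ω, incrementKernel a C ε s t ω ∂P =
      1 / (2 * Real.pi * (incrementCov (selfAttractingCov H a) s t s t + ε)) := by
  have h := hC.integral_mul_eq (a := a) (f := fun x _ => heatKernel ε x)
    (g := fun x _ => heatKernel ε x) ((continuous_heatKernel ε).comp continuous_fst).measurable
    ((continuous_heatKernel ε).comp continuous_fst).measurable s t s t
  have h1 := (hC.fbm 0).incrementCov_self_nonneg ha hs ht
  simp only [incrementKernel]
  rw [h, (hC.fbm 0).integral_heatKernel ha hε hs ht, (hC.fbm 1).integral_heatKernel ha hε hs ht,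
    div_mul_div_comm, one_mul, Real.mul_self_sqrt (by positivity)]

lemma IsPlanarContinuousFbm.integral_incrementKernel_mul {C : Fin 2 → ℝ → Ω → ℝ} (ha : 0 ≤ a)
    (hC : IsPlanarContinuousFbm H T C P) {ε η : ℝ} (hε : 0 < ε) (hη : 0 < η) {s t s' t' : ℝ}
    (hs : s ∈ Set.Icc 0 T) (ht : t ∈ Set.Icc 0 T)
    (hs' : s' ∈ Set.Icc 0 T) (ht' : t' ∈ Set.Icc 0 T) :
    ∫ ω, incrementKernel a C ε s t ω * incrementKernel a C η s' t' ω ∂P =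
      1 / (4 * Real.pi ^ 2 * ((incrementCov (selfAttractingCov H a) s t s t + ε) *
        (incrementCov (selfAttractingCov H a) s' t' s' t' + η) -
        incrementCov (selfAttractingCov H a) s t s' t' ^ 2)) := by
  have h := hC.integral_mul_eq (a := a) (f := fun x y => heatKernel ε x * heatKernel η y)
    (g := fun x y => heatKernel ε x * heatKernel η y)
    (((continuous_heatKernel ε).comp continuous_fst).mul
      ((continuous_heatKernel η).comp continuous_snd)).measurable
    (((continuous_heatKernel ε).comp continuous_fst).mul
      ((continuous_heatKernel η).comp continuous_snd)).measurable s t s' t'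
  have h1 := (hC.fbm 0).incrementCov_self_nonneg ha hs ht
  have h2 := (hC.fbm 0).incrementCov_self_nonneg ha hs' ht'
  have h3 := (hC.fbm 0).sq_incrementCov_le ha hs ht hs' ht'
  simp only [incrementKernel, mul_mul_mul_comm (heatKernel ε _)]
  rw [h, (hC.fbm 0).integral_heatKernel_mul ha hε hη hs ht hs' ht',
    (hC.fbm 1).integral_heatKernel_mul ha hε hη hs ht hs' ht',
    div_mul_div_comm, one_mul, mul_mul_mul_comm, Real.mul_self_sqrt (by
      nlinarith [mul_nonneg h1 hη.le, mul_nonneg h2 hε.le, mul_pos hε hη])]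
  congr 2
  ring

/-- The covariance of the kernels of two increments. -/
lemma IsPlanarContinuousFbm.covariance_incrementKernel {C : Fin 2 → ℝ → Ω → ℝ} (ha : 0 ≤ a)
    (hC : IsPlanarContinuousFbm H T C P) {ε η : ℝ} (hε : 0 < ε) (hη : 0 < η) {s t s' t' : ℝ}
    (hs : s ∈ Set.Icc 0 T) (ht : t ∈ Set.Icc 0 T)
    (hs' : s' ∈ Set.Icc 0 T) (ht' : t' ∈ Set.Icc 0 T) :
    (∫ ω, incrementKernel a C ε s t ω * incrementKernel a C η s' t' ω ∂P) -
      (∫ ω, incrementKernel a C ε s t ω ∂P) * ∫ ω, incrementKernel a C η s' t' ω ∂P =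
      1 / (4 * Real.pi ^ 2) * (incrementCov (selfAttractingCov H a) s t s' t' ^ 2 /
        ((incrementCov (selfAttractingCov H a) s t s t + ε) *
        (incrementCov (selfAttractingCov H a) s' t' s' t' + η) *
        ((incrementCov (selfAttractingCov H a) s t s t + ε) *
        (incrementCov (selfAttractingCov H a) s' t' s' t' + η) -
        incrementCov (selfAttractingCov H a) s t s' t' ^ 2))) := by
  rw [hC.integral_incrementKernel_mul ha hε hη hs ht hs' ht',
    hC.integral_incrementKernel ha hε hs ht, hC.integral_incrementKernel ha hη hs' ht']
  have h1 := (hC.fbm 0).incrementCov_self_nonneg ha hs ht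
  have h2 := (hC.fbm 0).incrementCov_self_nonneg ha hs' ht'
  have h3 := (hC.fbm 0).sq_incrementCov_le ha hs ht hs' ht'
  have h4 : 0 < (incrementCov (selfAttractingCov H a) s t s t + ε) *
        (incrementCov (selfAttractingCov H a) s' t' s' t' + η) -
        incrementCov (selfAttractingCov H a) s t s' t' ^ 2 := by
    nlinarith [mul_nonneg h1 hη.le, mul_nonneg h2 hε.le, mul_pos hε hη]
  have h5 : 0 < incrementCov (selfAttractingCov H a) s t s t + ε := by linarith
  have h6 : 0 < incrementCov (selfAttractingCov H a) s' t' s' t' + η := by linarith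
  field_simp
  ring

end Expectation

/-! ### Reduction to a continuous version of the noise. -/

lemma IsFractionalBrownianMotion.isContinuousFbm {Ω : Type*} [MeasurableSpace Ω] {P : Measure Ω}
    {H T : ℝ} (hH : 1 / 2 < H) {B C : ℝ → Ω → ℝ} (hB : IsFractionalBrownianMotion H B P)
    (hc : ∀ ω, Continuous fun t => C t ω) (hm : ∀ t, Measurable (C t))
    (hCB : ∀ t, 0 ≤ t → C t =ᵐ[P] B t) : IsContinuousFbm H T C P := by
  have hG : IsGaussianProcess (fun u : Set.Icc 0 T => C u) P :=
    (hB.isGaussianProcess.comp_right (fun u : Set.Icc 0 T => (⟨u, u.2.1⟩ : ℝ≥0))).congr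
      fun u => (hCB u u.2.1).symm
  have hcov : ∀ u ∈ Set.Icc 0 T, ∀ v ∈ Set.Icc 0 T, ∫ ω, C u ω * C v ω ∂P = fbmCov H u v :=
    fun u hu v hv => by
      rw [fbmCov, ← hB.covariance u v hu.1 hv.1]
      refine integral_congr_ae ?_
      filter_upwards [hCB u hu.1, hCB v hv.1] with ω h1 h2
      rw [h1, h2]
  refine ⟨⟨hc, hm, fun t ht => ?_, T ^ (2 * H) ⊔ 0, le_sup_right, fun t ht => ?_⟩, hcov, hG,
    fun u hu => ?_⟩
  · exact (hG.hasGaussianLaw_eval (t := ⟨t, ht⟩)).memLp_two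
  · simp_rw [sq]
    rw [hcov t ht t ht, fbmCov_self hH]
    exact (Real.rpow_le_rpow ht.1 ht.2 (by linarith)).trans le_sup_left
  · rw [← hB.centered u hu.1]
    exact integral_congr_ae (hCB u hu.1)

/-- The planar diffusion is almost surely the solution map applied to a continuous version of its
noise. -/
lemma IsPlanarFractionalSelfAttractingDiffusion.exists_version {Ω : Type*} [MeasurableSpace Ω]
    {P : Measure Ω} [IsProbabilityMeasure P] {H a T : ℝ} (hH : 1 / 2 < H) (hT : 0 ≤ T)
    {B : Fin 2 → ℝ → Ω → ℝ} {X : ℝ → Ω → EuclideanSpace ℝ (Fin 2)}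
    (hX : IsPlanarFractionalSelfAttractingDiffusion H a T B X P) :
    ∃ C : Fin 2 → ℝ → Ω → ℝ, IsPlanarContinuousFbm H T C P ∧
      ∀ᵐ ω ∂P, ∀ j, ∀ t ∈ Set.Icc 0 T, X t ω j = selfAttractingPath a (fun v => C j v ω) t := by
  have hBm : ∀ j t, 0 ≤ t → AEMeasurable (B j t) P := fun j t ht => by
    have hB := hX.fbm j
    have hG := hB.isGaussianProcess
    exact (hG.hasGaussianLaw_eval (t := ⟨t, ht⟩)).aemeasurable
  choose C hc hm hmax hae using fun j =>
    exists_continuous_version (hBm j) (hX.fbm j).continuous_paths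
  refine ⟨C, ⟨fun j => (hX.fbm j).isContinuousFbm hH (hc j) (hm j) fun t ht => ?_, hmax, ?_⟩, ?_⟩
  · filter_upwards [hae j] with ω hω using hω t ht
  -- Almost surely the whole paths agree, not merely the values at each fixed time, so the
  -- independence of the paths transfers.
  · refine iIndepFun.indepFun (f := fun (j : Fin 2) (ω : Ω) (t : ℝ≥0) => C j t ω)
      (hX.indep.congr fun j => ?_) (by decide)
    filter_upwards [hae j] with ω hω
    ext t
    exact (hω t t.2).symm
  · refine ae_all_iff.2 fun j => ?_
    filter_upwards [hae j, (hX.solution j).continuous_paths, (hX.solution j).equation]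
      with ω h1 h2 h3
    refine eq_selfAttractingPath hT h2 fun t ht => ?_
    rw [h3 t ht, h1 t ht.1]

/-! ### Integrability of the chain weights. -/

lemma integrableOn_abs_rpow_neg {δ : ℝ} (hδ : δ < 1) :
    IntegrableOn (fun x : ℝ => |x| ^ (-δ)) (Set.Ioc (-1) 1) := by
  have h1 : IntervalIntegrable (fun x : ℝ => |x| ^ (-δ)) volume 0 1 := by
    refine (intervalIntegral.intervalIntegrable_rpow' (a := 0) (b := 1) (r := -δ)
      (by linarith)).congr fun x hx => ?_
    rw [Set.uIoc_of_le zero_le_one] at hx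
    simp only [abs_of_pos hx.1]
  have h2 : IntervalIntegrable (fun x : ℝ => |x| ^ (-δ)) volume (-1) 0 := by
    have := ((IntervalIntegrable.iff_comp_neg (by simp)).1 h1).symm
    simpa using this
  exact (intervalIntegrable_iff_integrableOn_Ioc_of_le (by norm_num)).1 (h2.trans h1)

/-- The Riesz kernel is uniformly integrable against a finite measure on the line with bounded
density. -/
lemma exists_lintegral_abs_sub_rpow_le {δ : ℝ} (hδ0 : 0 ≤ δ) (hδ : δ < 1) (T : ℝ) :
    ∃ K : ℝ≥0∞, K ≠ ∞ ∧ ∀ y : ℝ,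
      ∫⁻ x in Set.Ioc 0 T, ENNReal.ofReal (|x - y| ^ (-δ)) ≤ K := by
  refine ⟨volume (Set.Ioc 0 T) + ∫⁻ x in Set.Ioc (-1) 1, ENNReal.ofReal (|x| ^ (-δ)), ?_,
    fun y => ?_⟩
  · refine ENNReal.add_ne_top.2 ⟨by simp, ?_⟩
    have := (integrableOn_abs_rpow_neg hδ).hasFiniteIntegral
    rw [hasFiniteIntegral_iff_ofReal (Eventually.of_forall fun x => by positivity)] at this
    exact this.ne
  · set h : ℝ → ℝ≥0∞ :=
      (Set.Ioc (-1) 1).indicator fun x => ENNReal.ofReal (|x| ^ (-δ)) with hh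
    have hle : ∀ x : ℝ, ENNReal.ofReal (|x| ^ (-δ)) ≤ 1 + h x := fun x => by
      by_cases hx : x ∈ Set.Ioc (-1 : ℝ) 1
      · rw [hh, Set.indicator_of_mem hx]
        exact le_add_self
      · rw [hh, Set.indicator_of_notMem hx, add_zero, ENNReal.ofReal_le_one]
        refine Real.rpow_le_one_of_one_le_of_nonpos ?_ (by linarith)
        by_contra hc
        obtain ⟨h1, h2⟩ := abs_lt.1 (not_le.1 hc)
        exact hx ⟨h1, h2.le⟩
    calc ∫⁻ x in Set.Ioc 0 T, ENNReal.ofReal (|x - y| ^ (-δ))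
        ≤ ∫⁻ x in Set.Ioc 0 T, (1 + h (x - y)) := lintegral_mono fun x => hle (x - y)
      _ = volume (Set.Ioc 0 T) + ∫⁻ x in Set.Ioc 0 T, h (x - y) := by
          rw [lintegral_add_left measurable_const]; simp
      _ ≤ volume (Set.Ioc 0 T) + ∫⁻ x, h (x - y) := by
          gcongr
          exact Measure.restrict_le_self
      _ = _ := by
          rw [lintegral_sub_right_eq_self h, hh, lintegral_indicator measurableSet_Ioc]

lemma measurable_chainWeight (δ : ℝ) :
    Measurable fun z : (ℝ × ℝ) × ℝ × ℝ => chainWeight δ z.1.1 z.1.2 z.2.1 z.2.2 := by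
  unfold chainWeight
  fun_prop

/-- The last point of the chain occurs in a single factor, whose integral is bounded uniformly in
its neighbour; removing the points one by one from the end leaves the finite mass of the first. -/
lemma integrable_chainWeight {δ : ℝ} (hδ0 : 0 ≤ δ) (hδ : δ < 1) (T : ℝ) :
    Integrable (fun z : (ℝ × ℝ) × ℝ × ℝ => chainWeight δ z.1.1 z.1.2 z.2.1 z.2.2)
      (((volume.restrict (Set.Ioc 0 T)).prod (volume.restrict (Set.Ioc 0 T))).prod
        ((volume.restrict (Set.Ioc 0 T)).prod (volume.restrict (Set.Ioc 0 T)))) := by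
  obtain ⟨K, hK, hle⟩ := exists_lintegral_abs_sub_rpow_le hδ0 hδ T
  set ν : Measure ℝ := volume.restrict (Set.Ioc 0 T)
  refine ⟨(measurable_chainWeight δ).aestronglyMeasurable, ?_⟩
  rw [hasFiniteIntegral_iff_ofReal (Eventually.of_forall fun z => chainWeight_nonneg _ _ _ _ _)]
  set k : ℝ → ℝ → ℝ≥0∞ := fun x y => ENNReal.ofReal (|x - y| ^ (-δ)) with hk
  have hkm : Measurable (Function.uncurry k) := by
    simp only [hk, Function.uncurry_def]; fun_prop
  have hkr : ∀ x, Measurable (k x) := fun x => hkm.of_uncurry_left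
  have hsymm : ∀ x, ∫⁻ y, k x y ∂ν ≤ K := fun x => by
    simp only [hk, abs_sub_comm x]; exact hle x
  have h1 : ∀ z : (ℝ × ℝ) × ℝ × ℝ, ENNReal.ofReal (chainWeight δ z.1.1 z.1.2 z.2.1 z.2.2) =
      k z.1.1 z.1.2 * (k z.1.2 z.2.1 * k z.2.1 z.2.2) := fun z => by
    rw [chainWeight, ENNReal.ofReal_mul (by positivity), ENNReal.ofReal_mul (by positivity),
      mul_assoc]
  simp_rw [h1]
  have h2 : ∀ q, ∫⁻ z : ℝ × ℝ, k q z.1 * k z.1 z.2 ∂(ν.prod ν) ≤ K * K := fun q => by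
    rw [lintegral_prod _ (by fun_prop)]
    calc ∫⁻ r, ∫⁻ w, k q r * k r w ∂ν ∂ν = ∫⁻ r, k q r * ∫⁻ w, k r w ∂ν ∂ν := by
          simp_rw [lintegral_const_mul _ (hkr _)]
      _ ≤ ∫⁻ r, k q r * K ∂ν := lintegral_mono fun r => by gcongr; exact hsymm r
      _ = (∫⁻ r, k q r ∂ν) * K := lintegral_mul_const _ (hkr q)
      _ ≤ K * K := by gcongr; exact hsymm q
  rw [lintegral_prod _ (by fun_prop)]
  calc ∫⁻ z : ℝ × ℝ, ∫⁻ y : ℝ × ℝ, k z.1 z.2 * (k z.2 y.1 * k y.1 y.2) ∂(ν.prod ν) ∂(ν.prod ν)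
      = ∫⁻ z : ℝ × ℝ, k z.1 z.2 * ∫⁻ y : ℝ × ℝ, k z.2 y.1 * k y.1 y.2 ∂(ν.prod ν) ∂(ν.prod ν) := by
        refine lintegral_congr fun z => ?_
        rw [lintegral_const_mul _ (by fun_prop)]
    _ ≤ ∫⁻ z : ℝ × ℝ, k z.1 z.2 * (K * K) ∂(ν.prod ν) :=
        lintegral_mono fun z => by gcongr; exact h2 z.2
    _ = ∫⁻ x, (∫⁻ y, k x y ∂ν) * (K * K) ∂ν := by
        rw [lintegral_prod _ (by fun_prop)]
        simp_rw [lintegral_mul_const _ (hkr _)]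
    _ ≤ ∫⁻ _, K * (K * K) ∂ν := lintegral_mono fun x => by gcongr; exact hsymm x
    _ = K * (K * K) * ν Set.univ := by simp
    _ < ∞ := ENNReal.mul_lt_top (ENNReal.mul_lt_top hK.lt_top (ENNReal.mul_lt_top hK.lt_top
        hK.lt_top)) (measure_lt_top _ _)

lemma measurePreserving_prod_prod_comm {α : Type*} [MeasurableSpace α] (ν : Measure α)
    [SFinite ν] :
    MeasurePreserving (fun z : (α × α) × α × α => ((z.1.1, z.2.1), (z.1.2, z.2.2)))
      ((ν.prod ν).prod (ν.prod ν)) ((ν.prod ν).prod (ν.prod ν)) := by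
  have h1 := measurePreserving_prodAssoc ν ν (ν.prod ν)
  have h2 := measurePreserving_prodAssoc ν ν ν
  have h2' := h2.symm
  have h3 : MeasurePreserving (Prod.map Prod.swap id) ((ν.prod ν).prod ν) ((ν.prod ν).prod ν) :=
    Measure.measurePreserving_swap.prod (MeasurePreserving.id ν)
  exact h1.symm.comp (((MeasurePreserving.id ν).prod (h2.comp (h3.comp h2'))).comp h1)

/-- The six chains differ by permutations of the four times, and each permutation used preserves the
product measure. -/
lemma integrable_pairWeight {δ : ℝ} (hδ0 : 0 ≤ δ) (hδ : δ < 1) (T : ℝ) :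
    Integrable (fun z : (ℝ × ℝ) × ℝ × ℝ => pairWeight δ z.1.1 z.1.2 z.2.1 z.2.2)
      (((volume.restrict (Set.Ioc 0 T)).prod (volume.restrict (Set.Ioc 0 T))).prod
        ((volume.restrict (Set.Ioc 0 T)).prod (volume.restrict (Set.Ioc 0 T)))) := by
  have h := integrable_chainWeight hδ0 hδ T
  set ν : Measure ℝ := volume.restrict (Set.Ioc 0 T)
  have hm := measurePreserving_prod_prod_comm ν
  have hs : MeasurePreserving Prod.swap (ν.prod ν) (ν.prod ν) := Measure.measurePreserving_swap
  have hi := MeasurePreserving.id (ν.prod ν)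
  have ho : MeasurePreserving Prod.swap ((ν.prod ν).prod (ν.prod ν)) ((ν.prod ν).prod (ν.prod ν)) :=
    Measure.measurePreserving_swap
  have c1 := hm.integrable_comp_of_integrable h
  have c2 := ((hi.prod hs).comp hm).integrable_comp_of_integrable h
  have c4 := ((hs.prod hs).comp hm).integrable_comp_of_integrable h
  have c5 := ((hs.prod hi).comp hm).integrable_comp_of_integrable h
  have c6 := ho.integrable_comp_of_integrable h
  exact ((c1.add c2).add h).add ((c4.add c5).add c6)

/-! ### Covariances of averages and convergence in `L²`. -/

section Abstract

variable {Ω : Type*} [MeasurableSpace Ω] {P : Measure Ω} [IsProbabilityMeasure P]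
  {S : Type*} [MeasurableSpace S] {κ : Measure S} [IsFiniteMeasure κ]

lemma memLp_integral_of_bound {f : S → Ω → ℝ} (hf : Measurable (Function.uncurry f)) {K : ℝ}
    (hfK : ∀ z ω, |f z ω| ≤ K) : MemLp (fun ω => ∫ z, f z ω ∂κ) 2 P := by
  refine MemLp.of_bound (C := K * κ.real Set.univ) ?_ (Eventually.of_forall fun ω => ?_)
  · exact (StronglyMeasurable.integral_prod_right (f := fun ω z => f z ω)
      (hf.comp measurable_swap).stronglyMeasurable).aestronglyMeasurable
  · exact norm_integral_le_of_norm_le_const (Eventually.of_forall fun z => hfK z ω)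

/-- The covariance of two averaged families of bounded random variables. -/
lemma covariance_integral_integral {f g : S → Ω → ℝ} (hf : Measurable (Function.uncurry f))
    (hg : Measurable (Function.uncurry g)) {K L : ℝ} (hfK : ∀ z ω, |f z ω| ≤ K)
    (hgL : ∀ z ω, |g z ω| ≤ L) :
    (∫ ω, (∫ z, f z ω ∂κ) * (∫ z, g z ω ∂κ) ∂P) -
        (∫ ω, (∫ z, f z ω ∂κ) ∂P) * (∫ ω, (∫ z, g z ω ∂κ) ∂P) =
      ∫ p, ((∫ ω, f p.1 ω * g p.2 ω ∂P) - (∫ ω, f p.1 ω ∂P) * ∫ ω, g p.2 ω ∂P)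
        ∂(κ.prod κ) := by
  have hfi : Integrable (Function.uncurry f) (κ.prod P) :=
    Integrable.of_bound hf.aestronglyMeasurable K (Eventually.of_forall fun z => hfK z.1 z.2)
  have hgi : Integrable (Function.uncurry g) (κ.prod P) :=
    Integrable.of_bound hg.aestronglyMeasurable L (Eventually.of_forall fun z => hgL z.1 z.2)
  have hfg : Integrable (Function.uncurry fun (p : S × S) ω => f p.1 ω * g p.2 ω)
      ((κ.prod κ).prod P) := by
    refine Integrable.of_bound (C := K * L) ?_ (Eventually.of_forall fun z => ?_)
    · refine Measurable.aestronglyMeasurable ?_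
      exact (hf.comp (by fun_prop : Measurable fun z : (S × S) × Ω => (z.1.1, z.2))).mul
        (hg.comp (by fun_prop : Measurable fun z : (S × S) × Ω => (z.1.2, z.2)))
    · simp only [Function.uncurry_def, norm_mul]
      exact mul_le_mul (hfK _ _) (hgL _ _) (norm_nonneg _) ((abs_nonneg _).trans (hfK z.1.1 z.2))
  have i1 : Integrable (fun p : S × S => ∫ ω, f p.1 ω * g p.2 ω ∂P) (κ.prod κ) :=
    hfg.integral_prod_left
  have i2 : Integrable (fun p : S × S => (∫ ω, f p.1 ω ∂P) * ∫ ω, g p.2 ω ∂P) (κ.prod κ) :=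
    hfi.integral_prod_left.mul_prod hgi.integral_prod_left
  rw [integral_sub i1 i2]
  congr 1
  · simp_rw [← integral_prod_mul]
    exact (integral_integral_swap hfg).symm
  · rw [integral_prod_mul (fun z => ∫ ω, f z ω ∂P) (fun z => ∫ ω, g z ω ∂P),
      integral_integral_swap hfi, integral_integral_swap hgi]

lemma integral_centered_mul {f g : Ω → ℝ} (hf : MemLp f 2 P) (hg : MemLp g 2 P) :
    ∫ ω, (f ω - ∫ ω', f ω' ∂P) * (g ω - ∫ ω', g ω' ∂P) ∂P =
      (∫ ω, f ω * g ω ∂P) - (∫ ω, f ω ∂P) * ∫ ω, g ω ∂P :=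
  covariance_eq_sub hf hg

end Abstract

lemma eventually_pos_prod : ∀ᶠ e : ℝ × ℝ in 𝓝[>] 0 ×ˢ 𝓝[>] 0, 0 < e.1 ∧ 0 < e.2 :=
  (eventually_mem_nhdsWithin (s := Set.Ioi (0 : ℝ))).prod_mk eventually_mem_nhdsWithin

/-- A family in `L²` whose Gram matrix converges is convergent. -/
lemma exists_tendsto_eLpNorm_of_tendsto_integral_mul {Ω : Type*} [MeasurableSpace Ω]
    {P : Measure Ω} {D : ℝ → Ω → ℝ} (hD : ∀ ε, 0 < ε → MemLp (D ε) 2 P) {L : ℝ}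
    (hL : Tendsto (fun p : ℝ × ℝ => ∫ ω, D p.1 ω * D p.2 ω ∂P) (𝓝[>] 0 ×ˢ 𝓝[>] 0) (𝓝 L)) :
    ∃ Z : Ω → ℝ, MemLp Z 2 P ∧
      Tendsto (fun ε => eLpNorm (fun ω => D ε ω - Z ω) 2 P) (𝓝[>] 0) (𝓝 0) := by
  classical
  set d : ℝ → Lp ℝ 2 P := fun ε => if h : 0 < ε then (hD ε h).toLp (D ε) else 0 with hd
  have hin : Tendsto (fun p : ℝ × ℝ => inner ℝ (d p.1) (d p.2)) (𝓝[>] 0 ×ˢ 𝓝[>] 0) (𝓝 L) := by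
    refine hL.congr' ?_
    filter_upwards [eventually_pos_prod] with p hp
    simp only [hd, hp.1, hp.2, dite_true]
    rw [inner_toLp_eq]
  have hdiag : Tendsto (fun ε => inner ℝ (d ε) (d ε)) (𝓝[>] 0) (𝓝 L) :=
    hin.comp (tendsto_id.prodMk tendsto_id)
  have hc : Cauchy (map d (𝓝[>] 0)) := by
    rw [cauchy_map_iff]
    refine ⟨inferInstance, ?_⟩
    rw [Metric.uniformity_eq_comap_nhds_zero, tendsto_comap_iff]
    -- Expanding the squared distance gives the limit `L - 2 * L + L = 0`; the diagonal terms
    -- converge because the joint limit may be taken along `ε = η`.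
    have h1 : Tendsto (fun p : ℝ × ℝ => √(inner ℝ (d p.1) (d p.1) - 2 * inner ℝ (d p.1) (d p.2) +
        inner ℝ (d p.2) (d p.2))) (𝓝[>] 0 ×ˢ 𝓝[>] 0) (𝓝 √(L - 2 * L + L)) :=
      (((hdiag.comp tendsto_fst).sub (hin.const_mul 2)).add (hdiag.comp tendsto_snd)).sqrt
    rw [show L - 2 * L + L = 0 by ring, Real.sqrt_zero] at h1
    refine h1.congr fun p => ?_
    rw [Function.comp_apply, dist_eq_norm, ← real_inner_sub_sub_self, real_inner_self_eq_norm_sq,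
      Real.sqrt_sq (norm_nonneg _)]
  obtain ⟨z, hz⟩ := CompleteSpace.complete hc
  refine ⟨z, Lp.memLp z, ?_⟩
  have h2 := (Lp.tendsto_Lp_iff_tendsto_eLpNorm' d z).1 hz
  refine h2.congr' ?_
  filter_upwards [self_mem_nhdsWithin] with ε hε
  refine eLpNorm_congr_ae ?_
  have h3 : d ε = (hD ε hε).toLp (D ε) := by simp only [hd]; exact dif_pos hε
  rw [h3]
  filter_upwards [(hD ε hε).coeFn_toLp] with ω hω
  rw [Pi.sub_apply, hω]

/-! ### The time triangle and the dominated convergence argument. -/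

/-- The measure `ds dt` on the triangle `0 < s ≤ t ≤ T`. -/
noncomputable def triangleMeasure (T : ℝ) : Measure (ℝ × ℝ) :=
  ((volume.restrict (Set.Ioc 0 T)).prod (volume.restrict (Set.Ioc 0 T))).restrict
    {z | z.1 ≤ z.2}

instance (T : ℝ) : IsFiniteMeasure (triangleMeasure T) := by
  unfold triangleMeasure; infer_instance

lemma measurableSet_le_fst_snd : MeasurableSet {z : ℝ × ℝ | z.1 ≤ z.2} :=
  measurableSet_le measurable_fst measurable_snd

lemma integral_triangleMeasure {T : ℝ} (hT : 0 ≤ T) {f : ℝ × ℝ → ℝ}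
    (hf : Integrable f (triangleMeasure T)) :
    ∫ z, f z ∂(triangleMeasure T) = ∫ t in (0 : ℝ)..T, ∫ s in (0 : ℝ)..t, f (s, t) := by
  rw [triangleMeasure, ← integral_indicator measurableSet_le_fst_snd, integral_prod_symm _
    ((integrable_indicator_iff measurableSet_le_fst_snd).2 hf),
    intervalIntegral.integral_of_le hT]
  refine setIntegral_congr_fun measurableSet_Ioc fun t ht => ?_
  have h1 : ∀ s, Set.indicator {z : ℝ × ℝ | z.1 ≤ z.2} f (s, t) =
      Set.indicator (Set.Iic t) (fun s => f (s, t)) s := fun s => rfl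
  simp_rw [h1]
  rw [integral_indicator measurableSet_Iic, Measure.restrict_restrict measurableSet_Iic,
    intervalIntegral.integral_of_le ht.1.le]
  congr 2
  ext s
  simp only [Set.mem_inter_iff, Set.mem_Iic, Set.mem_Ioc]
  exact ⟨fun h => ⟨h.2.1, h.1⟩, fun h => ⟨h.2, h.1, h.2.trans ht.2⟩⟩

lemma ae_prod_ne (ν : Measure ℝ) [SFinite ν] [NullSingletonClass ν] :
    ∀ᵐ z ∂(ν.prod ν), z.1 ≠ z.2 := by
  rw [Measure.ae_prod_iff_ae_ae (by
    exact (measurableSet_eq_fun measurable_fst measurable_snd).compl)]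
  refine Eventually.of_forall fun x => ?_
  filter_upwards [(Set.countable_singleton x).ae_notMem ν] with y hy h
  exact hy h.symm

/-- Almost every pair of points of the triangle is in general position. -/
lemma ae_triangleMeasure_prod (T : ℝ) :
    ∀ᵐ p ∂((triangleMeasure T).prod (triangleMeasure T)),
      (0 ≤ p.1.1 ∧ p.1.1 < p.1.2 ∧ p.1.2 ≤ T) ∧ (0 ≤ p.2.1 ∧ p.2.1 < p.2.2 ∧ p.2.2 ≤ T) ∧
      p.1.1 ≠ p.2.1 ∧ p.1.2 ≠ p.2.2 ∧ p.1.1 ≠ p.2.2 ∧ p.2.1 ≠ p.1.2 := by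
  have htri : ∀ᵐ z ∂(triangleMeasure T), 0 ≤ z.1 ∧ z.1 < z.2 ∧ z.2 ≤ T := by
    have h1 := ae_restrict_mem (μ := (volume.restrict (Set.Ioc 0 T)).prod
      (volume.restrict (Set.Ioc 0 T))) measurableSet_le_fst_snd
    have h2 := ae_restrict_of_ae (s := {z : ℝ × ℝ | z.1 ≤ z.2})
      (ae_prod_ne (volume.restrict (Set.Ioc 0 T)))
    have h3 : ∀ᵐ x ∂(volume.restrict (Set.Ioc 0 T)), x ∈ Set.Ioc 0 T :=
      ae_restrict_mem measurableSet_Ioc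
    have h4 := ae_restrict_of_ae (s := {z : ℝ × ℝ | z.1 ≤ z.2})
      ((Measure.quasiMeasurePreserving_fst (μ := volume.restrict (Set.Ioc 0 T))
        (ν := volume.restrict (Set.Ioc 0 T))).ae h3)
    have h5 := ae_restrict_of_ae (s := {z : ℝ × ℝ | z.1 ≤ z.2})
      ((Measure.quasiMeasurePreserving_snd (μ := volume.restrict (Set.Ioc 0 T))
        (ν := volume.restrict (Set.Ioc 0 T))).ae h3)
    rw [triangleMeasure]
    filter_upwards [h1, h2, h4, h5] with z h1 h2 h4 h5
    exact ⟨h4.1.le, lt_of_le_of_ne h1 h2, h5.2⟩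
  have hf := (Measure.quasiMeasurePreserving_fst (μ := triangleMeasure T)
    (ν := triangleMeasure T)).ae htri
  have hs := (Measure.quasiMeasurePreserving_snd (μ := triangleMeasure T)
    (ν := triangleMeasure T)).ae htri
  set ν : Measure ℝ := volume.restrict (Set.Ioc 0 T)
  have hne := ae_prod_ne ν
  have hm := (measurePreserving_prod_prod_comm ν).quasiMeasurePreserving
  have hsw : MeasurePreserving Prod.swap (ν.prod ν) (ν.prod ν) := Measure.measurePreserving_swap
  have hsi := (hsw.prod (MeasurePreserving.id (ν.prod ν))).quasiMeasurePreserving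
  have h1 := hm.ae (Measure.quasiMeasurePreserving_fst.ae hne)
  have h2 := hm.ae (Measure.quasiMeasurePreserving_snd.ae hne)
  -- Exchanging the end points of the first pair turns the conditions on equally placed end points
  -- into the conditions on opposite ones.
  have h3 := hsi.ae (hm.ae (Measure.quasiMeasurePreserving_fst.ae hne))
  have h4 := hsi.ae (hm.ae (Measure.quasiMeasurePreserving_snd.ae hne))
  rw [triangleMeasure, Measure.prod_restrict] at hf hs ⊢
  filter_upwards [hf, hs, ae_restrict_of_ae h1, ae_restrict_of_ae h2, ae_restrict_of_ae h3,
    ae_restrict_of_ae h4] with p hf hs h1 h2 h3 h4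
  exact ⟨hf, hs, h1, h2, h4, h3.symm⟩

lemma integrable_pairWeight_triangleMeasure {δ : ℝ} (hδ0 : 0 ≤ δ) (hδ : δ < 1) (T : ℝ) :
    Integrable (fun z : (ℝ × ℝ) × ℝ × ℝ => pairWeight δ z.1.1 z.1.2 z.2.1 z.2.2)
      ((triangleMeasure T).prod (triangleMeasure T)) := by
  rw [triangleMeasure, Measure.prod_restrict]
  exact (integrable_pairWeight hδ0 hδ T).restrict

lemma abs_incrementKernel_le {Ω : Type*} {a : ℝ} {C : Fin 2 → ℝ → Ω → ℝ} {ε : ℝ} (hε : 0 < ε)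
    (s t : ℝ) (ω : Ω) :
    |incrementKernel a C ε s t ω| ≤ (√(2 * Real.pi * ε))⁻¹ * (√(2 * Real.pi * ε))⁻¹ := by
  rw [incrementKernel, abs_of_nonneg (mul_nonneg (heatKernel_nonneg _ _) (heatKernel_nonneg _ _))]
  exact mul_le_mul (heatKernel_le hε _) (heatKernel_le hε _) (heatKernel_nonneg _ _)
    (by positivity)

section Diffusion

variable {Ω : Type*} [MeasurableSpace Ω] {P : Measure Ω} {H a T : ℝ} {C : Fin 2 → ℝ → Ω → ℝ}

lemma IsPlanarContinuousFbm.measurable_incrementKernel (hC : IsPlanarContinuousFbm H T C P)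
    (ε : ℝ) :
    Measurable (Function.uncurry fun (z : ℝ × ℝ) ω => incrementKernel a C ε z.1 z.2 ω) := by
  have h : ∀ j, Measurable (Function.uncurry fun (t : ℝ) ω =>
      selfAttractingPath a (fun v => C j v ω) t) := fun j =>
    measurable_uncurry_of_continuous_of_measurable
      (fun ω => continuous_selfAttractingPath a ((hC.fbm j).continuous_path ω))
      (measurable_selfAttractingPath a (hC.fbm j).continuous_path (hC.fbm j).measurable_eval)
  have hd : ∀ j, Measurable fun z : (ℝ × ℝ) × Ω => selfAttractingPath a (fun v => C j v z.2) z.1.2 -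
      selfAttractingPath a (fun v => C j v z.2) z.1.1 := fun j =>
    ((h j).comp (by fun_prop : Measurable fun z : (ℝ × ℝ) × Ω => (z.1.2, z.2))).sub
      ((h j).comp (by fun_prop : Measurable fun z : (ℝ × ℝ) × Ω => (z.1.1, z.2)))
  exact ((continuous_heatKernel ε).measurable.comp (hd 0)).mul
    ((continuous_heatKernel ε).measurable.comp (hd 1))

lemma ae_smoothedSelfIntersectionLocalTime_eq (hT : 0 ≤ T) (hC : IsPlanarContinuousFbm H T C P)
    {X : ℝ → Ω → EuclideanSpace ℝ (Fin 2)}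
    (hX : ∀ᵐ ω ∂P, ∀ j, ∀ t ∈ Set.Icc 0 T, X t ω j = selfAttractingPath a (fun v => C j v ω) t)
    {ε : ℝ} (hε : 0 < ε) :
    smoothedSelfIntersectionLocalTime X T ε =ᵐ[P]
      fun ω => ∫ z, incrementKernel a C ε z.1 z.2 ω ∂(triangleMeasure T) := by
  filter_upwards [hX] with ω hω
  rw [integral_triangleMeasure hT (f := fun z => incrementKernel a C ε z.1 z.2 ω)
    (Integrable.of_bound
      ((hC.measurable_incrementKernel ε).comp measurable_prodMk_right).aestronglyMeasurable _
      (Eventually.of_forall fun z => abs_incrementKernel_le hε z.1 z.2 ω)),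
    smoothedSelfIntersectionLocalTime]
  refine intervalIntegral.integral_congr fun t ht => ?_
  rw [Set.uIcc_of_le hT] at ht
  refine intervalIntegral.integral_congr fun s hs => ?_
  rw [Set.uIcc_of_le ht.1] at hs
  have hs' : s ∈ Set.Icc 0 T := ⟨hs.1, hs.2.trans ht.2⟩
  simp only [planarHeatKernel_eq hε, PiLp.sub_apply, hω _ t ht, hω _ s hs', incrementKernel]

variable [IsProbabilityMeasure P]

/-- The covariances of the smoothed self-intersection local times converge. -/
lemma IsPlanarContinuousFbm.exists_tendsto_covariance (hH : 1 / 2 < H) (hH' : H < 3 / 4)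
    (ha : 0 ≤ a) (hT : 0 < T) (hC : IsPlanarContinuousFbm H T C P) :
    ∃ L : ℝ, Tendsto (fun e : ℝ × ℝ => ∫ p,
      ((∫ ω, incrementKernel a C e.1 p.1.1 p.1.2 ω * incrementKernel a C e.2 p.2.1 p.2.2 ω ∂P) -
        (∫ ω, incrementKernel a C e.1 p.1.1 p.1.2 ω ∂P) *
          ∫ ω, incrementKernel a C e.2 p.2.1 p.2.2 ω ∂P)
        ∂((triangleMeasure T).prod (triangleMeasure T))) (𝓝[>] 0 ×ˢ 𝓝[>] 0) (𝓝 L) := by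
  obtain ⟨K, hK, hratio⟩ := exists_ratio_le_pairWeight hH hH' ha hT (hC.fbm 0)
  set V := incrementCov (selfAttractingCov H a) with hV
  refine ⟨∫ p : (ℝ × ℝ) × ℝ × ℝ, 1 / (4 * Real.pi ^ 2) * (V p.1.1 p.1.2 p.2.1 p.2.2 ^ 2 /
      ((V p.1.1 p.1.2 p.1.1 p.1.2 + 0) * (V p.2.1 p.2.2 p.2.1 p.2.2 + 0) *
        ((V p.1.1 p.1.2 p.1.1 p.1.2 + 0) * (V p.2.1 p.2.2 p.2.1 p.2.2 + 0) -
          V p.1.1 p.1.2 p.2.1 p.2.2 ^ 2))) ∂((triangleMeasure T).prod (triangleMeasure T)),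
    tendsto_integral_filter_of_dominated_convergence
      (fun p => 1 / (4 * Real.pi ^ 2) * (K * pairWeight (4 * H / 3) p.1.1 p.1.2 p.2.1 p.2.2))
      (Eventually.of_forall fun e => ?_) ?_ ?_ ?_⟩
  · have hm : ∀ ε, Measurable (Function.uncurry fun (z : ℝ × ℝ) ω =>
        incrementKernel a C ε z.1 z.2 ω) := hC.measurable_incrementKernel
    have h1 : StronglyMeasurable fun p : (ℝ × ℝ) × ℝ × ℝ =>
        ∫ ω, incrementKernel a C e.1 p.1.1 p.1.2 ω * incrementKernel a C e.2 p.2.1 p.2.2 ω ∂P :=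
      StronglyMeasurable.integral_prod_right (f := fun (p : (ℝ × ℝ) × ℝ × ℝ) ω =>
        incrementKernel a C e.1 p.1.1 p.1.2 ω * incrementKernel a C e.2 p.2.1 p.2.2 ω)
        (((hm e.1).comp (by fun_prop :
          Measurable fun z : ((ℝ × ℝ) × ℝ × ℝ) × Ω => (z.1.1, z.2))).mul
          ((hm e.2).comp (by fun_prop :
          Measurable fun z : ((ℝ × ℝ) × ℝ × ℝ) × Ω => (z.1.2, z.2)))).stronglyMeasurable
    have h2 : ∀ ε, StronglyMeasurable fun z : ℝ × ℝ => ∫ ω, incrementKernel a C ε z.1 z.2 ω ∂P :=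
      fun ε => StronglyMeasurable.integral_prod_right (hm ε).stronglyMeasurable
    exact (h1.sub (((h2 e.1).comp_measurable measurable_fst).mul
      ((h2 e.2).comp_measurable measurable_snd))).aestronglyMeasurable
  · filter_upwards [eventually_pos_prod] with e he
    filter_upwards [ae_triangleMeasure_prod T] with p hp
    obtain ⟨⟨h1, h2, h3⟩, ⟨h4, h5, h6⟩, h7, h8, h9, h10⟩ := hp
    rw [hC.covariance_incrementKernel ha he.1 he.2 ⟨h1, h2.le.trans h3⟩ ⟨h1.trans h2.le, h3⟩
      ⟨h4, h5.le.trans h6⟩ ⟨h4.trans h5.le, h6⟩]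
    obtain ⟨hd, hr⟩ := hratio _ _ _ _ h1 h2 h3 h4 h5 h6 h7 h8 h9 h10
    rw [← hV]
    set lam := V p.1.1 p.1.2 p.1.1 p.1.2
    set rho := V p.2.1 p.2.2 p.2.1 p.2.2
    set mu := V p.1.1 p.1.2 p.2.1 p.2.2
    have hl : 0 ≤ lam := (hC.fbm 0).incrementCov_self_nonneg ha ⟨h1, h2.le.trans h3⟩
      ⟨h1.trans h2.le, h3⟩
    have hrho : 0 ≤ rho := (hC.fbm 0).incrementCov_self_nonneg ha ⟨h4, h5.le.trans h6⟩
      ⟨h4.trans h5.le, h6⟩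
    -- Smoothing increases the product of the variances and leaves `mu` unchanged, so the ratio is
    -- largest without smoothing and the dominating function does not depend on `e`.
    have hlr : lam * rho ≤ (lam + e.1) * (rho + e.2) := by
      nlinarith [mul_nonneg hl he.2.le, mul_nonneg hrho he.1.le, mul_pos he.1 he.2]
    have hlr0 : 0 < lam * rho := by nlinarith [sq_nonneg mu]
    have hle : mu ^ 2 / ((lam + e.1) * (rho + e.2) * ((lam + e.1) * (rho + e.2) - mu ^ 2)) ≤
        mu ^ 2 / (lam * rho * (lam * rho - mu ^ 2)) :=
      div_le_div_of_nonneg_left (sq_nonneg _) (mul_pos hlr0 hd)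
        (mul_le_mul hlr (by linarith) hd.le (hlr0.le.trans hlr))
    have hnn : 0 ≤ mu ^ 2 / ((lam + e.1) * (rho + e.2) * ((lam + e.1) * (rho + e.2) - mu ^ 2)) :=
      div_nonneg (sq_nonneg _) (mul_nonneg (hlr0.le.trans hlr) (by linarith))
    rw [Real.norm_of_nonneg (mul_nonneg (by positivity) hnn)]
    exact mul_le_mul_of_nonneg_left (hle.trans hr) (by positivity)
  · exact ((integrable_pairWeight_triangleMeasure (by linarith) (by linarith) T).const_mul
      K).const_mul _
  · filter_upwards [ae_triangleMeasure_prod T] with p hp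
    obtain ⟨⟨h1, h2, h3⟩, ⟨h4, h5, h6⟩, h7, h8, h9, h10⟩ := hp
    obtain ⟨hd, -⟩ := hratio _ _ _ _ h1 h2 h3 h4 h5 h6 h7 h8 h9 h10
    have hf : Tendsto (fun e : ℝ × ℝ => e.1) (𝓝[>] (0 : ℝ) ×ˢ 𝓝[>] (0 : ℝ)) (𝓝 0) :=
      (tendsto_nhdsWithin_of_tendsto_nhds tendsto_id).comp tendsto_fst
    have hs : Tendsto (fun e : ℝ × ℝ => e.2) (𝓝[>] (0 : ℝ) ×ˢ 𝓝[>] (0 : ℝ)) (𝓝 0) :=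
      (tendsto_nhdsWithin_of_tendsto_nhds tendsto_id).comp tendsto_snd
    have hprod := (hf.const_add (V p.1.1 p.1.2 p.1.1 p.1.2)).mul
      (hs.const_add (V p.2.1 p.2.2 p.2.1 p.2.2))
    have hlim := ((tendsto_const_nhds (x := V p.1.1 p.1.2 p.2.1 p.2.2 ^ 2)).div
      (hprod.mul (hprod.sub_const (V p.1.1 p.1.2 p.2.1 p.2.2 ^ 2))) (by
        simp only [add_zero]
        have := sq_nonneg (V p.1.1 p.1.2 p.2.1 p.2.2)
        exact (mul_pos (by linarith) hd).ne')).const_mul (1 / (4 * Real.pi ^ 2))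
    refine hlim.congr' ?_
    filter_upwards [eventually_pos_prod] with e he
    rw [Pi.div_apply, hC.covariance_incrementKernel ha he.1 he.2 ⟨h1, h2.le.trans h3⟩
      ⟨h1.trans h2.le, h3⟩ ⟨h4, h5.le.trans h6⟩ ⟨h4.trans h5.le, h6⟩]

end Diffusion

theorem theorem5p1 {Ω : Type*} [MeasurableSpace Ω] (P : Measure Ω) [IsProbabilityMeasure P]
    (H a T : ℝ) (hH : 1 / 2 < H) (hH' : H < 3 / 4) (ha : 0 < a) (hT : 0 < T)
    (B : Fin 2 → ℝ → Ω → ℝ) (X : ℝ → Ω → EuclideanSpace ℝ (Fin 2))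
    (hX : IsPlanarFractionalSelfAttractingDiffusion H a T B X P) :
    (∀ ε : ℝ, 0 < ε → MemLp (smoothedSelfIntersectionLocalTime X T ε) 2 P) ∧
    ∃ Z : Ω → ℝ, MemLp Z 2 P ∧
      Tendsto (fun ε : ℝ => eLpNorm (fun ω =>
          (smoothedSelfIntersectionLocalTime X T ε ω
            - ∫ ω', smoothedSelfIntersectionLocalTime X T ε ω' ∂P) - Z ω) 2 P)
        (𝓝[>] 0) (𝓝 0) := by
  obtain ⟨C, hC, hXC⟩ := hX.exists_version hH hT.le
  have heq := fun ε (hε : 0 < ε) => ae_smoothedSelfIntersectionLocalTime_eq hT.le hC hXC hε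
  have hmem : ∀ ε, 0 < ε → MemLp (smoothedSelfIntersectionLocalTime X T ε) 2 P := fun ε hε =>
    (memLp_congr_ae (heq ε hε)).2 (memLp_integral_of_bound (hC.measurable_incrementKernel ε)
      fun z ω => abs_incrementKernel_le hε z.1 z.2 ω)
  refine ⟨hmem, ?_⟩
  obtain ⟨L, hL⟩ := hC.exists_tendsto_covariance hH hH' ha.le hT
  -- The inner products of the centered local times are covariances of time averages of the kernels,
  -- hence by Fubini the double integrals whose limit is `L`.
  refine exists_tendsto_eLpNorm_of_tendsto_integral_mul
    (fun ε hε => (hmem ε hε).sub (memLp_const _)) (hL.congr' ?_)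
  filter_upwards [eventually_pos_prod] with e he
  refine Eq.trans ?_ (integral_centered_mul (hmem e.1 he.1) (hmem e.2 he.2)).symm
  rw [integral_congr_ae (heq e.1 he.1), integral_congr_ae (heq e.2 he.2),
    show ∫ ω, smoothedSelfIntersectionLocalTime X T e.1 ω *
      smoothedSelfIntersectionLocalTime X T e.2 ω ∂P = _ from
      integral_congr_ae ((heq e.1 he.1).mul (heq e.2 he.2))]
  exact (covariance_integral_integral (hC.measurable_incrementKernel e.1)
    (hC.measurable_incrementKernel e.2) (fun z ω => abs_incrementKernel_le he.1 z.1 z.2 ω)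
    (fun z ω => abs_incrementKernel_le he.2 z.1 z.2 ω)).symm
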